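/- **Setting.** Let $d\ge 1$ and let $\mathcal H_0\neq\{0\}$ be a finite dimensional Hilbert space, attached to each site of $\mathbb Z^d$. Let $(Q_A)$, $A\subset\mathbb Z^d$ finite, be a translation invariant, finite range family of self-adjoint operators, $Q_A$ acting on $\bigotimes_{x\in A}\mathcal H_x$. Let $\kappa_0$ be a self-adjoint operator acting on a finite cluster of sites, with $\|\kappa_0\|\le 1$, and let $\kappa_x$ be its translates. Let $\eta=(\eta_x)_{x\in\mathbb Z^d}$ be i.i.d. real random variables of finite variance, with average denoted $\mathrm{Av}$, and let $\varepsilon\ge 0$. On $\Gamma_K=[-K,K]^d\cap\mathbb Z^d$ with periodic boundary conditions put $$H^{h,\eta}_K=\sum_A Q_A+\sum_{x\in\Gamma_K}(h+\varepsilon\eta_x)\kappa_x ,\qquad F^h_K(\eta)=-\tfrac1\beta\log\mathrm{Tr}\,e^{-\beta H_K^{h,\eta}}\quad(0<\beta<\infty),$$ and for $\beta=\infty$ let $F_K^h(\eta)$ be the ground state energy of $H_K^{h,\eta}$. Let $\langle\cdot\rangle^h_K(\eta)$ be the corresponding Gibbs state (for $\beta=\infty$, its limit as $\beta\to\infty$).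 For a finite set $\Lambda$ of sites let $\langle\cdot\rangle_{\eta_\Lambda}$ denote the average over the $\eta_x$, $x\notin\Lambda$, with $\eta_\Lambda=(\eta_x)_{x\in\Lambda}$ held fixed. Let $r_L\eta$ be $\eta$ with $\eta_x$ replaced by $0$ for $x\in\Gamma_L$, let $(T_x\eta)_y=\eta_{y-x}$, and put $$g^{\delta}_{L,K}(\eta_L)=\tfrac12\Big\langle F^{h+\delta}_K(\eta)-F^{h+\delta}_K(r_L\eta)-F^{h-\delta}_K(\eta)+F^{h-\delta}_K(r_L\eta)\Big\rangle_{\eta_{\Gamma_L}} .$$ Let $\|f\|_{\mathrm{Lip}}=\sup |f(\eta)-f(\eta')|/\|\eta-\eta'\|_1$, the supremum being over $0<\|\eta-\eta'\|_1<\infty$, where $\|\eta\|_1=\sum_x|\eta_x|$. **Lemma.** Let $0<\beta\le\infty$; if $\beta=\infty$, assume in addition that the distribution of $\eta_0$ is absolutely continuous. Then there is a function $\mathcal F:\mathbb R\to\mathbb R$ (the free energy density) such that, almost surely, $F_K^h(\eta)/|\Gamma_K|\to\mathcal F(h)$ as $K\to\infty$ for all $h$; and for every $h\in\mathbb R$ there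 are sequences $K_j\to\infty$ and $\delta_i\to0$, $\delta_i>0$, such that the limits $$G_L(\eta)=\lim_{i\to\infty}\lim_{j\to\infty}\Big(g^{\delta_i}_{L,K_j}-\mathrm{Av}\big[g^{\delta_i}_{L,K_j}\big]\Big)$$ exist for all $L\ge 0$ and all $\eta$, and have the following properties. 1. $G_L$ is integrable and $\mathrm{Av}\,G_L=0$. 2. $G_L(\eta)$ depends on the values of $\eta_x$ only for $x\in\Gamma_L$. 3. $\|G_L\|_{\mathrm{Lip}}\le\varepsilon$. 4. $\langle G_L\rangle_{\eta_\Lambda}=G_{L'}(T_x\eta)$ for all $\eta$ whenever $\Lambda=\Gamma_{L'}-x\subset\Gamma_L$. 5. The one-site function $t\mapsto G_0(t)$ (recall $\Gamma_0=\{0\}$) has a distributional derivative $G_0'$, i.e. a locally integrable function with $\int_a^bG_0'(t)\,dt=G_0(b)-G_0(a)$ for all $a,b$, which for $\beta<\infty$ is Lipschitz with constant at most $\beta\varepsilon^2$. 6. For the same $G_0'$: $G_0'(\eta_0)$ is integrable, $\mathcal F$ has one-sided derivatives at $h$, and $\mathrm{Av}\,G_0'(\eta_0)=\frac{\varepsilon}{2}\Big(\frac{\partial\mathcal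 F}{\partial h+}-\frac{\partial\mathcal F}{\partial h-}\Big)$. 7. If the system satisfies the weak FKG condition, i.e. for all large $K$ and all $x\in\Gamma_K$ the quantity $\langle\kappa_x\rangle_K^h(\eta)$ is nondecreasing in $h$ and in all the $\eta_y$, $y\in\Gamma_K$, jointly, then $G_0$ is nondecreasing. If these quantities are instead all nonincreasing (the weak FKG condition for $-\kappa$), then $G_0$ is nonincreasing. -/

import Mathlib

open MeasureTheory Filter Topology
open scoped ENNReal

noncomputable section

namespace DisorderedLattice

/-- Field configurations `η = (η_x)`, one real number for each site `x ∈ ℤ^d`. -/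
abbrev Fields (d : ℕ) : Type := (Fin d → ℤ) → ℝ

/-- The box `Γ_L = [-L, L]^d ∩ ℤ^d`. -/
def box (d L : ℕ) : Finset (Fin d → ℤ) := Finset.Icc (fun _ => -(L : ℤ)) (fun _ => (L : ℤ))

/-- The translate `A + x` of a finite set of sites. -/
def translateSet {d : ℕ} (x : Fin d → ℤ) (A : Finset (Fin d → ℤ)) : Finset (Fin d → ℤ) :=
  A.map (addRightEmbedding x)

/-- The site `a + x` of `A + x`, for `a ∈ A`. -/
def translateSite {d : ℕ} (x : Fin d → ℤ) (A : Finset (Fin d → ℤ)) (a : A) : translateSet x A :=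
  ⟨(a : Fin d → ℤ) + x, Finset.mem_map_of_mem (addRightEmbedding x) a.2⟩

/-- Periodic box with `(2K+1)^d` sites, i.e. `Γ_K` with opposite faces identified. -/
abbrev Torus (d K : ℕ) : Type := Fin d → ZMod (2 * K + 1)

/-- Reduction of a site of `ℤ^d` modulo the periods. -/
def proj {d : ℕ} (K : ℕ) (x : Fin d → ℤ) : Torus d K := fun i => (x i : ZMod (2 * K + 1))

/-- The representative in `Γ_K = [-K, K]^d` of a site of the torus. -/
def rep {d K : ℕ} (v : Torus d K) : Fin d → ℤ := fun i => (v i).valMinAbs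

section Quantum

variable {σ : Type*}

/-- The local state space is `ℂ^σ`, so the state space of a set `V` of sites is
`⨂_{v ∈ V} ℂ^σ`, with orthonormal basis indexed by `V → σ`, and operators on it are matrices
indexed by `V → σ`.  For an injection `f : A → V` the matrix `embedOp f M` is `M ⊗ 1`: it acts
as `M` on the sites `f a` (`a ∈ A`) and as the identity on the other sites. -/
def embedOp {A V : Type*} (f : A → V) (M : Matrix (A → σ) (A → σ) ℂ) :
    Matrix (V → σ) (V → σ) ℂ :=
  open Classical in
  Matrix.of fun s t => if ∀ v, v ∉ Set.range f → s v = t v then M (s ∘ f) (t ∘ f) else 0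

/-- A translation invariant quantum lattice system on `ℤ^d` with local state space `ℂ^σ`:
a translation invariant finite range interaction `Q`, and a local observable `kappa`
(the operator `κ_0`) acting on a finite cluster of sites and normalized by `‖κ_0‖ ≤ 1`. -/
structure LatticeSystem (d : ℕ) (σ : Type*) [Fintype σ] [DecidableEq σ] where
  /-- The interaction term `Q_A`, an operator on the sites in `A`. -/
  Q : (A : Finset (Fin d → ℤ)) → Matrix (A → σ) (A → σ) ℂ
  Q_isHermitian : ∀ A, (Q A).IsHermitian
  Q_translate : ∀ (x : Fin d → ℤ) (A : Finset (Fin d → ℤ)) (s t : translateSet x A → σ),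
    Q (translateSet x A) s t = Q A (s ∘ translateSite x A) (t ∘ translateSite x A)
  /-- The range of the interaction. -/
  range : ℕ
  Q_finiteRange : ∀ A, (∃ a ∈ A, ∃ b ∈ A, ∃ i, (range : ℤ) < |a i - b i|) → Q A = 0
  /-- The cluster of sites on which `κ_0` acts. -/
  cluster : Finset (Fin d → ℤ)
  /-- The operator `κ_0`. -/
  kappa : Matrix (cluster → σ) (cluster → σ) ℂ
  kappa_isHermitian : kappa.IsHermitian
  kappa_norm_le : ‖Matrix.toEuclideanCLM (𝕜 := ℂ) kappa‖ ≤ 1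

namespace LatticeSystem

variable [Fintype σ] [DecidableEq σ] {d : ℕ} (S : LatticeSystem d σ)

/-- The copy of `Q_A` on the torus, with `A` moved by `v`. -/
def torusQ (K : ℕ) (v : Torus d K) (A : Finset (Fin d → ℤ)) :
    Matrix (Torus d K → σ) (Torus d K → σ) ℂ :=
  embedOp (fun a : A => v + proj K (a : Fin d → ℤ)) (S.Q A)

/-- The operator `κ_v` on the torus. -/
def torusKappa (K : ℕ) (v : Torus d K) : Matrix (Torus d K → σ) (Torus d K → σ) ℂ :=
  embedOp (fun a : S.cluster => v + proj K (a : Fin d → ℤ)) S.kappa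

/-- The Hamiltonian `∑_A Q_A + ∑_x (h + ε η_x) κ_x` in `Γ_K` with periodic boundary conditions.
The first sum is over the nonempty finite sets `A` of sites modulo the periods: it is written as
a sum over the sites `v` and the sets `A ∋ 0`, with the weight `1/|A|` since a set of `|A|`
sites arises in this way from each of its points.  Finite range forces the relevant `A ∋ 0` to
lie in `[-R, R]^d`. -/
def hamiltonian (ε h : ℝ) (K : ℕ) (η : Fields d) :
    Matrix (Torus d K → σ) (Torus d K → σ) ℂ :=
  (∑ v : Torus d K, ∑ A ∈ (box d S.range).powerset with 0 ∈ A,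
      ((A.card : ℂ)⁻¹) • S.torusQ K v A)
    + ∑ v : Torus d K, ((h + ε * η (rep v) : ℝ) : ℂ) • S.torusKappa K v

/-- The finite volume free energy `F_K^h(η)` with periodic boundary conditions: `-β⁻¹ log Z` for
`β < ∞`, and the ground state energy for `β = ∞`. -/
def freeEnergy (β : ℝ≥0∞) (ε h : ℝ) (K : ℕ) (η : Fields d) : ℝ :=
  open Classical in
  if β = ⊤ then sInf (spectrum ℝ (S.hamiltonian ε h K η))
  else -(β.toReal)⁻¹ *
    Real.log (NormedSpace.exp (((-β.toReal : ℝ) : ℂ) • S.hamiltonian ε h K η)).trace.re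

/-- The Gibbs expectation `⟨κ_v⟩` at inverse temperature `b < ∞`. -/
def gibbsKappa (b ε h : ℝ) (K : ℕ) (η : Fields d) (v : Torus d K) : ℝ :=
  (S.torusKappa K v * NormedSpace.exp (((-b : ℝ) : ℂ) • S.hamiltonian ε h K η)).trace.re /
    (NormedSpace.exp (((-b : ℝ) : ℂ) • S.hamiltonian ε h K η)).trace.re

/-- The equilibrium expectation `⟨κ_v⟩_K^h(η)` at `β ≤ ∞`; at `β = ∞` it is the zero temperature
limit of the Gibbs expectations (the average over the space of ground states). -/
def stateKappa (β : ℝ≥0∞) (ε h : ℝ) (K : ℕ) (η : Fields d) (v : Torus d K) : ℝ :=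
  open Classical in
  if β = ⊤ then limUnder atTop (fun b : ℝ => S.gibbsKappa b ε h K η v)
  else S.gibbsKappa β.toReal ε h K η v

/-- The weak FKG condition: on all large periodic boxes, every `⟨κ_x⟩` is nondecreasing in the
uniform field `h` and in the random fields. -/
def WeakFKG (β : ℝ≥0∞) (ε : ℝ) : Prop :=
  ∀ᶠ K : ℕ in atTop, ∀ (v : Torus d K) (h h' : ℝ) (η η' : Fields d), h' ≤ h →
    (∀ y ∈ box d K, η' y ≤ η y) → S.stateKappa β ε h' K η' v ≤ S.stateKappa β ε h K η v

/-- The weak FKG condition for `-κ`: on all large periodic boxes, every `⟨κ_x⟩` is nonincreasing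
in the uniform field `h` and in the random fields. -/
def WeakFKGNeg (β : ℝ≥0∞) (ε : ℝ) : Prop :=
  ∀ᶠ K : ℕ in atTop, ∀ (v : Torus d K) (h h' : ℝ) (η η' : Fields d), h' ≤ h →
    (∀ y ∈ box d K, η' y ≤ η y) → S.stateKappa β ε h K η v ≤ S.stateKappa β ε h' K η' v

end LatticeSystem

end Quantum

/-- The law of independent fields `η_x`, each with distribution `ν`. -/
def fieldLaw (d : ℕ) (ν : Measure ℝ) : Measure (Fields d) :=
  Measure.infinitePi fun _ : Fin d → ℤ => ν

/-- The configuration that equals `η` on `Λ` and `ω` off `Λ`. -/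
def splice {d : ℕ} (Λ : Finset (Fin d → ℤ)) (η ω : Fields d) : Fields d :=
  fun x => if x ∈ Λ then η x else ω x

/-- The conditional average of `f` over the fields outside `Λ`, with `η_Λ` held constant. -/
def condAv {d : ℕ} (ν : Measure ℝ) (Λ : Finset (Fin d → ℤ)) (f : Fields d → ℝ) (η : Fields d) :
    ℝ :=
  ∫ ω, f (splice Λ η ω) ∂(fieldLaw d ν)

/-- `r_L η`: the field `η` with `η_x` set to `0` for all `x ∈ Γ_L`. -/
def resetField {d : ℕ} (L : ℕ) (η : Fields d) : Fields d := splice (box d L) 0 η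

/-- The translate `(T_x η)_y = η_{y - x}`. -/
def shiftField {d : ℕ} (x : Fin d → ℤ) (η : Fields d) : Fields d := fun y => η (y - x)

/-- The `ℓ¹` norm of a configuration, possibly infinite. -/
def l1 {d : ℕ} (η : Fields d) : ℝ≥0∞ := ∑' x, ENNReal.ofReal |η x|

/-- The `ℓ¹`-Lipschitz seminorm. -/
def lipSeminorm {d : ℕ} (f : Fields d → ℝ) : ℝ≥0∞ :=
  ⨆ (η : Fields d) (η' : Fields d) (_ : 0 < l1 (η - η')) (_ : l1 (η - η') < ⊤),
    ENNReal.ofReal |f η - f η'| / l1 (η - η')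

section Statement

variable {σ : Type*} [Fintype σ] [DecidableEq σ] {d : ℕ} (S : LatticeSystem d σ)

/-- `𝓕` is the infinite volume free energy density, as a function of `h`: almost surely, for all
`h`, it is the limit of `F_K^h(η) / |Γ_K|`. -/
def IsFreeEnergyDensity (ν : Measure ℝ) (β : ℝ≥0∞) (ε : ℝ) (𝓕 : ℝ → ℝ) : Prop :=
  ∀ᵐ η ∂(fieldLaw d ν), ∀ h : ℝ,
    Tendsto (fun K : ℕ => S.freeEnergy β ε h K η / ((box d K).card : ℝ)) atTop (𝓝 (𝓕 h))

/-- The free energy second difference `g_{L,K}^δ(η_L)`. -/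
def secondDiff (ν : Measure ℝ) (β : ℝ≥0∞) (ε h : ℝ) (L K : ℕ) (δ : ℝ) (η : Fields d) : ℝ :=
  (1 / 2) * condAv ν (box d L)
    (fun η => S.freeEnergy β ε (h + δ) K η - S.freeEnergy β ε (h + δ) K (resetField L η)
      - S.freeEnergy β ε (h - δ) K η + S.freeEnergy β ε (h - δ) K (resetField L η)) η

/-- `g_{L,K}^δ` minus its average over the random fields. -/
def centeredDiff (ν : Measure ℝ) (β : ℝ≥0∞) (ε h : ℝ) (L K : ℕ) (δ : ℝ) (η : Fields d) : ℝ :=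
  secondDiff S ν β ε h L K δ η - ∫ η', secondDiff S ν β ε h L K δ η' ∂(fieldLaw d ν)

end Statement

/-- `g` is a distributional derivative of the function `f` of one real variable. -/
def IsDistribDeriv (f g : ℝ → ℝ) : Prop :=
  LocallyIntegrable g volume ∧ ∀ a b : ℝ, ∫ t in a..b, g t = f b - f a

/-- The one-site member of the family `G`, as a function of the single variable `η_0`. -/
def oneSite {d : ℕ} (G : ℕ → Fields d → ℝ) : ℝ → ℝ := fun t => G 0 (fun _ => t)

end DisorderedLattice

end

/-!
Cutting a periodic box into smaller boxes changes the free energy by at most a boundary term, so the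
mean free energy per site converges. By the Efron–Stein inequality the variance of the free energy
is of the order of the volume, which makes the fluctuations per site summable along the box sizes
`n²` and gives almost sure convergence there; interpolation between consecutive squares, and the
Lipschitz dependence on `h`, give it along all sizes and for all `h` at once.

Conditional averages of the free energy, centered, are Lipschitz in every field with constant `ε`,
uniformly in `K`, `L` and `h`, so a diagonal subsequence produces the iterated limits at `h ± δ`,
and `G_L` is half their difference. The free energy is concave in each field, with supergradient
`ε ⟨κ⟩`. Supergradients pass to limits; at positive temperature the one-site slopes are in addition
equi-Lipschitz. The mean slope at `h ± δ` is `ε` times a supergradient of the free energy density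
there, and as `δ → 0` these supergradients tend to the one-sided derivatives at `h`.
-/

namespace DisorderedLattice

/-! ### Gibbs states of Hermitian matrices -/

section SpectralTraces

open Matrix
open scoped Matrix.Norms.L2Operator

lemma isHermitian_ofReal_smul {n : Type*} {A : Matrix n n ℂ} (hA : A.IsHermitian) (r : ℝ) :
    ((r : ℂ) • A).IsHermitian := by
  rw [Matrix.IsHermitian, conjTranspose_smul, hA.eq, Complex.star_def, Complex.conj_ofReal]

variable {n : Type*} [Fintype n] [DecidableEq n] {A B : Matrix n n ℂ}

lemma norm_entry_le_l2_opNorm (B : Matrix n n ℂ) (i j : n) : ‖B i j‖ ≤ ‖B‖ := by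
  have h := l2_opNorm_mulVec B (EuclideanSpace.single j 1)
  rw [PiLp.norm_single, norm_one, mul_one] at h
  exact (by simp : ‖B i j‖ = _).trans_le ((PiLp.norm_apply_le _ i).trans h)

lemma norm_entry_conj_unitary_le (U : unitaryGroup n ℂ) (B : Matrix n n ℂ) (i j : n) :
    ‖(star (U : Matrix n n ℂ) * B * (U : Matrix n n ℂ)) i j‖ ≤ ‖B‖ :=
  (norm_entry_le_l2_opNorm _ i j).trans_eq <| by
    rw [CStarRing.norm_mul_coe_unitary, ← Unitary.coe_star, CStarRing.norm_coe_unitary_mul]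

lemma cfc_eq_conj_diagonal (hA : A.IsHermitian) (f : ℝ → ℝ) :
    cfc f A = (hA.eigenvectorUnitary : Matrix n n ℂ)
      * diagonal (fun i => (f (hA.eigenvalues i) : ℂ))
      * star (hA.eigenvectorUnitary : Matrix n n ℂ) :=
  hA.cfc_eq f

lemma trace_mul_cfc (hA : A.IsHermitian) (B : Matrix n n ℂ) (f : ℝ → ℝ) :
    (B * cfc f A).trace.re = ∑ i, ((star (hA.eigenvectorUnitary : Matrix n n ℂ) * B
      * hA.eigenvectorUnitary) i i).re * f (hA.eigenvalues i) := by
  rw [cfc_eq_conj_diagonal hA, ← mul_assoc, trace_mul_comm, ← mul_assoc, ← mul_assoc, trace,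
    Complex.re_sum]
  exact Finset.sum_congr rfl fun i _ => by rw [diag_apply, mul_diagonal, Complex.re_mul_ofReal]

lemma trace_cfc (hA : A.IsHermitian) (f : ℝ → ℝ) :
    (cfc f A).trace.re = ∑ i, f (hA.eigenvalues i) := by
  simpa using trace_mul_cfc hA 1 f

lemma exp_eq_cfc (hA : A.IsHermitian) : NormedSpace.exp A = cfc Real.exp A :=
  (CFC.real_exp_eq_normedSpace_exp hA.isSelfAdjoint).symm

lemma exp_ofReal_smul_eq_cfc (hA : A.IsHermitian) (r : ℝ) :
    NormedSpace.exp ((r : ℂ) • A) = cfc (fun x => Real.exp (r * x)) A := by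
  rw [exp_eq_cfc (isHermitian_ofReal_smul hA r), Complex.coe_smul,
    ← cfc_comp_smul r Real.exp A (ha := hA.isSelfAdjoint)]
  rfl

lemma trace_exp_pos [Nonempty n] (hA : A.IsHermitian) : 0 < (NormedSpace.exp A).trace.re := by
  rw [exp_eq_cfc hA, trace_cfc hA]
  exact Finset.sum_pos (fun i _ => Real.exp_pos _) Finset.univ_nonempty

lemma abs_trace_mul_exp_le (hA : A.IsHermitian) (B : Matrix n n ℂ) :
    |(B * NormedSpace.exp A).trace.re| ≤ ‖B‖ * (NormedSpace.exp A).trace.re := by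
  rw [exp_eq_cfc hA, trace_mul_cfc hA, trace_cfc hA, Finset.mul_sum]
  refine (Finset.abs_sum_le_sum_abs _ _).trans (Finset.sum_le_sum fun i _ => ?_)
  rw [abs_mul, Real.abs_exp]
  gcongr
  exact (Complex.abs_re_le_norm _).trans (norm_entry_conj_unitary_le _ B i i)

/-- The squared overlaps `|⟨u_i, v_j⟩|²` of the eigenvectors of two Hermitian matrices. They
reduce the trace of a product of functions of the two matrices to a double sum over their
eigenvalues. -/
noncomputable def spectralOverlap (hA : A.IsHermitian) (hB : B.IsHermitian) (i j : n) : ℝ :=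
  Complex.normSq ((star (hA.eigenvectorUnitary : Matrix n n ℂ) * hB.eigenvectorUnitary) i j)

lemma spectralOverlap_nonneg (hA : A.IsHermitian) (hB : B.IsHermitian) (i j : n) :
    0 ≤ spectralOverlap hA hB i j :=
  Complex.normSq_nonneg _

lemma spectralOverlap_comm (hA : A.IsHermitian) (hB : B.IsHermitian) (i j : n) :
    spectralOverlap hA hB i j = spectralOverlap hB hA j i := by
  rw [spectralOverlap, spectralOverlap, ← Complex.normSq_conj, ← Complex.star_def, ← star_apply,
    star_mul, star_star]

lemma trace_cfc_mul_cfc (hA : A.IsHermitian) (hB : B.IsHermitian) (f g : ℝ → ℝ) :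
    (cfc f A * cfc g B).trace.re = ∑ i, ∑ j,
      spectralOverlap hA hB i j * (f (hA.eigenvalues i) * g (hB.eigenvalues j)) := by
  rw [trace_mul_comm, trace_mul_cfc hA, cfc_eq_conj_diagonal hB]
  refine Finset.sum_congr rfl fun i _ => ?_
  set W := star (hA.eigenvectorUnitary : Matrix n n ℂ) * (hB.eigenvectorUnitary : Matrix n n ℂ)
    with hW
  have hconj : star (hA.eigenvectorUnitary : Matrix n n ℂ)
      * ((hB.eigenvectorUnitary : Matrix n n ℂ)
        * diagonal (fun j => (g (hB.eigenvalues j) : ℂ))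
        * star (hB.eigenvectorUnitary : Matrix n n ℂ))
      * hA.eigenvectorUnitary
      = W * diagonal (fun j => (g (hB.eigenvalues j) : ℂ)) * star W := by
    simp only [hW, star_mul, star_star, mul_assoc]
  rw [hconj, mul_apply, Complex.re_sum, Finset.sum_mul]
  refine Finset.sum_congr rfl fun j _ => ?_
  rw [mul_diagonal, star_apply, mul_right_comm, Complex.star_def, Complex.mul_conj,
    ← Complex.ofReal_mul, Complex.ofReal_re, spectralOverlap]
  ring

lemma trace_exp_eq_sum_overlap_left (hA : A.IsHermitian) (hB : B.IsHermitian) :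
    (NormedSpace.exp A).trace.re
      = ∑ i, ∑ j, spectralOverlap hA hB i j * Real.exp (hA.eigenvalues i) := by
  rw [exp_eq_cfc hA]
  simpa [cfc_const_one ℝ B hB.isSelfAdjoint] using trace_cfc_mul_cfc hA hB Real.exp fun _ => 1

lemma trace_exp_eq_sum_overlap_right (hA : A.IsHermitian) (hB : B.IsHermitian) :
    (NormedSpace.exp B).trace.re
      = ∑ i, ∑ j, spectralOverlap hA hB i j * Real.exp (hB.eigenvalues j) := by
  rw [trace_exp_eq_sum_overlap_left hB hA, Finset.sum_comm]
  simp only [spectralOverlap_comm hA hB]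

lemma trace_sub_mul_exp (hA : A.IsHermitian) (hB : B.IsHermitian) :
    ((B - A) * NormedSpace.exp A).trace.re = ∑ i, ∑ j, spectralOverlap hA hB i j
      * ((hB.eigenvalues j - hA.eigenvalues i) * Real.exp (hA.eigenvalues i)) := by
  have hBA := trace_cfc_mul_cfc hA hB Real.exp id
  have hAA := trace_cfc_mul_cfc hA hB (fun x => x * Real.exp x) fun _ => 1
  rw [cfc_id ℝ B hB.isSelfAdjoint, trace_mul_comm] at hBA
  rw [cfc_const_one ℝ B hB.isSelfAdjoint, mul_one, cfc_mul (fun x => x) Real.exp A,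
    cfc_id' ℝ A hA.isSelfAdjoint] at hAA
  rw [sub_mul, trace_sub, Complex.sub_re, exp_eq_cfc hA, hBA, hAA]
  simp only [← Finset.sum_sub_distrib, id]
  exact Finset.sum_congr rfl fun i _ => Finset.sum_congr rfl fun j _ => by ring

lemma trace_sub_mul_sub_mul_exp (hA : A.IsHermitian) (hB : B.IsHermitian) :
    ((B - A) * (B - A) * NormedSpace.exp A).trace.re = ∑ i, ∑ j, spectralOverlap hA hB i j
      * ((hB.eigenvalues j - hA.eigenvalues i) ^ 2 * Real.exp (hA.eigenvalues i)) := by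
  have hBB := trace_cfc_mul_cfc hA hB Real.exp fun x => x * x
  have hAB := trace_cfc_mul_cfc hA hB (fun x => x * Real.exp x) id
  have hAA := trace_cfc_mul_cfc hA hB (fun x => x * (x * Real.exp x)) fun _ => 1
  have hcomm : cfc Real.exp A * A = A * cfc Real.exp A := by
    simpa [cfc_id ℝ A hA.isSelfAdjoint] using (cfc_commute_cfc Real.exp id A).eq
  rw [cfc_mul (fun x => x) (fun x => x) B, cfc_id' ℝ B hB.isSelfAdjoint] at hBB
  rw [cfc_mul (fun x => x) Real.exp A, cfc_id' ℝ A hA.isSelfAdjoint,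
    cfc_id ℝ B hB.isSelfAdjoint] at hAB
  rw [cfc_const_one ℝ B hB.isSelfAdjoint, mul_one, cfc_mul (fun x => x) (fun x => x * Real.exp x) A,
    cfc_mul (fun x => x) Real.exp A, cfc_id' ℝ A hA.isSelfAdjoint] at hAA
  have hexpand : ((B - A) * (B - A) * cfc Real.exp A).trace
      = (cfc Real.exp A * (B * B)).trace - 2 * (A * cfc Real.exp A * B).trace
        + (A * (A * cfc Real.exp A)).trace := by
    have hABe : (A * B * cfc Real.exp A).trace = (A * cfc Real.exp A * B).trace := by
      rw [mul_assoc, trace_mul_comm, mul_assoc, hcomm, trace_mul_comm]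
    have hBAe : (B * A * cfc Real.exp A).trace = (A * cfc Real.exp A * B).trace := by
      rw [mul_assoc, trace_mul_comm]
    simp only [sub_mul, mul_sub, trace_sub]
    rw [trace_mul_comm (B * B), hABe, hBAe, mul_assoc A A]
    ring
  rw [exp_eq_cfc hA, hexpand, Complex.add_re, Complex.sub_re, hBB, hAA,
    show (2 : ℂ) = ((2 : ℝ) : ℂ) by norm_num, Complex.re_ofReal_mul, hAB]
  simp only [Finset.mul_sum, ← Finset.sum_sub_distrib, ← Finset.sum_add_distrib, id]
  exact Finset.sum_congr rfl fun i _ => Finset.sum_congr rfl fun j _ => by ring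

end SpectralTraces

section GibbsMeans

open Matrix
open scoped Matrix.Norms.L2Operator

variable {n : Type*} [Fintype n] [DecidableEq n] {A B X : Matrix n n ℂ}

/-- The logarithm of the partition function `Tr e^A`. The inverse temperature is absorbed into
`A = -β H`. -/
noncomputable def logPartition (A : Matrix n n ℂ) : ℝ :=
  Real.log (NormedSpace.exp A).trace.re

/-- The expectation of `B` in the Gibbs state with density matrix `e^A / Tr e^A`, where
`A = -β H`. -/
noncomputable def gibbsMean (A B : Matrix n n ℂ) : ℝ :=
  (B * NormedSpace.exp A).trace.re / (NormedSpace.exp A).trace.re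

lemma gibbsMean_add (A B C : Matrix n n ℂ) :
    gibbsMean A (B + C) = gibbsMean A B + gibbsMean A C := by
  simp only [gibbsMean, add_mul, trace_add, Complex.add_re, add_div]

lemma gibbsMean_smul (A B : Matrix n n ℂ) (r : ℝ) :
    gibbsMean A ((r : ℂ) • B) = r * gibbsMean A B := by
  simp only [gibbsMean, smul_mul_assoc, trace_smul, smul_eq_mul, Complex.re_ofReal_mul,
    mul_div_assoc]

lemma gibbsMean_one [Nonempty n] (hA : A.IsHermitian) : gibbsMean A 1 = 1 := by
  rw [gibbsMean, one_mul, div_self (trace_exp_pos hA).ne']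

lemma abs_gibbsMean_le [Nonempty n] (hA : A.IsHermitian) (B : Matrix n n ℂ) :
    |gibbsMean A B| ≤ ‖B‖ := by
  rw [gibbsMean, abs_div, abs_of_pos (trace_exp_pos hA), div_le_iff₀ (trace_exp_pos hA)]
  exact abs_trace_mul_exp_le hA B

lemma exp_logPartition [Nonempty n] (hA : A.IsHermitian) :
    Real.exp (logPartition A) = (NormedSpace.exp A).trace.re :=
  Real.exp_log (trace_exp_pos hA)

lemma continuous_gibbsMean [Nonempty n] {Y : Type*} [TopologicalSpace Y] {A : Y → Matrix n n ℂ}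
    (hcont : Continuous A) (hA : ∀ y, (A y).IsHermitian) (B : Matrix n n ℂ) :
    Continuous fun y => gibbsMean (A y) B := by
  have hexp : Continuous fun y => NormedSpace.exp (A y) := by
    let _ : NormedAlgebra ℚ (Matrix n n ℂ) := NormedAlgebra.restrictScalars ℚ ℂ _
    exact NormedSpace.exp_continuous.comp hcont
  refine Continuous.div ?_ ?_ fun y => (trace_exp_pos (hA y)).ne'
  · exact Complex.continuous_re.comp (continuous_const.mul hexp).matrix_trace
  · exact Complex.continuous_re.comp hexp.matrix_trace

/-- The Peierls–Bogoliubov inequality: Jensen's inequality for `exp` and the weights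
`|⟨u_i, v_j⟩|² e^{a_i} / Tr e^A`. -/
lemma gibbsMean_sub_le_logPartition_sub [Nonempty n] (hA : A.IsHermitian) (hB : B.IsHermitian) :
    gibbsMean A (B - A) ≤ logPartition B - logPartition A := by
  have hZ := trace_exp_pos hA
  let w : n × n → ℝ := fun p => spectralOverlap hA hB p.1 p.2 * Real.exp (hA.eigenvalues p.1)
    / (NormedSpace.exp A).trace.re
  have hw : ∀ p ∈ Finset.univ, 0 ≤ w p := fun p _ =>
    div_nonneg (mul_nonneg (spectralOverlap_nonneg hA hB _ _) (Real.exp_pos _).le) hZ.le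
  have hw1 : ∑ p, w p = 1 := by
    rw [← Finset.sum_div, Fintype.sum_prod_type, ← trace_exp_eq_sum_overlap_left hA hB,
      div_self hZ.ne']
  have hmean : ∑ p, w p • (hB.eigenvalues p.2 - hA.eigenvalues p.1) = gibbsMean A (B - A) := by
    rw [gibbsMean, trace_sub_mul_exp hA hB, Fintype.sum_prod_type]
    simp only [Finset.sum_div]
    exact Finset.sum_congr rfl fun i _ => Finset.sum_congr rfl fun j _ => by
      simp only [w, smul_eq_mul]; ring
  have hexp : ∑ p, w p • Real.exp (hB.eigenvalues p.2 - hA.eigenvalues p.1)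
      = (NormedSpace.exp B).trace.re / (NormedSpace.exp A).trace.re := by
    rw [trace_exp_eq_sum_overlap_right hA hB, Fintype.sum_prod_type]
    simp only [Finset.sum_div]
    exact Finset.sum_congr rfl fun i _ => Finset.sum_congr rfl fun j _ => by
      simp only [w, smul_eq_mul, Real.exp_sub]
      field_simp
  have hjensen := convexOn_exp.map_sum_le hw hw1
    (p := fun p : n × n => hB.eigenvalues p.2 - hA.eigenvalues p.1) fun _ _ => Set.mem_univ _
  rw [hmean, hexp] at hjensen
  have hlog := (Real.le_log_iff_exp_le (div_pos (trace_exp_pos hB) hZ)).2 hjensen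
  rwa [Real.log_div (trace_exp_pos hB).ne' hZ.ne'] at hlog

lemma sub_mul_exp_sub_exp_le (x y : ℝ) :
    (x - y) * (Real.exp x - Real.exp y) ≤ (x - y) ^ 2 * (Real.exp x + Real.exp y) := by
  wlog h : y ≤ x generalizing x y
  · linarith [this y x (le_of_not_ge h)]
  have htangent : Real.exp x - Real.exp y ≤ (x - y) * Real.exp x := by
    have hmul : Real.exp y = Real.exp x * Real.exp (y - x) := by rw [← Real.exp_add]; ring_nf
    nlinarith [Real.add_one_le_exp (y - x), Real.exp_pos x]
  nlinarith [mul_le_mul_of_nonneg_left htangent (sub_nonneg.2 h),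
    mul_nonneg (sq_nonneg (x - y)) (Real.exp_pos y).le]

lemma trace_sub_mul_exp_sub_exp_le (hA : A.IsHermitian) (hB : B.IsHermitian) :
    ((B - A) * NormedSpace.exp B).trace.re - ((B - A) * NormedSpace.exp A).trace.re
      ≤ ((B - A) * (B - A) * NormedSpace.exp A).trace.re
        + ((B - A) * (B - A) * NormedSpace.exp B).trace.re := by
  have hfirst : ((B - A) * NormedSpace.exp B).trace.re
      = -∑ i, ∑ j, spectralOverlap hB hA i j
        * ((hA.eigenvalues j - hB.eigenvalues i) * Real.exp (hB.eigenvalues i)) := by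
    rw [← trace_sub_mul_exp hB hA, ← neg_sub, neg_mul, trace_neg, Complex.neg_re]
  have hsquare : ((B - A) * (B - A) * NormedSpace.exp B).trace.re
      = ∑ i, ∑ j, spectralOverlap hB hA i j
        * ((hA.eigenvalues j - hB.eigenvalues i) ^ 2 * Real.exp (hB.eigenvalues i)) := by
    rw [← trace_sub_mul_sub_mul_exp hB hA, ← neg_sub A B, neg_mul_neg]
  have hsquare' : ((B - A) * (B - A) * NormedSpace.exp A).trace.re
      = ∑ i, ∑ j, spectralOverlap hA hB i j
        * ((hB.eigenvalues j - hA.eigenvalues i) ^ 2 * Real.exp (hA.eigenvalues i)) := by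
    rw [← trace_sub_mul_sub_mul_exp hA hB]
  rw [hfirst, hsquare, hsquare', trace_sub_mul_exp hA hB,
    Finset.sum_comm (f := fun i j => spectralOverlap hB hA i j * ((_ - _) * _)),
    Finset.sum_comm (f := fun i j => spectralOverlap hB hA i j * ((_ - _) ^ 2 * _))]
  simp only [← Finset.sum_neg_distrib, ← Finset.sum_sub_distrib, ← Finset.sum_add_distrib]
  refine Finset.sum_le_sum fun i _ => Finset.sum_le_sum fun j _ => ?_
  have hpoint := mul_le_mul_of_nonneg_left
    (sub_mul_exp_sub_exp_le (hB.eigenvalues j) (hA.eigenvalues i))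
    (spectralOverlap_nonneg hA hB i j)
  rw [spectralOverlap_comm hB hA j i]
  linarith

lemma exp_sub_ofReal_smul_one (A : Matrix n n ℂ) (c : ℝ) :
    NormedSpace.exp (A - (c : ℂ) • 1) = (Real.exp (-c) : ℂ) • NormedSpace.exp A := by
  have hscalar : NormedSpace.exp (((-c : ℝ) : ℂ) • (1 : Matrix n n ℂ))
      = (Real.exp (-c) : ℂ) • 1 := by
    rw [← Algebra.algebraMap_eq_smul_one, ← Algebra.algebraMap_eq_smul_one,
      ← NormedSpace.algebraMap_exp_comm, ← Complex.exp_eq_exp_ℂ, Complex.ofReal_exp]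
  rw [sub_eq_add_neg, ← neg_smul, ← Complex.ofReal_neg, Matrix.exp_add_of_commute _ _
    ((Commute.one_right A).smul_right _), hscalar, mul_smul_comm, mul_one]

/-- Subtracting the logarithms of their partition functions normalizes both density matrices. -/
lemma gibbsMean_sub_gibbsMean_le_second_moments [Nonempty n] (hA : A.IsHermitian)
    (hB : B.IsHermitian) {D : Matrix n n ℂ}
    (hD : D = B - A - ((logPartition B - logPartition A : ℝ) : ℂ) • 1) :
    gibbsMean B D - gibbsMean A D ≤ gibbsMean A (D * D) + gibbsMean B (D * D) := by
  have hnormal : ∀ {H : Matrix n n ℂ}, H.IsHermitian → ∀ Y : Matrix n n ℂ,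
      (Y * NormedSpace.exp (H - (logPartition H : ℂ) • 1)).trace.re = gibbsMean H Y := by
    intro H hH Y
    rw [exp_sub_ofReal_smul_one, mul_smul_comm, trace_smul, smul_eq_mul, Complex.re_ofReal_mul,
      Real.exp_neg, exp_logPartition hH, gibbsMean, inv_mul_eq_div]
  have hdiff : B - (logPartition B : ℂ) • 1 - (A - (logPartition A : ℂ) • 1) = D := by
    rw [hD, Complex.ofReal_sub, sub_smul]; abel
  have h := trace_sub_mul_exp_sub_exp_le
    (hA.sub (isHermitian_ofReal_smul isHermitian_one (logPartition A)))
    (hB.sub (isHermitian_ofReal_smul isHermitian_one (logPartition B)))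
  simpa only [hdiff, hnormal hA, hnormal hB] using h

lemma gibbsMean_add_self_sub_le [Nonempty n] (hA : A.IsHermitian) (hX : X.IsHermitian) :
    gibbsMean (A + X) X - gibbsMean A X
      ≤ 2 * ‖X‖ ^ 2 + 4 * ‖X‖ * (gibbsMean (A + X) X - gibbsMean A X) := by
  have hAX := hA.add hX
  set k := logPartition (A + X) - logPartition A
  have hlower : gibbsMean A X ≤ k := by
    simpa using gibbsMean_sub_le_logPartition_sub hA hAX
  have hupper : k ≤ gibbsMean (A + X) X := by
    have h := gibbsMean_sub_le_logPartition_sub hAX hA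
    rw [show A - (A + X) = ((-1 : ℝ) : ℂ) • X by simp, gibbsMean_smul] at h
    linarith
  have hmean : ∀ {H : Matrix n n ℂ}, H.IsHermitian →
      gibbsMean H (X - (k : ℂ) • 1) = gibbsMean H X - k := by
    intro H hH
    rw [sub_eq_add_neg, ← neg_smul, ← Complex.ofReal_neg, gibbsMean_add, gibbsMean_smul,
      gibbsMean_one hH]
    ring
  have hsecond : ∀ {H : Matrix n n ℂ}, H.IsHermitian →
      gibbsMean H ((X - (k : ℂ) • 1) * (X - (k : ℂ) • 1))
        ≤ ‖X‖ ^ 2 - 2 * k * gibbsMean H X + k ^ 2 := by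
    intro H hH
    have hexpand : (X - (k : ℂ) • 1) * (X - (k : ℂ) • 1)
        = X * X + (((-(2 * k) : ℝ) : ℂ) • X + ((k ^ 2 : ℝ) : ℂ) • 1) := by
      simp only [sub_mul, mul_sub, smul_mul_assoc, mul_smul_comm, one_mul, mul_one]
      push_cast
      module
    rw [hexpand, gibbsMean_add, gibbsMean_add, gibbsMean_smul, gibbsMean_smul, gibbsMean_one hH]
    have hXX : gibbsMean H (X * X) ≤ ‖X‖ ^ 2 :=
      (le_abs_self _).trans <| (abs_gibbsMean_le hH _).trans <| sq ‖X‖ ▸ norm_mul_le X X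
    linarith
  have hmain := gibbsMean_sub_gibbsMean_le_second_moments hA hAX (D := X - (k : ℂ) • 1)
    (by rw [add_sub_cancel_left])
  rw [hmean hAX, hmean hA] at hmain
  have hbound := hsecond hA
  have hbound' := hsecond hAX
  have hm := abs_le.1 (abs_gibbsMean_le hA X)
  have hm' := abs_le.1 (abs_gibbsMean_le hAX X)
  have hwidth : (gibbsMean (A + X) X - gibbsMean A X) ^ 2
      ≤ 2 * ‖X‖ * (gibbsMean (A + X) X - gibbsMean A X) := by
    rw [sq]; exact mul_le_mul_of_nonneg_right (by linarith) (by linarith)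
  have hk : (k - gibbsMean A X) ^ 2 ≤ (gibbsMean (A + X) X - gibbsMean A X) ^ 2 := by gcongr
  have hk' : (gibbsMean (A + X) X - k) ^ 2 ≤ (gibbsMean (A + X) X - gibbsMean A X) ^ 2 := by gcongr
  linarith [sq_nonneg (gibbsMean A X), sq_nonneg (gibbsMean (A + X) X)]

/-- Applied to `s X` with small `s`, the preceding increment bound controls the slope of
`s ↦ ⟨X⟩_{A + s X}`. -/
lemma gibbsMean_add_self_sub_le_two_mul_sq [Nonempty n] (hA : A.IsHermitian)
    (hX : X.IsHermitian) : gibbsMean (A + X) X - gibbsMean A X ≤ 2 * ‖X‖ ^ 2 := by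
  set f : ℝ → ℝ := fun s => gibbsMean (A + (s : ℂ) • X) X with hf
  have hherm : ∀ s : ℝ, (A + (s : ℂ) • X).IsHermitian := fun s =>
    hA.add (isHermitian_ofReal_smul hX s)
  have hcont : Continuous f := continuous_gibbsMean (by fun_prop) hherm X
  have hincrement : ∀ s z, s < z → slope f s z * (1 - 4 * ‖X‖ * (z - s)) ≤ 2 * ‖X‖ ^ 2 := by
    intro s z hsz
    have hpos := sub_pos.2 hsz
    have h := gibbsMean_add_self_sub_le (hherm s) (isHermitian_ofReal_smul hX (z - s))
    rw [add_assoc, ← add_smul, ← Complex.ofReal_add, add_sub_cancel, gibbsMean_smul,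
      gibbsMean_smul, norm_smul, Complex.norm_real, Real.norm_of_nonneg hpos.le] at h
    rw [slope_def_field, div_mul_eq_mul_div, div_le_iff₀ hpos]
    refine le_of_mul_le_mul_left ?_ hpos
    linarith
  have hslope : ∀ s ∈ Set.Ico (0 : ℝ) 1, ∀ r, 2 * ‖X‖ ^ 2 < r →
      ∃ᶠ z in 𝓝[>] s, slope f s z < r := by
    intro s _ r hr
    have hlim : Tendsto (fun z => r * (1 - 4 * ‖X‖ * (z - s))) (𝓝[>] s) (𝓝 r) := by
      have : Continuous fun z => r * (1 - 4 * ‖X‖ * (z - s)) := by fun_prop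
      simpa using (this.tendsto s).mono_left nhdsWithin_le_nhds
    refine Eventually.frequently ?_
    filter_upwards [hlim.eventually_const_lt hr, self_mem_nhdsWithin] with z hz hsz
    have hfactor : 0 < 1 - 4 * ‖X‖ * (z - s) :=
      pos_of_mul_pos_right ((by positivity : 0 ≤ 2 * ‖X‖ ^ 2).trans_lt hz)
        ((by positivity : 0 ≤ 2 * ‖X‖ ^ 2).trans hr.le)
    exact lt_of_mul_lt_mul_right ((hincrement s z hsz).trans_lt hz) hfactor.le
  have hle := image_le_of_liminf_slope_right_le_deriv_boundary
    (B := fun s => f 0 + 2 * ‖X‖ ^ 2 * s) (B' := fun _ => 2 * ‖X‖ ^ 2) hcont.continuousOn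
    (by simp) (by fun_prop)
    (fun s _ => by simpa using (((hasDerivAt_id s).const_mul _).const_add (f 0)).hasDerivWithinAt)
    hslope (Set.right_mem_Icc.2 zero_le_one)
  simp only [hf, Complex.ofReal_one, one_smul, Complex.ofReal_zero, zero_smul, add_zero,
    mul_one] at hle
  linarith

end GibbsMeans

section Laplace

variable {ι : Type*} [Fintype ι] [Nonempty ι]

lemma tendsto_neg_inv_mul_log_sum_exp (a : ι → ℝ) :
    Tendsto (fun b : ℝ => -b⁻¹ * Real.log (∑ i, Real.exp (-b * a i))) atTop (𝓝 (⨅ i, a i)) := by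
  have hmin : ∀ i, ⨅ i, a i ≤ a i := ciInf_le (Set.finite_range a).bddBelow
  obtain ⟨i₀, hi₀⟩ := exists_eq_ciInf_of_finite (f := a)
  have hlower : Tendsto (fun b : ℝ => (⨅ i, a i) - b⁻¹ * Real.log (Fintype.card ι)) atTop
      (𝓝 (⨅ i, a i)) := by
    simpa using (tendsto_const_nhds (x := ⨅ i, a i)).sub
      (tendsto_inv_atTop_zero.mul_const (Real.log (Fintype.card ι)))
  refine tendsto_of_tendsto_of_tendsto_of_le_of_le' hlower tendsto_const_nhds ?_ ?_
  all_goals filter_upwards [eventually_gt_atTop 0] with b hb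
  · have hsum : ∑ i, Real.exp (-b * a i) ≤ Fintype.card ι * Real.exp (-b * ⨅ i, a i) := by
      rw [← nsmul_eq_mul, ← Finset.card_univ, ← Finset.sum_const]
      exact Finset.sum_le_sum fun i _ => Real.exp_le_exp.2 <|
        mul_le_mul_of_nonpos_left (hmin i) (neg_nonpos.2 hb.le)
    have hlog := Real.log_le_log
      (Finset.sum_pos (fun i _ => Real.exp_pos _) Finset.univ_nonempty) hsum
    rw [Real.log_mul (by simp) (Real.exp_pos _).ne', Real.log_exp] at hlog
    have hscale : b⁻¹ * (Real.log (Fintype.card ι) + -b * ⨅ i, a i)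
        = b⁻¹ * Real.log (Fintype.card ι) - ⨅ i, a i := by field_simp; ring
    linarith [mul_le_mul_of_nonneg_left hlog (inv_pos.2 hb).le]
  · have hsum : Real.exp (-b * a i₀) ≤ ∑ i, Real.exp (-b * a i) :=
      Finset.single_le_sum (f := fun i => Real.exp (-b * a i)) (fun i _ => (Real.exp_pos _).le)
        (Finset.mem_univ i₀)
    have hlog := Real.log_le_log (Real.exp_pos _) hsum
    rw [Real.log_exp, hi₀] at hlog
    have hscale : b⁻¹ * (-b * ⨅ i, a i) = -⨅ i, a i := by field_simp
    linarith [mul_le_mul_of_nonneg_left hlog (inv_pos.2 hb).le]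

lemma exists_tendsto_sum_mul_exp_div_sum_exp (w a : ι → ℝ) :
    ∃ l, Tendsto (fun b : ℝ => (∑ i, w i * Real.exp (-b * a i)) / ∑ i, Real.exp (-b * a i))
      atTop (𝓝 l) := by
  have hmin : ∀ i, ⨅ i, a i ≤ a i := ciInf_le (Set.finite_range a).bddBelow
  obtain ⟨i₀, hi₀⟩ := exists_eq_ciInf_of_finite (f := a)
  have hexp : ∀ i, Tendsto (fun b : ℝ => Real.exp (-b * (a i - ⨅ i, a i))) atTop
      (𝓝 (if a i = ⨅ i, a i then 1 else 0)) := by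
    intro i
    split_ifs with hi
    · simp [hi]
    · have hgap : 0 < a i - ⨅ i, a i := sub_pos.2 (lt_of_le_of_ne (hmin i) (Ne.symm hi))
      simp only [neg_mul]
      exact Real.tendsto_exp_neg_atTop_nhds_zero.comp (tendsto_id.atTop_mul_const hgap)
  have hnum := tendsto_finsetSum Finset.univ fun i _ => (hexp i).const_mul (w i)
  have hden := tendsto_finsetSum Finset.univ fun i _ => hexp i
  have hden₀ : ∑ i, (if a i = ⨅ i, a i then 1 else 0 : ℝ) ≠ 0 :=
    (Finset.sum_pos' (fun i _ => by positivity) ⟨i₀, Finset.mem_univ _, by simp [hi₀]⟩).ne'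
  refine ⟨_, (hnum.div hden hden₀).congr fun b => ?_⟩
  have hshift : ∀ i, Real.exp (-b * (a i - ⨅ i, a i))
      = Real.exp (b * ⨅ i, a i) * Real.exp (-b * a i) := fun i => by
    rw [← Real.exp_add]; ring_nf
  simp only [Pi.div_apply, hshift, mul_left_comm (w _), ← Finset.mul_sum]
  exact mul_div_mul_left _ _ (Real.exp_pos _).ne'

end Laplace

section EquilibriumStates

open Matrix
open scoped Matrix.Norms.L2Operator

variable {n : Type*} [Fintype n] [DecidableEq n] {H H' B : Matrix n n ℂ} {β : ℝ≥0∞}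

open Classical in
/-- The free energy of the Hamiltonian `H` at inverse temperature `β ≤ ∞`; at `β = ∞` it is the
ground state energy. -/
noncomputable def eqFreeEnergy (β : ℝ≥0∞) (H : Matrix n n ℂ) : ℝ :=
  if β = ⊤ then sInf (spectrum ℝ H)
  else -(β.toReal)⁻¹ * logPartition (((-β.toReal : ℝ) : ℂ) • H)

open Classical in
/-- The equilibrium expectation of `B` for the Hamiltonian `H` at inverse temperature `β ≤ ∞`; at
`β = ∞` it is the zero temperature limit of the Gibbs expectations. -/
noncomputable def eqState (β : ℝ≥0∞) (H B : Matrix n n ℂ) : ℝ :=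
  if β = ⊤ then limUnder atTop fun b : ℝ => gibbsMean (((-b : ℝ) : ℂ) • H) B
  else gibbsMean (((-β.toReal : ℝ) : ℂ) • H) B

open Classical in
/-- The filter of finite inverse temperatures approaching `β`. It reduces statements about
equilibrium at `β ≤ ∞` to finite inverse temperatures. -/
noncomputable def invTempFilter (β : ℝ≥0∞) : Filter ℝ := if β = ⊤ then atTop else pure β.toReal

instance invTempFilter_neBot (β : ℝ≥0∞) : (invTempFilter β).NeBot := by
  unfold invTempFilter; split_ifs <;> infer_instance

instance invTempFilter_isCountablyGenerated (β : ℝ≥0∞) :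
    (invTempFilter β).IsCountablyGenerated := by
  unfold invTempFilter; split_ifs <;> infer_instance

lemma eventually_invTempFilter_pos (hβ : β ≠ 0) : ∀ᶠ b in invTempFilter β, 0 < b := by
  unfold invTempFilter
  split_ifs with htop
  · exact eventually_gt_atTop 0
  · exact ENNReal.toReal_pos hβ htop

lemma tendsto_inv_invTempFilter (β : ℝ≥0∞) :
    Tendsto (fun b : ℝ => b⁻¹) (invTempFilter β) (𝓝 (β.toReal)⁻¹) := by
  unfold invTempFilter
  split_ifs with htop
  · simpa [htop] using tendsto_inv_atTop_zero
  · exact tendsto_pure_nhds _ _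

lemma tendsto_eqFreeEnergy [Nonempty n] (hH : H.IsHermitian) (β : ℝ≥0∞) :
    Tendsto (fun b : ℝ => -b⁻¹ * logPartition (((-b : ℝ) : ℂ) • H)) (invTempFilter β)
      (𝓝 (eqFreeEnergy β H)) := by
  unfold invTempFilter eqFreeEnergy
  split_ifs
  · simp only [logPartition, exp_ofReal_smul_eq_cfc hH, trace_cfc hH,
      hH.spectrum_real_eq_range_eigenvalues]
    exact tendsto_neg_inv_mul_log_sum_exp hH.eigenvalues
  · exact tendsto_pure_nhds _ _

lemma tendsto_eqState [Nonempty n] (hH : H.IsHermitian) (B : Matrix n n ℂ) (β : ℝ≥0∞) :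
    Tendsto (fun b : ℝ => gibbsMean (((-b : ℝ) : ℂ) • H) B) (invTempFilter β)
      (𝓝 (eqState β H B)) := by
  unfold invTempFilter eqState
  split_ifs
  · refine tendsto_nhds_limUnder ?_
    simp only [gibbsMean, exp_ofReal_smul_eq_cfc hH, trace_cfc hH, trace_mul_cfc hH]
    exact exists_tendsto_sum_mul_exp_div_sum_exp _ hH.eigenvalues
  · exact tendsto_pure_nhds _ _

lemma eqState_add [Nonempty n] (hH : H.IsHermitian) (B C : Matrix n n ℂ) (β : ℝ≥0∞) :
    eqState β H (B + C) = eqState β H B + eqState β H C :=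
  tendsto_nhds_unique (tendsto_eqState hH (B + C) β) <|
    ((tendsto_eqState hH B β).add (tendsto_eqState hH C β)).congr fun _ =>
      (gibbsMean_add _ _ _).symm

lemma eqState_smul [Nonempty n] (hH : H.IsHermitian) (r : ℝ) (B : Matrix n n ℂ) (β : ℝ≥0∞) :
    eqState β H ((r : ℂ) • B) = r * eqState β H B :=
  tendsto_nhds_unique (tendsto_eqState hH _ β) <|
    ((tendsto_eqState hH B β).const_mul r).congr fun _ => (gibbsMean_smul _ _ _).symm

lemma eqState_sum [Nonempty n] (hH : H.IsHermitian) {ι : Type*} (s : Finset ι)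
    (B : ι → Matrix n n ℂ) (β : ℝ≥0∞) :
    eqState β H (∑ i ∈ s, B i) = ∑ i ∈ s, eqState β H (B i) :=
  map_sum (AddMonoidHom.mk' (eqState β H) fun B C => eqState_add hH B C β) B s

lemma abs_eqState_le [Nonempty n] (hH : H.IsHermitian) (B : Matrix n n ℂ) (β : ℝ≥0∞) :
    |eqState β H B| ≤ ‖B‖ :=
  le_of_tendsto (tendsto_eqState hH B β).abs <| Eventually.of_forall fun b =>
    abs_gibbsMean_le (isHermitian_ofReal_smul hH (-b)) B

lemma measurable_eqState [Nonempty n] {Y : Type*} [TopologicalSpace Y] [MeasurableSpace Y]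
    [OpensMeasurableSpace Y] {H : Y → Matrix n n ℂ} (hcont : Continuous H)
    (hH : ∀ y, (H y).IsHermitian) (β : ℝ≥0∞) (B : Matrix n n ℂ) :
    Measurable fun y => eqState β (H y) B :=
  measurable_of_tendsto_metrizable' (invTempFilter β)
    (fun b => (continuous_gibbsMean (by fun_prop)
      (fun y => isHermitian_ofReal_smul (hH y) (-b)) B).measurable)
    (tendsto_pi_nhds.2 fun y => tendsto_eqState (hH y) B β)

/-- At finite inverse temperature this is the Peierls–Bogoliubov inequality. -/
lemma eqFreeEnergy_add_le [Nonempty n] (hH : H.IsHermitian) (hB : B.IsHermitian) (hβ : β ≠ 0) :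
    eqFreeEnergy β (H + B) ≤ eqFreeEnergy β H + eqState β H B := by
  refine le_of_tendsto_of_tendsto (tendsto_eqFreeEnergy (hH.add hB) β)
    ((tendsto_eqFreeEnergy hH β).add (tendsto_eqState hH B β)) ?_
  filter_upwards [eventually_invTempFilter_pos hβ] with b hb
  have h := gibbsMean_sub_le_logPartition_sub (isHermitian_ofReal_smul hH (-b))
    (isHermitian_ofReal_smul (hH.add hB) (-b))
  rw [← smul_sub, add_sub_cancel_left, gibbsMean_smul] at h
  have hscale : b⁻¹ * (-b * gibbsMean (((-b : ℝ) : ℂ) • H) B)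
      = -gibbsMean (((-b : ℝ) : ℂ) • H) B := by field_simp
  linarith [mul_le_mul_of_nonneg_left h (inv_pos.2 hb).le]

lemma abs_eqFreeEnergy_sub_le [Nonempty n] (hH : H.IsHermitian) (hH' : H'.IsHermitian)
    (hβ : β ≠ 0) : |eqFreeEnergy β H - eqFreeEnergy β H'| ≤ ‖H - H'‖ := by
  have hle : ∀ {H H' : Matrix n n ℂ}, H.IsHermitian → H'.IsHermitian →
      eqFreeEnergy β H - eqFreeEnergy β H' ≤ ‖H - H'‖ := by
    intro H H' hH hH'
    have h := eqFreeEnergy_add_le hH' (hH.sub hH') hβ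
    rw [add_sub_cancel] at h
    linarith [le_of_abs_le (abs_eqState_le hH' (H - H') β)]
  exact abs_sub_le_iff.2 ⟨hle hH hH', norm_sub_rev H H' ▸ hle hH' hH⟩

lemma eqState_sub_eqState_add_le [Nonempty n] (hH : H.IsHermitian) (hB : B.IsHermitian)
    (hβ : β ≠ 0) (hβ' : β ≠ ⊤) :
    eqState β H B - eqState β (H + B) B ≤ 2 * β.toReal * ‖B‖ ^ 2 := by
  have hb := ENNReal.toReal_pos hβ hβ'
  simp only [eqState, hβ', if_false]
  generalize β.toReal = b at hb
  have h := gibbsMean_add_self_sub_le_two_mul_sq (isHermitian_ofReal_smul hH (-b))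
    (isHermitian_ofReal_smul hB (-b))
  rw [← smul_add, gibbsMean_smul, gibbsMean_smul, norm_smul, Complex.norm_real, norm_neg,
    Real.norm_of_nonneg hb.le, mul_pow] at h
  refine le_of_mul_le_mul_left ?_ hb
  linarith

/-- The free energy relative to the normalized trace. Unlike `eqFreeEnergy` it does not change
when the system is enlarged by sites that do not interact. -/
noncomputable def normalizedFreeEnergy (β : ℝ≥0∞) (H : Matrix n n ℂ) : ℝ :=
  eqFreeEnergy β H + (β.toReal)⁻¹ * Real.log (Fintype.card n)

lemma tendsto_normalizedFreeEnergy [Nonempty n] (hH : H.IsHermitian) (β : ℝ≥0∞) :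
    Tendsto (fun b : ℝ => -b⁻¹ * Real.log
        ((NormedSpace.exp (((-b : ℝ) : ℂ) • H)).trace.re / Fintype.card n))
      (invTempFilter β) (𝓝 (normalizedFreeEnergy β H)) := by
  refine ((tendsto_eqFreeEnergy hH β).add
    ((tendsto_inv_invTempFilter β).mul_const _)).congr fun b => ?_
  rw [Real.log_div (trace_exp_pos (isHermitian_ofReal_smul hH (-b))).ne' (by simp), logPartition]
  ring

lemma abs_normalizedFreeEnergy_sub_le [Nonempty n] (hH : H.IsHermitian) (hH' : H'.IsHermitian)
    (hβ : β ≠ 0) : |normalizedFreeEnergy β H - normalizedFreeEnergy β H'| ≤ ‖H - H'‖ := by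
  rw [normalizedFreeEnergy, normalizedFreeEnergy, add_sub_add_right_eq_sub]
  exact abs_eqFreeEnergy_sub_le hH hH' hβ

end EquilibriumStates

/-! ### Operators on tensor products -/

section Embedding

open Matrix
open scoped Matrix.Norms.L2Operator

variable {σ A V W : Type*} {f : A → V} {s t : V → σ}

lemma embedOp_apply_of_eqOn (M : Matrix (A → σ) (A → σ) ℂ) (h : Set.EqOn s t (Set.range f)ᶜ) :
    embedOp f M s t = M (s ∘ f) (t ∘ f) :=
  if_pos fun _ hv => h hv

lemma embedOp_apply_of_not_eqOn (M : Matrix (A → σ) (A → σ) ℂ)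
    (h : ¬Set.EqOn s t (Set.range f)ᶜ) : embedOp f M s t = 0 :=
  if_neg fun h' => h fun v hv => h' v hv

lemma embedOp_add (f : A → V) (M N : Matrix (A → σ) (A → σ) ℂ) :
    embedOp f (M + N) = embedOp f M + embedOp f N := by
  ext s t
  simp only [embedOp, of_apply, Matrix.add_apply]
  split_ifs <;> simp only [add_zero]

lemma embedOp_smul (f : A → V) (c : ℂ) (M : Matrix (A → σ) (A → σ) ℂ) :
    embedOp f (c • M) = c • embedOp f M := by
  ext s t
  simp only [embedOp, of_apply, Matrix.smul_apply]
  split_ifs <;> simp only [smul_zero]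

lemma conjTranspose_embedOp (f : A → V) (M : Matrix (A → σ) (A → σ) ℂ) :
    (embedOp f M)ᴴ = embedOp f Mᴴ := by
  ext s t
  rw [conjTranspose_apply]
  by_cases h : Set.EqOn s t (Set.range f)ᶜ
  · rw [embedOp_apply_of_eqOn _ h, embedOp_apply_of_eqOn _ h.symm, conjTranspose_apply]
  · rw [embedOp_apply_of_not_eqOn _ h, embedOp_apply_of_not_eqOn _ fun h' => h h'.symm, star_zero]

lemma isHermitian_embedOp (f : A → V) {M : Matrix (A → σ) (A → σ) ℂ} (hM : M.IsHermitian) :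
    (embedOp f M).IsHermitian := by
  rw [Matrix.IsHermitian, conjTranspose_embedOp, hM.eq]

lemma embedOp_sum (f : A → V) {ι : Type*} (u : Finset ι) (M : ι → Matrix (A → σ) (A → σ) ℂ) :
    embedOp f (∑ i ∈ u, M i) = ∑ i ∈ u, embedOp f (M i) :=
  map_sum (AddMonoidHom.mk' (embedOp f) (embedOp_add f)) M u

lemma embedOp_embedOp {g : V → W} (hg : Function.Injective g) (f : A → V)
    (M : Matrix (A → σ) (A → σ) ℂ) : embedOp g (embedOp f M) = embedOp (g ∘ f) M := by
  ext s t
  have hiff : Set.EqOn s t (Set.range (g ∘ f))ᶜ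
      ↔ Set.EqOn s t (Set.range g)ᶜ ∧ Set.EqOn (s ∘ g) (t ∘ g) (Set.range f)ᶜ := by
    refine ⟨fun h => ⟨fun v hv => h fun ⟨a, ha⟩ => hv ⟨f a, ha⟩,
      fun v hv => h fun ⟨a, ha⟩ => hv ⟨a, hg ha⟩⟩, fun ⟨hout, hin⟩ v hv => ?_⟩
    by_cases hvg : v ∈ Set.range g
    · obtain ⟨u, rfl⟩ := hvg
      exact hin fun ⟨a, ha⟩ => hv ⟨a, congrArg g ha⟩
    · exact hout hvg
  by_cases h : Set.EqOn s t (Set.range (g ∘ f))ᶜ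
  · obtain ⟨hout, hin⟩ := hiff.1 h
    rw [embedOp_apply_of_eqOn _ h, embedOp_apply_of_eqOn _ hout, embedOp_apply_of_eqOn _ hin]
    rfl
  · rw [embedOp_apply_of_not_eqOn _ h]
    by_cases hout : Set.EqOn s t (Set.range g)ᶜ
    · rw [embedOp_apply_of_eqOn _ hout,
        embedOp_apply_of_not_eqOn _ fun hin => h (hiff.2 ⟨hout, hin⟩)]
    · rw [embedOp_apply_of_not_eqOn _ hout]

lemma embedOp_one [DecidableEq σ] [Fintype A] [Fintype V] (f : A → V) :
    embedOp f (1 : Matrix (A → σ) (A → σ) ℂ) = 1 := by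
  ext s t
  by_cases h : Set.EqOn s t (Set.range f)ᶜ
  · have heq : s ∘ f = t ∘ f ↔ s = t := by
      refine ⟨fun e => funext fun v => ?_, fun e => by rw [e]⟩
      by_cases hv : v ∈ Set.range f
      · obtain ⟨a, rfl⟩ := hv
        exact congrFun e a
      · exact h hv
    simp only [embedOp_apply_of_eqOn _ h, one_apply, heq]
  · rw [embedOp_apply_of_not_eqOn _ h, one_apply_ne]
    rintro rfl
    exact h fun _ _ => rfl

variable [Fintype σ] [Fintype A] [DecidableEq A] [Fintype V] [DecidableEq V]

open Classical in
lemma sum_ite_eqOn_compl_range (hf : Function.Injective f) (t : V → σ) {R : Type*}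
    [AddCommMonoid R] (g : (A → σ) → R) :
    (∑ u : V → σ, if Set.EqOn u t (Set.range f)ᶜ then g (u ∘ f) else 0) = ∑ w, g w := by
  rw [← Finset.sum_filter]
  refine Finset.sum_nbij' (fun u => u ∘ f) (fun w => Function.extend f w t) ?_ ?_ ?_ ?_ ?_
  · simp
  · exact fun w _ => Finset.mem_filter.2
      ⟨Finset.mem_univ _, fun v hv => Function.extend_apply' _ _ _ hv⟩
  · intro u hu
    ext v
    by_cases hv : v ∈ Set.range f
    · obtain ⟨a, rfl⟩ := hv
      rw [hf.extend_apply, Function.comp_apply]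
    · rw [Function.extend_apply' _ _ _ hv, (Finset.mem_filter.1 hu).2 hv]
  · exact fun w _ => Function.extend_comp hf _ _
  · simp

lemma embedOp_mul (hf : Function.Injective f) (M N : Matrix (A → σ) (A → σ) ℂ) :
    embedOp f (M * N) = embedOp f M * embedOp f N := by
  classical
  ext s t
  rw [mul_apply]
  by_cases h : Set.EqOn s t (Set.range f)ᶜ
  · rw [embedOp_apply_of_eqOn _ h, mul_apply, ← sum_ite_eqOn_compl_range hf t]
    refine Finset.sum_congr rfl fun u _ => ?_
    split_ifs with hu
    · rw [embedOp_apply_of_eqOn _ hu, embedOp_apply_of_eqOn _ (h.trans hu.symm)]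
    · rw [embedOp_apply_of_not_eqOn N hu, mul_zero]
  · rw [embedOp_apply_of_not_eqOn _ h]
    refine (Finset.sum_eq_zero fun u _ => ?_).symm
    by_cases hu : Set.EqOn u t (Set.range f)ᶜ
    · rw [embedOp_apply_of_not_eqOn M fun hs => h (hs.trans hu), zero_mul]
    · rw [embedOp_apply_of_not_eqOn N hu, mul_zero]

/-- Double counting of the pairs of configurations that agree off the range of `f`. -/
lemma card_mul_trace_embedOp (hf : Function.Injective f) (M : Matrix (A → σ) (A → σ) ℂ) :
    (Fintype.card (A → σ) : ℂ) * (embedOp f M).trace = Fintype.card (V → σ) * M.trace := by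
  classical
  have hfiber : ∀ u : V → σ, (Fintype.card (A → σ) : ℂ)
      = ∑ t : V → σ, if Set.EqOn t u (Set.range f)ᶜ then 1 else 0 := fun u => by
    rw [sum_ite_eqOn_compl_range hf u fun _ => (1 : ℂ)]
    simp
  have htotal : (Fintype.card (V → σ) : ℂ) * M.trace = ∑ t : V → σ, ∑ u : V → σ,
      if Set.EqOn u t (Set.range f)ᶜ then M (u ∘ f) (u ∘ f) else 0 := by
    simp only [sum_ite_eqOn_compl_range hf _ fun w => M w w, Finset.sum_const, Finset.card_univ,
      nsmul_eq_mul]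
    rfl
  rw [htotal, Finset.sum_comm, trace, Finset.mul_sum]
  refine Finset.sum_congr rfl fun u _ => ?_
  rw [diag_apply, embedOp_apply_of_eqOn M fun _ _ => rfl, hfiber u, Finset.sum_mul]
  simp only [ite_mul, one_mul, zero_mul, Set.eqOn_comm]

lemma re_trace_embedOp_div_card [Nonempty σ] (hf : Function.Injective f)
    (M : Matrix (A → σ) (A → σ) ℂ) :
    (embedOp f M).trace.re / Fintype.card (V → σ) = M.trace.re / Fintype.card (A → σ) := by
  have h := congrArg Complex.re (card_mul_trace_embedOp hf M)
  rw [← Complex.ofReal_natCast, ← Complex.ofReal_natCast, Complex.re_ofReal_mul,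
    Complex.re_ofReal_mul] at h
  rw [div_eq_div_iff (Nat.cast_ne_zero.2 Fintype.card_ne_zero)
    (Nat.cast_ne_zero.2 Fintype.card_ne_zero)]
  linarith

variable [DecidableEq σ]

/-- The map `M ↦ M ⊗ 1` given by `embedOp f`, as a unital `*`-homomorphism. Its continuity and
norm bound are then those of `*`-homomorphisms. -/
noncomputable def embedHom (f : A → V) (hf : Function.Injective f) :
    Matrix (A → σ) (A → σ) ℂ →⋆ₐ[ℂ] Matrix (V → σ) (V → σ) ℂ where
  toFun := embedOp f
  map_one' := embedOp_one f
  map_mul' := embedOp_mul hf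
  map_zero' := by simpa using embedOp_smul (σ := σ) f 0 0
  map_add' := embedOp_add f
  commutes' r := by
    rw [Algebra.algebraMap_eq_smul_one, Algebra.algebraMap_eq_smul_one, embedOp_smul, embedOp_one]
  map_star' M := (conjTranspose_embedOp f M).symm

lemma norm_embedOp_le (hf : Function.Injective f) (M : Matrix (A → σ) (A → σ) ℂ) :
    ‖embedOp f M‖ ≤ ‖M‖ :=
  NonUnitalStarAlgHom.norm_apply_le (embedHom f hf) M

lemma exp_embedOp (hf : Function.Injective f) (M : Matrix (A → σ) (A → σ) ℂ) :
    NormedSpace.exp (embedOp f M) = embedOp f (NormedSpace.exp M) := by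
  have hcont : Continuous (embedHom (σ := σ) f hf) :=
    (embedHom (σ := σ) f hf).toAlgHom.toLinearMap.continuous_of_finiteDimensional
  let _ : NormedAlgebra ℚ (Matrix (A → σ) (A → σ) ℂ) := NormedAlgebra.restrictScalars ℚ ℂ _
  let _ : NormedAlgebra ℚ (Matrix (V → σ) (V → σ) ℂ) := NormedAlgebra.restrictScalars ℚ ℂ _
  exact (NormedSpace.map_exp (embedHom f hf) hcont M).symm

variable [Nonempty σ]

lemma gibbsMean_embedOp (hf : Function.Injective f) (X B : Matrix (A → σ) (A → σ) ℂ) :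
    gibbsMean (embedOp f X) (embedOp f B) = gibbsMean X B := by
  have hV : (Fintype.card (V → σ) : ℝ) ≠ 0 := Nat.cast_ne_zero.2 Fintype.card_ne_zero
  have hA : (Fintype.card (A → σ) : ℝ) ≠ 0 := Nat.cast_ne_zero.2 Fintype.card_ne_zero
  rw [gibbsMean, gibbsMean, exp_embedOp hf, ← embedOp_mul hf,
    ← div_div_div_cancel_right₀ hV (embedOp f _).trace.re, re_trace_embedOp_div_card hf,
    re_trace_embedOp_div_card hf, div_div_div_cancel_right₀ hA]

variable {H : Matrix (A → σ) (A → σ) ℂ}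

lemma normalizedFreeEnergy_embedOp (hf : Function.Injective f) (hH : H.IsHermitian) (β : ℝ≥0∞) :
    normalizedFreeEnergy β (embedOp f H) = normalizedFreeEnergy β H := by
  refine tendsto_nhds_unique (tendsto_normalizedFreeEnergy (isHermitian_embedOp f hH) β)
    ((tendsto_normalizedFreeEnergy hH β).congr fun b => ?_)
  rw [← embedOp_smul f, exp_embedOp hf, re_trace_embedOp_div_card hf]

lemma eqState_embedOp (hf : Function.Injective f) (hH : H.IsHermitian)
    (B : Matrix (A → σ) (A → σ) ℂ) (β : ℝ≥0∞) :
    eqState β (embedOp f H) (embedOp f B) = eqState β H B := by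
  refine tendsto_nhds_unique (tendsto_eqState (isHermitian_embedOp f hH) _ β)
    ((tendsto_eqState hH B β).congr fun b => ?_)
  rw [← embedOp_smul f, gibbsMean_embedOp hf]

end Embedding

section BlockTensor

open Matrix
open scoped Matrix.Norms.L2Operator

variable {σ I T : Type*} [Fintype I]

/-- The tensor product of the operators `M i` on the blocks `{i} × T`. -/
def blockTensor (M : I → Matrix (T → σ) (T → σ) ℂ) : Matrix (I × T → σ) (I × T → σ) ℂ :=
  Matrix.of fun s t => ∏ i, M i (fun v => s (i, v)) (fun v => t (i, v))

lemma blockTensor_one [DecidableEq σ] [Fintype T] :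
    blockTensor (fun _ : I => (1 : Matrix (T → σ) (T → σ) ℂ)) = 1 := by
  ext s t
  simp only [blockTensor, of_apply, one_apply, Finset.prod_ite_zero, Finset.prod_const_one]
  congr 1
  exact propext ⟨fun h => funext fun ⟨i, v⟩ => congrFun (h i (Finset.mem_univ i)) v,
    fun h _ _ => by rw [h]⟩

variable [DecidableEq I]

lemma embedOp_block [DecidableEq σ] [Fintype T] (i : I) (M : Matrix (T → σ) (T → σ) ℂ) :
    embedOp (fun v => (i, v)) M = blockTensor (Function.update 1 i M) := by
  ext s t
  have hother : ∀ j ∈ Finset.univ.erase i,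
      Function.update (1 : I → Matrix (T → σ) (T → σ) ℂ) i M j (fun v => s (j, v))
        (fun v => t (j, v)) = if (fun v => s (j, v)) = (fun v => t (j, v)) then 1 else 0 :=
    fun j hj => by
      rw [Function.update_of_ne (Finset.ne_of_mem_erase hj), Pi.one_apply, one_apply]
  have hagree : (∀ j ∈ Finset.univ.erase i, (fun v => s (j, v)) = fun v => t (j, v))
      ↔ Set.EqOn s t (Set.range fun v : T => (i, v))ᶜ := by
    refine ⟨fun h ⟨j, v⟩ hv => ?_, fun h j hj => funext fun v => h ?_⟩
    · exact congrFun (h j (Finset.mem_erase.2 ⟨fun e => hv ⟨v, by rw [e]⟩, Finset.mem_univ _⟩)) v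
    · rintro ⟨w, hw⟩
      exact Finset.ne_of_mem_erase hj (congrArg Prod.fst hw).symm
  simp only [blockTensor, of_apply]
  rw [← Finset.mul_prod_erase _ _ (Finset.mem_univ i), Function.update_self,
    Finset.prod_congr rfl hother, Finset.prod_ite_zero, Finset.prod_const_one]
  by_cases h : Set.EqOn s t (Set.range fun v : T => (i, v))ᶜ
  · rw [embedOp_apply_of_eqOn _ h, if_pos (hagree.2 h), mul_one]
    rfl
  · rw [embedOp_apply_of_not_eqOn _ h, if_neg (mt hagree.1 h), mul_zero]

variable [Fintype σ] [Fintype T] [DecidableEq T]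

lemma sum_prod_blocks {R : Type*} [CommSemiring R] (g : I → (T → σ) → R) :
    ∑ u : I × T → σ, ∏ i, g i (fun v => u (i, v)) = ∏ i, ∑ w, g i w := by
  classical
  rw [Finset.prod_univ_sum, Fintype.piFinset_univ]
  exact Fintype.sum_equiv (Equiv.curry I T σ) _ _ fun u => rfl

lemma blockTensor_mul (M N : I → Matrix (T → σ) (T → σ) ℂ) :
    blockTensor M * blockTensor N = blockTensor (fun i => M i * N i) := by
  ext s t
  simp only [mul_apply, blockTensor, of_apply, ← Finset.prod_mul_distrib]
  exact sum_prod_blocks fun i w => M i (fun v => s (i, v)) w * N i w (fun v => t (i, v))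

lemma trace_blockTensor (M : I → Matrix (T → σ) (T → σ) ℂ) :
    (blockTensor M).trace = ∏ i, (M i).trace :=
  sum_prod_blocks fun i w => M i w w

lemma card_prod_fun : Fintype.card (I × T → σ) = ∏ _i : I, Fintype.card (T → σ) := by
  rw [Finset.prod_const, Finset.card_univ, Fintype.card_fun, Fintype.card_fun, Fintype.card_prod,
    mul_comm, pow_mul]

lemma commute_embedOp_block {i j : I} (hij : i ≠ j) (M N : Matrix (T → σ) (T → σ) ℂ) :
    Commute (embedOp (fun v => (i, v)) M) (embedOp (fun v => (j, v)) N) := by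
  classical
  rw [Commute, SemiconjBy, embedOp_block, embedOp_block, blockTensor_mul, blockTensor_mul]
  congr 1
  ext1 k
  by_cases hk : k = i
  · subst hk
    rw [Function.update_self, Function.update_of_ne hij, Pi.one_apply, one_mul, mul_one]
  · rw [Function.update_of_ne hk, Pi.one_apply, one_mul, mul_one]

variable [DecidableEq σ]

lemma exp_sum_embedOp_block (H : I → Matrix (T → σ) (T → σ) ℂ) (s : Finset I) :
    NormedSpace.exp (∑ i ∈ s, embedOp (fun v => (i, v)) (H i))
      = blockTensor fun i => if i ∈ s then NormedSpace.exp (H i) else 1 := by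
  induction s using Finset.induction_on with
  | empty => simp [blockTensor_one]
  | insert a s ha ih =>
    have hcomm : Commute (embedOp (fun v => (a, v)) (H a))
        (∑ i ∈ s, embedOp (fun v => (i, v)) (H i)) :=
      Commute.sum_right _ _ _ fun i hi =>
        commute_embedOp_block (ne_of_mem_of_not_mem hi ha).symm _ _
    rw [Finset.sum_insert ha, Matrix.exp_add_of_commute _ _ hcomm, ih,
      exp_embedOp (Prod.mk_right_injective a), embedOp_block, blockTensor_mul]
    congr 1
    ext1 k
    by_cases hk : k = a
    · subst hk
      simp [ha]
    · simp [hk]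

lemma ofReal_re_trace_of_isHermitian {n : Type*} [Fintype n] {A : Matrix n n ℂ}
    (hA : A.IsHermitian) : (A.trace.re : ℂ) = A.trace := by
  refine Complex.conj_eq_iff_re.1 ?_
  rw [starRingEnd_apply, ← trace_conjTranspose, hA.eq]

lemma re_trace_exp_sum_embedOp_block_div_card {H : I → Matrix (T → σ) (T → σ) ℂ}
    (hH : ∀ i, (H i).IsHermitian) :
    (NormedSpace.exp (∑ i, embedOp (fun v => (i, v)) (H i))).trace.re / Fintype.card (I × T → σ)
      = ∏ i, (NormedSpace.exp (H i)).trace.re / Fintype.card (T → σ) := by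
  have hreal : ∀ i, (NormedSpace.exp (H i)).trace = ((NormedSpace.exp (H i)).trace.re : ℂ) :=
    fun i => (ofReal_re_trace_of_isHermitian (hH i).exp).symm
  simp only [exp_sum_embedOp_block, Finset.mem_univ, if_true, trace_blockTensor]
  rw [Finset.prod_congr rfl fun i _ => hreal i, ← Complex.ofReal_prod, Complex.ofReal_re,
    card_prod_fun, Nat.cast_prod, Finset.prod_div_distrib]

lemma normalizedFreeEnergy_sum_embedOp_block [Nonempty σ] {H : I → Matrix (T → σ) (T → σ) ℂ}
    (hH : ∀ i, (H i).IsHermitian) (β : ℝ≥0∞) :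
    normalizedFreeEnergy β (∑ i, embedOp (fun v => (i, v)) (H i))
      = ∑ i, normalizedFreeEnergy β (H i) := by
  have hsum : (∑ i, embedOp (fun v => (i, v)) (H i)).IsHermitian :=
    isSelfAdjoint_sum _ fun i _ => isHermitian_embedOp _ (hH i)
  refine tendsto_nhds_unique (tendsto_normalizedFreeEnergy hsum β)
    ((tendsto_finsetSum _ fun i _ => tendsto_normalizedFreeEnergy (hH i) β).congr fun b => ?_)
  simp only [Finset.smul_sum, ← embedOp_smul]
  rw [re_trace_exp_sum_embedOp_block_div_card fun i => isHermitian_ofReal_smul (hH i) (-b),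
    ← Finset.mul_sum, Real.log_prod]
  exact fun i _ => div_ne_zero (trace_exp_pos (isHermitian_ofReal_smul (hH i) (-b))).ne'
    (Nat.cast_ne_zero.2 Fintype.card_ne_zero)

end BlockTensor

/-! ### Boxes in the torus -/

section TorusGeometry

variable {d : ℕ}

lemma mem_box {L : ℕ} {x : Fin d → ℤ} : x ∈ box d L ↔ ∀ i, -(L : ℤ) ≤ x i ∧ x i ≤ L := by
  simp only [box, Finset.mem_Icc, Pi.le_def, forall_and]

lemma box_subset_box {L M : ℕ} (h : L ≤ M) : box d L ⊆ box d M := fun x hx =>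
  mem_box.2 fun i => by
    have := mem_box.1 hx i
    omega

lemma box_zero : box d 0 = {0} := by
  ext x
  simp only [mem_box, Nat.cast_zero, neg_zero, Finset.mem_singleton, funext_iff, Pi.zero_apply]
  exact forall_congr' fun i => ⟨fun h => le_antisymm h.2 h.1, fun h => ⟨h.ge, h.le⟩⟩

lemma add_mem_box {L M : ℕ} {x y : Fin d → ℤ} (hx : x ∈ box d L) (hy : y ∈ box d M) :
    x + y ∈ box d (L + M) :=
  mem_box.2 fun i => by
    have := mem_box.1 hx i
    have := mem_box.1 hy i
    simp only [Pi.add_apply]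
    omega

lemma card_box (L : ℕ) : (box d L).card = (2 * L + 1) ^ d := by
  simp only [box, Pi.card_Icc, Int.card_Icc, Finset.prod_const, Finset.card_univ, Fintype.card_fin]
  congr 1
  omega

lemma exists_subset_box (A : Finset (Fin d → ℤ)) : ∃ L, A ⊆ box d L := by
  refine ⟨A.sup fun x => Finset.univ.sup fun i => (x i).natAbs, fun x hx => mem_box.2 fun i => ?_⟩
  have hcoord : (x i).natAbs ≤ Finset.univ.sup fun i => (x i).natAbs :=
    Finset.le_sup (f := fun i => (x i).natAbs) (Finset.mem_univ i)
  have hsite := Finset.le_sup (f := fun x : Fin d → ℤ => Finset.univ.sup fun i => (x i).natAbs) hx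
  omega

variable {K : ℕ}

lemma proj_rep (v : Torus d K) : proj K (rep v) = v :=
  funext fun i => ZMod.coe_valMinAbs (v i)

lemma rep_injective : Function.Injective (rep : Torus d K → Fin d → ℤ) :=
  Function.LeftInverse.injective proj_rep

lemma rep_mem_box (v : Torus d K) : rep v ∈ box d K :=
  mem_box.2 fun i => by
    have := ZMod.natAbs_valMinAbs_le (v i)
    simp only [rep]
    omega

lemma rep_proj {x : Fin d → ℤ} (hx : x ∈ box d K) : rep (proj K x) = x := by
  funext i
  have := mem_box.1 hx i
  refine (ZMod.valMinAbs_spec _ _).2 ⟨rfl, ?_, ?_⟩ <;> push_cast <;> omega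

lemma proj_add (x y : Fin d → ℤ) : proj K (x + y) = proj K x + proj K y :=
  funext fun _ => Int.cast_add _ _

lemma proj_zero : proj K (0 : Fin d → ℤ) = 0 :=
  funext fun _ => Int.cast_zero

lemma rep_zero : rep (0 : Torus d K) = 0 := by
  rw [← proj_zero, rep_proj (mem_box.2 fun i => by simp)]

lemma rep_add_proj {v : Torus d K} {x : Fin d → ℤ} (h : rep v + x ∈ box d K) :
    rep (v + proj K x) = rep v + x := by
  rw [← rep_proj h, proj_add, proj_rep]

lemma map_rep_filter_rep_mem_box {L : ℕ} (h : L ≤ K) :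
    (Finset.univ.filter fun v : Torus d K => rep v ∈ box d L).map ⟨rep, rep_injective⟩
      = box d L := by
  ext x
  simp only [Finset.mem_map, Finset.mem_filter, Finset.mem_univ, true_and,
    Function.Embedding.coeFn_mk]
  refine ⟨fun ⟨_, hv, e⟩ => e ▸ hv, fun hx => ⟨proj K x, ?_⟩⟩
  rw [rep_proj (box_subset_box h hx)]
  exact ⟨hx, rfl⟩

lemma card_filter_rep_mem_box {L : ℕ} (h : L ≤ K) :
    (Finset.univ.filter fun v : Torus d K => rep v ∈ box d L).card = (2 * L + 1) ^ d :=
  (Finset.card_map _).symm.trans (by rw [map_rep_filter_rep_mem_box h, card_box])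

lemma sum_rep {M : Type*} [AddCommMonoid M] (g : (Fin d → ℤ) → M) :
    ∑ v : Torus d K, g (rep v) = ∑ x ∈ box d K, g x := by
  rw [← map_rep_filter_rep_mem_box le_rfl, Finset.sum_map,
    Finset.filter_true_of_mem fun v _ => rep_mem_box v]
  rfl

lemma card_torus : Fintype.card (Torus d K) = (2 * K + 1) ^ d := by
  simp [ZMod.card]

/-- The site `v` of copy `i` of `Γ_M`, where the copies of `Γ_M` in the torus of `Γ_K` are centered
at the points `c i`. These copies are the blocks that decouple in the subadditivity argument. -/
def blockSite {I : Type*} (K M : ℕ) (c : I → Torus d K) (p : I × Torus d M) : Torus d K :=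
  c p.1 + proj K (rep p.2)

lemma blockSite_add_proj {I : Type*} {M R : ℕ} (c : I → Torus d K) (i : I) {v : Torus d M}
    (hRM : R ≤ M) (hv : rep v ∈ box d (M - R)) {a : Fin d → ℤ} (ha : a ∈ box d R) :
    blockSite K M c (i, v + proj M a) = blockSite K M c (i, v) + proj K a := by
  have h := add_mem_box hv ha
  rw [Nat.sub_add_cancel hRM] at h
  simp only [blockSite, rep_add_proj h, proj_add, add_assoc]

lemma rep_blockSite_zero {M : ℕ} (h : M ≤ K) (p : Unit × Torus d M) :
    rep (blockSite K M (fun _ => 0) p) = rep p.2 := by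
  rw [blockSite, zero_add, rep_proj (box_subset_box h (rep_mem_box _))]

lemma blockSite_zero_injective {M : ℕ} (h : M ≤ K) :
    Function.Injective (blockSite K M fun _ : Unit => (0 : Torus d K)) := fun p q e =>
  Prod.ext rfl <| rep_injective <| by rw [← rep_blockSite_zero h p, e, rep_blockSite_zero h]

lemma eq_and_eq_of_dvd_sub_of_centered_digits {M N m p q a b : ℤ} (hN : m * (2 * M + 1) ≤ N)
    (hp : 0 ≤ p ∧ p < m) (hq : 0 ≤ q ∧ q < m) (ha : -M ≤ a ∧ a ≤ M) (hb : -M ≤ b ∧ b ≤ M)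
    (hdvd : N ∣ (2 * M + 1) * q + b - ((2 * M + 1) * p + a)) : p = q ∧ a = b := by
  have hrange : ∀ r c : ℤ, (0 ≤ r ∧ r < m) → (-M ≤ c ∧ c ≤ M) →
      0 ≤ (2 * M + 1) * r + c + M ∧ (2 * M + 1) * r + c + M < N := fun r c hr hc => by
    have hM : 0 ≤ 2 * M + 1 := by omega
    have hlow := mul_nonneg hM hr.1
    have hhigh := mul_le_mul_of_nonneg_left (Int.add_one_le_iff.2 hr.2) hM
    constructor <;> linarith
  have hzero := Int.eq_zero_of_abs_lt_dvd hdvd <| by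
    rw [abs_lt]
    constructor <;> linarith [hrange p a hp ha, hrange q b hq hb]
  have hab : a - b = 0 := Int.eq_zero_of_abs_lt_dvd (m := 2 * M + 1) ⟨q - p, by linarith⟩ <| by
    rw [abs_lt]
    constructor <;> linarith
  have hpq : (2 * M + 1) * (q - p) = 0 := by linarith
  rcases mul_eq_zero.1 hpq with h | h <;> omega

lemma blockSite_tiling_injective {M m : ℕ} (h : m * (2 * M + 1) ≤ 2 * K + 1) :
    Function.Injective (blockSite K M
      fun i : Fin d → Fin m => proj K fun k => ((2 * M + 1 : ℕ) : ℤ) * (i k : ℕ)) := by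
  rintro ⟨i, v⟩ ⟨j, w⟩ e
  simp only [blockSite, ← proj_add] at e
  have hcoord : ∀ k, ((i k : ℕ) : ℤ) = (j k : ℕ) ∧ rep v k = rep w k := fun k => by
    have hk := congrFun e k
    simp only [proj, Pi.add_apply] at hk
    rw [ZMod.intCast_eq_intCast_iff_dvd_sub] at hk
    push_cast at hk
    exact eq_and_eq_of_dvd_sub_of_centered_digits (m := m) (by exact_mod_cast h) (by simp) (by simp)
      (mem_box.1 (rep_mem_box v) k) (mem_box.1 (rep_mem_box w) k) hk
  exact Prod.ext (funext fun k => Fin.ext (Int.ofNat_inj.1 (hcoord k).1))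
    (rep_injective (funext fun k => (hcoord k).2))

/-- The union of the copies of `Γ_L` concentric with the blocks `Γ_M` of `blockSite K M c`. -/
noncomputable def blockCore {I : Type*} [Fintype I] (K M L : ℕ) (c : I → Torus d K) :
    Finset (Torus d K) :=
  (Finset.univ.filter fun p : I × Torus d M => rep p.2 ∈ box d L).image (blockSite K M c)

lemma mem_blockCore_zero {L M : ℕ} (hLM : L ≤ M) (hMK : M ≤ K) {u : Torus d K} :
    u ∈ blockCore K M L (fun _ : Unit => 0) ↔ rep u ∈ box d L := by
  simp only [blockCore, Finset.mem_image, Finset.mem_filter, Finset.mem_univ, true_and]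
  constructor
  · rintro ⟨p, hp, rfl⟩
    rwa [rep_blockSite_zero hMK]
  · intro hu
    have hrep := rep_proj (box_subset_box hLM hu)
    exact ⟨((), proj M (rep u)), by rwa [hrep],
      rep_injective (by rw [rep_blockSite_zero hMK, hrep])⟩

lemma card_blockCore {I : Type*} [Fintype I] {L M : ℕ} (hLM : L ≤ M) {c : I → Torus d K}
    (hc : Function.Injective (blockSite K M c)) :
    (blockCore K M L c).card = Fintype.card I * (2 * L + 1) ^ d := by
  rw [blockCore, Finset.card_image_of_injective _ hc, ← Finset.univ_product_univ,
    Finset.filter_product_right (fun v : Torus d M => rep v ∈ box d L), Finset.card_product,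
    card_filter_rep_mem_box hLM, Finset.card_univ]

end TorusGeometry

/-! ### The Hamiltonians -/

namespace LatticeSystem

open Matrix
open scoped Matrix.Norms.L2Operator

variable {σ : Type*} [Fintype σ] [DecidableEq σ] {d : ℕ} (S : LatticeSystem d σ)

/-- A radius `R` such that `Γ_R` contains the cluster of `κ_0` and all the sets `A ∋ 0` that
interact. -/
noncomputable def radius : ℕ := max S.range (exists_subset_box S.cluster).choose

lemma cluster_subset_box_radius : S.cluster ⊆ box d S.radius :=
  (exists_subset_box S.cluster).choose_spec.trans (box_subset_box (le_max_right _ _))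

variable {S} in
lemma subset_box_radius {A : Finset (Fin d → ℤ)}
    (hA : A ∈ (box d S.range).powerset.filter fun A => 0 ∈ A) : A ⊆ box d S.radius :=
  (Finset.mem_powerset.1 (Finset.mem_filter.1 hA).1).trans (box_subset_box (le_max_left _ _))

/-- The terms of the Hamiltonian attached to the site `v`, in the field `r`. -/
noncomputable def siteTerm (K : ℕ) (v : Torus d K) (r : ℝ) :
    Matrix (Torus d K → σ) (Torus d K → σ) ℂ :=
  (∑ A ∈ (box d S.range).powerset with 0 ∈ A, ((A.card : ℂ)⁻¹) • S.torusQ K v A)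
    + (r : ℂ) • S.torusKappa K v

/-- The Hamiltonian on the torus with field `θ v` at the site `v`. Unlike `hamiltonian`, it takes
the total field on the torus itself, which makes translation covariance visible. -/
noncomputable def fieldHamiltonian (K : ℕ) (θ : Torus d K → ℝ) :
    Matrix (Torus d K → σ) (Torus d K → σ) ℂ :=
  ∑ v, S.siteTerm K v (θ v)

lemma hamiltonian_eq_fieldHamiltonian (ε h : ℝ) (K : ℕ) (η : Fields d) :
    S.hamiltonian ε h K η = S.fieldHamiltonian K fun v => h + ε * η (rep v) := by
  simp only [hamiltonian, fieldHamiltonian, siteTerm, Finset.sum_add_distrib]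

lemma freeEnergy_eq_eqFreeEnergy (β : ℝ≥0∞) (ε h : ℝ) (K : ℕ) (η : Fields d) :
    S.freeEnergy β ε h K η
      = eqFreeEnergy β (S.fieldHamiltonian K fun v => h + ε * η (rep v)) := by
  rw [← hamiltonian_eq_fieldHamiltonian]
  rfl

lemma stateKappa_eq_eqState (β : ℝ≥0∞) (ε h : ℝ) (K : ℕ) (η : Fields d) (v : Torus d K) :
    S.stateKappa β ε h K η v
      = eqState β (S.fieldHamiltonian K fun v => h + ε * η (rep v)) (S.torusKappa K v) := by
  rw [← hamiltonian_eq_fieldHamiltonian]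
  rfl

lemma isHermitian_torusKappa (K : ℕ) (v : Torus d K) : (S.torusKappa K v).IsHermitian :=
  isHermitian_embedOp _ S.kappa_isHermitian

lemma isHermitian_siteTerm (K : ℕ) (v : Torus d K) (r : ℝ) : (S.siteTerm K v r).IsHermitian := by
  refine .add (isSelfAdjoint_sum _ fun A _ => ?_)
    (isHermitian_ofReal_smul (S.isHermitian_torusKappa K v) r)
  rw [← Complex.ofReal_natCast, ← Complex.ofReal_inv]
  exact isHermitian_ofReal_smul (isHermitian_embedOp _ (S.Q_isHermitian A)) _

lemma isHermitian_fieldHamiltonian (K : ℕ) (θ : Torus d K → ℝ) :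
    (S.fieldHamiltonian K θ).IsHermitian :=
  isSelfAdjoint_sum _ fun v _ => S.isHermitian_siteTerm K v (θ v)

lemma fieldHamiltonian_add {K : ℕ} (θ τ : Torus d K → ℝ) :
    S.fieldHamiltonian K (θ + τ)
      = S.fieldHamiltonian K θ + ∑ v, (τ v : ℂ) • S.torusKappa K v := by
  simp only [fieldHamiltonian, siteTerm, Pi.add_apply, Complex.ofReal_add, add_smul, ← add_assoc,
    Finset.sum_add_distrib]

lemma fieldHamiltonian_add_single {K : ℕ} (θ : Torus d K → ℝ) (v : Torus d K) (r : ℝ) :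
    S.fieldHamiltonian K (θ + Pi.single v r)
      = S.fieldHamiltonian K θ + (r : ℂ) • S.torusKappa K v := by
  rw [fieldHamiltonian_add, Fintype.sum_eq_single v fun w hw => by simp [Pi.single_eq_of_ne hw],
    Pi.single_eq_same]

lemma continuous_fieldHamiltonian (K : ℕ) : Continuous (S.fieldHamiltonian K) := by
  refine continuous_matrix fun s t => ?_
  simp only [fieldHamiltonian, siteTerm, Matrix.sum_apply, Matrix.add_apply, Matrix.smul_apply,
    smul_eq_mul]
  fun_prop

section NormBounds

lemma injective_add_proj {K R : ℕ} (hK : R ≤ K) (v : Torus d K) {A : Finset (Fin d → ℤ)}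
    (hA : A ⊆ box d R) : Function.Injective fun a : A => v + proj K (a : Fin d → ℤ) := by
  intro a b e
  have hrep := congrArg rep (add_left_cancel e)
  rw [rep_proj (box_subset_box hK (hA a.2)), rep_proj (box_subset_box hK (hA b.2))] at hrep
  exact Subtype.ext hrep

/-- A bound for the norm of the interaction terms attached to one site. -/
noncomputable def siteBound : ℝ := ∑ A ∈ (box d S.range).powerset with 0 ∈ A, ‖S.Q A‖

lemma siteBound_nonneg : 0 ≤ S.siteBound := Finset.sum_nonneg fun _ _ => norm_nonneg _

variable {S}

lemma norm_torusKappa_le {K : ℕ} (hK : S.radius ≤ K) (v : Torus d K) :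
    ‖S.torusKappa K v‖ ≤ 1 := by
  refine (norm_embedOp_le (injective_add_proj hK v S.cluster_subset_box_radius) _).trans ?_
  rw [← l2_opNorm_toEuclideanCLM]
  exact S.kappa_norm_le

lemma norm_siteTerm_le {K : ℕ} (hK : S.radius ≤ K) (v : Torus d K) (r : ℝ) :
    ‖S.siteTerm K v r‖ ≤ S.siteBound + |r| := by
  refine (norm_add_le _ _).trans (add_le_add ((norm_sum_le _ _).trans ?_) ?_)
  · refine Finset.sum_le_sum fun A hA => ?_
    have hweight : ‖((A.card : ℂ)⁻¹)‖ ≤ 1 := by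
      rw [norm_inv, Complex.norm_natCast]
      exact Nat.cast_inv_le_one _
    rw [norm_smul]
    exact (mul_le_of_le_one_left (norm_nonneg _) hweight).trans
      (norm_embedOp_le (injective_add_proj hK v (subset_box_radius hA)) _)
  · rw [norm_smul, Complex.norm_real, Real.norm_eq_abs]
    exact mul_le_of_le_one_right (abs_nonneg _) (norm_torusKappa_le hK v)

end NormBounds

section Translation

variable {S}

lemma embedOp_siteTerm {K M : ℕ} {e : Torus d M → Torus d K} (he : Function.Injective e)
    {v : Torus d M} (hv : ∀ a ∈ box d S.radius, e (v + proj M a) = e v + proj K a) (r : ℝ) :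
    embedOp e (S.siteTerm M v r) = S.siteTerm K (e v) r := by
  have hembed : ∀ {A : Finset (Fin d → ℤ)}, A ⊆ box d S.radius →
      ∀ N : Matrix (A → σ) (A → σ) ℂ,
        embedOp e (embedOp (fun a : A => v + proj M (a : Fin d → ℤ)) N)
          = embedOp (fun a : A => e v + proj K (a : Fin d → ℤ)) N := fun hA N => by
    rw [embedOp_embedOp he]
    exact congrArg (embedOp · N) (funext fun a => hv a (hA a.2))
  rw [siteTerm, siteTerm, embedOp_add, embedOp_sum, embedOp_smul, torusKappa, torusKappa,
    hembed S.cluster_subset_box_radius]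
  congr 1
  refine Finset.sum_congr rfl fun A hA => ?_
  rw [embedOp_smul, torusQ, torusQ, hembed (subset_box_radius hA)]

variable (S)

lemma embedOp_add_right_fieldHamiltonian {K : ℕ} (w : Torus d K) (θ : Torus d K → ℝ) :
    embedOp (· + w) (S.fieldHamiltonian K fun v => θ (v + w)) = S.fieldHamiltonian K θ := by
  rw [fieldHamiltonian, embedOp_sum]
  exact Fintype.sum_equiv (Equiv.addRight w) _ _ fun v =>
    embedOp_siteTerm (add_left_injective w) (fun _ _ => add_right_comm _ _ _) _

lemma embedOp_add_right_torusKappa {K : ℕ} (v w : Torus d K) :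
    embedOp (· + w) (S.torusKappa K v) = S.torusKappa K (v + w) := by
  rw [torusKappa, torusKappa, embedOp_embedOp (add_left_injective w)]
  exact congrArg (embedOp · S.kappa) (funext fun _ => add_right_comm _ _ _)

variable [Nonempty σ]

lemma eqFreeEnergy_fieldHamiltonian_translate (β : ℝ≥0∞) {K : ℕ} (w : Torus d K)
    (θ : Torus d K → ℝ) :
    eqFreeEnergy β (S.fieldHamiltonian K fun v => θ (v + w))
      = eqFreeEnergy β (S.fieldHamiltonian K θ) := by
  have h := normalizedFreeEnergy_embedOp (add_left_injective w)
    (S.isHermitian_fieldHamiltonian K fun v => θ (v + w)) β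
  rw [embedOp_add_right_fieldHamiltonian] at h
  exact (add_right_cancel h).symm

lemma eqState_fieldHamiltonian_translate (β : ℝ≥0∞) {K : ℕ} (v w : Torus d K)
    (θ : Torus d K → ℝ) :
    eqState β (S.fieldHamiltonian K fun v => θ (v + w)) (S.torusKappa K v)
      = eqState β (S.fieldHamiltonian K θ) (S.torusKappa K (v + w)) := by
  have h := eqState_embedOp (add_left_injective w)
    (S.isHermitian_fieldHamiltonian K fun v => θ (v + w)) (S.torusKappa K v) β
  rw [embedOp_add_right_fieldHamiltonian, embedOp_add_right_torusKappa] at h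
  exact h.symm

end Translation

section Equilibrium

variable [Nonempty σ] {β : ℝ≥0∞}

lemma eqFreeEnergy_fieldHamiltonian_le (hβ : β ≠ 0) {K : ℕ} (θ θ' : Torus d K → ℝ) :
    eqFreeEnergy β (S.fieldHamiltonian K θ') ≤ eqFreeEnergy β (S.fieldHamiltonian K θ)
      + ∑ v, (θ' v - θ v) * eqState β (S.fieldHamiltonian K θ) (S.torusKappa K v) := by
  have hH := S.isHermitian_fieldHamiltonian K θ
  have hB : (∑ v, (((θ' - θ) v : ℝ) : ℂ) • S.torusKappa K v).IsHermitian :=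
    isSelfAdjoint_sum _ fun v _ => isHermitian_ofReal_smul (S.isHermitian_torusKappa K v) _
  have h := eqFreeEnergy_add_le hH hB hβ
  rw [← fieldHamiltonian_add, add_sub_cancel, eqState_sum hH] at h
  simpa only [eqState_smul hH, Pi.sub_apply] using h

variable {S}

lemma abs_eqState_torusKappa_le {K : ℕ} (hK : S.radius ≤ K) (β : ℝ≥0∞) (θ : Torus d K → ℝ)
    (v : Torus d K) : |eqState β (S.fieldHamiltonian K θ) (S.torusKappa K v)| ≤ 1 :=
  (abs_eqState_le (S.isHermitian_fieldHamiltonian K θ) _ β).trans (norm_torusKappa_le hK v)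

lemma eqState_torusKappa_sub_add_single_le (hβ : β ≠ 0) (hβ' : β ≠ ⊤) {K : ℕ}
    (hK : S.radius ≤ K) (θ : Torus d K → ℝ) (v : Torus d K) {r : ℝ} (hr : 0 ≤ r) :
    eqState β (S.fieldHamiltonian K θ) (S.torusKappa K v)
      - eqState β (S.fieldHamiltonian K (θ + Pi.single v r)) (S.torusKappa K v)
        ≤ 2 * β.toReal * r := by
  rcases hr.eq_or_lt with rfl | hr
  · simp
  have h := eqState_sub_eqState_add_le (S.isHermitian_fieldHamiltonian K θ)
    (isHermitian_ofReal_smul (S.isHermitian_torusKappa K v) r) hβ hβ'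
  rw [← fieldHamiltonian_add_single, eqState_smul (S.isHermitian_fieldHamiltonian K _),
    eqState_smul (S.isHermitian_fieldHamiltonian K _), norm_smul, Complex.norm_real,
    Real.norm_of_nonneg hr.le] at h
  have hsq : (r * ‖S.torusKappa K v‖) ^ 2 ≤ r ^ 2 := by
    gcongr
    exact mul_le_of_le_one_right hr.le (norm_torusKappa_le hK v)
  have hbound := h.trans (mul_le_mul_of_nonneg_left hsq (by positivity))
  refine le_of_mul_le_mul_left ?_ hr
  linarith

lemma abs_eqFreeEnergy_fieldHamiltonian_sub_le (hβ : β ≠ 0) {K : ℕ} (hK : S.radius ≤ K)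
    (θ θ' : Torus d K → ℝ) :
    |eqFreeEnergy β (S.fieldHamiltonian K θ) - eqFreeEnergy β (S.fieldHamiltonian K θ')|
      ≤ ∑ v, |θ v - θ' v| := by
  have hle : ∀ θ θ' : Torus d K → ℝ, eqFreeEnergy β (S.fieldHamiltonian K θ)
      - eqFreeEnergy β (S.fieldHamiltonian K θ') ≤ ∑ v, |θ v - θ' v| := fun θ θ' => by
    refine (sub_le_iff_le_add'.2 (S.eqFreeEnergy_fieldHamiltonian_le hβ θ' θ)).trans
      (Finset.sum_le_sum fun v _ => (le_abs_self _).trans ?_)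
    rw [abs_mul]
    exact mul_le_of_le_one_right (abs_nonneg _) (abs_eqState_torusKappa_le hK β _ v)
  refine abs_sub_le_iff.2 ⟨hle θ θ', (hle θ' θ).trans_eq ?_⟩
  simp only [abs_sub_comm]

lemma continuous_eqFreeEnergy_fieldHamiltonian (hβ : β ≠ 0) (K : ℕ) :
    Continuous fun θ : Torus d K → ℝ => eqFreeEnergy β (S.fieldHamiltonian K θ) := by
  refine continuous_iff_continuousAt.2 fun θ => tendsto_iff_norm_sub_tendsto_zero.2 ?_
  exact squeeze_zero (fun _ => norm_nonneg _)
    (fun θ' => abs_eqFreeEnergy_sub_le (S.isHermitian_fieldHamiltonian K θ')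
      (S.isHermitian_fieldHamiltonian K θ) hβ)
    (tendsto_iff_norm_sub_tendsto_zero.1 ((S.continuous_fieldHamiltonian K).tendsto θ))

end Equilibrium

section Blocks

variable {I : Type*} [Fintype I]

/-- The Hamiltonian on the torus of `Γ_K` in which the blocks of `blockSite K M c` carry periodic
boundary conditions of their own, and interact neither with each other nor with the remaining
sites. -/
noncomputable def blockHamiltonian (K M : ℕ) (c : I → Torus d K) (θ : Torus d K → ℝ) :
    Matrix (Torus d K → σ) (Torus d K → σ) ℂ :=
  embedOp (blockSite K M c)
    (∑ i, embedOp (fun v => (i, v)) (S.fieldHamiltonian M fun v => θ (blockSite K M c (i, v))))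

lemma isHermitian_sum_embedOp_fieldHamiltonian {M : ℕ} (θ : I → Torus d M → ℝ) :
    (∑ i, embedOp (fun v => (i, v)) (S.fieldHamiltonian M (θ i))).IsHermitian :=
  isSelfAdjoint_sum _ fun _ _ => isHermitian_embedOp _ (S.isHermitian_fieldHamiltonian _ _)

lemma isHermitian_blockHamiltonian (K M : ℕ) (c : I → Torus d K) (θ : Torus d K → ℝ) :
    (S.blockHamiltonian K M c θ).IsHermitian :=
  isHermitian_embedOp _ (S.isHermitian_sum_embedOp_fieldHamiltonian _)

variable {K M : ℕ} {c : I → Torus d K}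

lemma normalizedFreeEnergy_blockHamiltonian [Nonempty σ]
    (hc : Function.Injective (blockSite K M c)) (θ : Torus d K → ℝ) (β : ℝ≥0∞) :
    normalizedFreeEnergy β (S.blockHamiltonian K M c θ)
      = ∑ i, normalizedFreeEnergy β
          (S.fieldHamiltonian M fun v => θ (blockSite K M c (i, v))) := by
  classical
  rw [blockHamiltonian,
    normalizedFreeEnergy_embedOp hc (S.isHermitian_sum_embedOp_fieldHamiltonian _),
    normalizedFreeEnergy_sum_embedOp_block fun i => S.isHermitian_fieldHamiltonian _ _]

lemma blockHamiltonian_eq_sum (hc : Function.Injective (blockSite K M c)) (θ : Torus d K → ℝ) :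
    S.blockHamiltonian K M c θ = ∑ p : I × Torus d M,
      embedOp (fun v => blockSite K M c (p.1, v))
        (S.siteTerm M p.2 (θ (blockSite K M c p))) := by
  simp only [blockHamiltonian, fieldHamiltonian, embedOp_sum, embedOp_embedOp hc,
    Fintype.sum_prod_type]
  rfl

variable {S}

lemma fieldHamiltonian_sub_blockHamiltonian (hM : S.radius ≤ M)
    (hc : Function.Injective (blockSite K M c)) (θ : Torus d K → ℝ) :
    S.fieldHamiltonian K θ - S.blockHamiltonian K M c θ
      = ∑ u ∈ (blockCore K M (M - S.radius) c)ᶜ, S.siteTerm K u (θ u)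
        - ∑ p : I × Torus d M with rep p.2 ∉ box d (M - S.radius),
            embedOp (fun v => blockSite K M c (p.1, v))
              (S.siteTerm M p.2 (θ (blockSite K M c p))) := by
  rw [blockHamiltonian_eq_sum S hc, fieldHamiltonian,
    ← Finset.sum_filter_add_sum_filter_not Finset.univ
      fun p : I × Torus d M => rep p.2 ∈ box d (M - S.radius),
    ← Finset.sum_add_sum_compl (blockCore K M (M - S.radius) c), blockCore,
    Finset.sum_image fun _ _ _ _ h => hc h]
  have hcore : ∀ p ∈ Finset.univ.filter fun p : I × Torus d M => rep p.2 ∈ box d (M - S.radius),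
      S.siteTerm K (blockSite K M c p) (θ (blockSite K M c p))
        = embedOp (fun v => blockSite K M c (p.1, v))
            (S.siteTerm M p.2 (θ (blockSite K M c p))) := fun p hp =>
    (embedOp_siteTerm (hc.comp (Prod.mk_right_injective p.1)) (fun _ ha =>
      blockSite_add_proj c p.1 hM (Finset.mem_filter.1 hp).2 ha) _).symm
  rw [Finset.sum_congr rfl hcore]
  abel

lemma norm_fieldHamiltonian_sub_blockHamiltonian_le (hK : S.radius ≤ K) (hM : S.radius ≤ M)
    (hc : Function.Injective (blockSite K M c)) (θ : Torus d K → ℝ) :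
    ‖S.fieldHamiltonian K θ - S.blockHamiltonian K M c θ‖
      ≤ 2 * ∑ u ∈ (blockCore K M (M - S.radius) c)ᶜ, (S.siteBound + |θ u|) := by
  rw [fieldHamiltonian_sub_blockHamiltonian hM hc]
  refine (norm_sub_le _ _).trans ((add_le_add ((norm_sum_le _ _).trans
    (Finset.sum_le_sum fun u _ => norm_siteTerm_le hK u _)) ?_).trans_eq (two_mul _).symm)
  calc _ ≤ ∑ p : I × Torus d M with rep p.2 ∉ box d (M - S.radius),
        (S.siteBound + |θ (blockSite K M c p)|) :=
        (norm_sum_le _ _).trans (Finset.sum_le_sum fun p _ =>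
          (norm_embedOp_le (hc.comp (Prod.mk_right_injective p.1)) _).trans
            (norm_siteTerm_le hM _ _))
    _ = ∑ u ∈ (Finset.univ.filter fun p : I × Torus d M => rep p.2 ∉ box d (M - S.radius)).image
          (blockSite K M c), (S.siteBound + |θ u|) :=
        (Finset.sum_image (f := fun u => S.siteBound + |θ u|) fun _ _ _ _ h => hc h).symm
    _ ≤ _ := by
        refine Finset.sum_le_sum_of_subset_of_nonneg ?_
          fun u _ _ => add_nonneg S.siteBound_nonneg (abs_nonneg _)
        intro u hu
        obtain ⟨p, hp, rfl⟩ := Finset.mem_image.1 hu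
        refine Finset.mem_compl.2 fun hcore => ?_
        obtain ⟨q, hq, e⟩ := Finset.mem_image.1 hcore
        exact (Finset.mem_filter.1 hp).2 (hc e ▸ (Finset.mem_filter.1 hq).2)

lemma abs_normalizedFreeEnergy_sub_sum_blocks_le [Nonempty σ] {β : ℝ≥0∞} (hβ : β ≠ 0)
    (hK : S.radius ≤ K) (hM : S.radius ≤ M) (hc : Function.Injective (blockSite K M c))
    (θ : Torus d K → ℝ) :
    |normalizedFreeEnergy β (S.fieldHamiltonian K θ)
        - ∑ i, normalizedFreeEnergy β (S.fieldHamiltonian M fun v => θ (blockSite K M c (i, v)))|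
      ≤ 2 * ∑ u ∈ (blockCore K M (M - S.radius) c)ᶜ, (S.siteBound + |θ u|) := by
  rw [← normalizedFreeEnergy_blockHamiltonian S hc]
  exact (abs_normalizedFreeEnergy_sub_le (S.isHermitian_fieldHamiltonian K θ)
    (S.isHermitian_blockHamiltonian K M c θ) hβ).trans
      (norm_fieldHamiltonian_sub_blockHamiltonian_le hK hM hc θ)

end Blocks

end LatticeSystem

/-! ### Lipschitz functions of independent fields -/

open ProbabilityTheory

section ProductLaw

variable {d : ℕ} (ν : Measure ℝ) [IsProbabilityMeasure ν]

instance : IsProbabilityMeasure (fieldLaw d ν) := by unfold fieldLaw; infer_instance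

lemma measurePreserving_eval_fieldLaw (x : Fin d → ℤ) :
    MeasurePreserving (fun η : Fields d => η x) (fieldLaw d ν) ν :=
  measurePreserving_eval_infinitePi _ x

lemma measurePreserving_comp_injective {ι : Type*} {g : ι → Fin d → ℤ}
    (hg : Function.Injective g) :
    MeasurePreserving (fun (η : Fields d) i => η (g i)) (fieldLaw d ν)
      (Measure.infinitePi fun _ : ι => ν) :=
  ⟨by fun_prop, Measure.map_infinitePi_infinitePi_of_inj hg⟩

lemma measurable_splice (Λ : Finset (Fin d → ℤ)) :
    Measurable fun p : Fields d × Fields d => splice Λ p.1 p.2 := by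
  refine measurable_pi_lambda _ fun x => ?_
  unfold splice
  split_ifs <;> fun_prop

lemma measurePreserving_splice (Λ : Finset (Fin d → ℤ)) :
    MeasurePreserving (fun p : Fields d × Fields d => splice Λ p.1 p.2)
      ((fieldLaw d ν).prod (fieldLaw d ν)) (fieldLaw d ν) := by
  refine ⟨measurable_splice Λ, Measure.eq_infinitePi _ fun s t ht => ?_⟩
  have preimage_pi : (fun p : Fields d × Fields d => splice Λ p.1 p.2) ⁻¹' (Set.pi s t)
      = (Set.pi (s.filter (· ∈ Λ)) t) ×ˢ (Set.pi (s.filter (· ∉ Λ)) t) := by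
    ext p
    simp only [Set.mem_preimage, Set.mem_pi, SetLike.mem_coe, Set.mem_prod, Finset.mem_filter,
      splice]
    grind
  rw [Measure.map_apply (measurable_splice Λ)
    (MeasurableSet.pi s.countable_toSet fun i _ => ht i), preimage_pi, Measure.prod_prod, fieldLaw,
    Measure.infinitePi_pi _ fun i _ => ht i, Measure.infinitePi_pi _ fun i _ => ht i]
  exact Finset.prod_filter_mul_prod_filter_not s (· ∈ Λ) _

variable {ν}

lemma integral_comp_sites {T : Type*} {Ψ : (T → ℝ) → ℝ} (hΨ : Measurable Ψ)
    {g g' : T → Fin d → ℤ} (hg : Function.Injective g) (hg' : Function.Injective g') :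
    ∫ η, Ψ (fun v => η (g v)) ∂(fieldLaw d ν) = ∫ η, Ψ (fun v => η (g' v)) ∂(fieldLaw d ν) :=
  ((measurePreserving_comp_injective ν hg).hasLaw.integral_comp hΨ.aestronglyMeasurable).trans
    ((measurePreserving_comp_injective ν hg').hasLaw.integral_comp hΨ.aestronglyMeasurable).symm

lemma integrable_comp_sites {T : Type*} {Ψ : (T → ℝ) → ℝ} (hΨ : Measurable Ψ)
    {g g' : T → Fin d → ℤ} (hg : Function.Injective g) (hg' : Function.Injective g')
    (hi : Integrable (fun η => Ψ (fun v => η (g v))) (fieldLaw d ν)) :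
    Integrable (fun η => Ψ (fun v => η (g' v))) (fieldLaw d ν) :=
  ((measurePreserving_comp_injective ν hg').integrable_comp (g := Ψ) hΨ.aestronglyMeasurable).2
    (((measurePreserving_comp_injective ν hg).integrable_comp hΨ.aestronglyMeasurable).1 hi)

lemma integral_abs_eval (x : Fin d → ℤ) :
    ∫ η : Fields d, |η x| ∂(fieldLaw d ν) = ∫ t, |t| ∂ν :=
  (measurePreserving_eval_fieldLaw ν x).hasLaw.integral_comp (f := fun t => |t|) (by fun_prop)

lemma memLp_eval {p : ℝ≥0∞} (hν : MemLp id p ν) (x : Fin d → ℤ) :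
    MemLp (fun η : Fields d => η x) p (fieldLaw d ν) :=
  hν.comp_measurePreserving (measurePreserving_eval_fieldLaw ν x)

lemma integral_condAv {f : Fields d → ℝ} (hf : Integrable f (fieldLaw d ν))
    (Λ : Finset (Fin d → ℤ)) :
    ∫ η, condAv ν Λ f η ∂(fieldLaw d ν) = ∫ η, f η ∂(fieldLaw d ν) := by
  have hΛ := measurePreserving_splice (d := d) ν Λ
  rw [← hΛ.hasLaw.integral_comp hf.aestronglyMeasurable]
  exact (integral_prod _ (hΛ.integrable_comp_of_integrable hf)).symm

end ProductLaw

section SiteLipschitz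

variable {d : ℕ}

/-- `f` depends on the fields in `s` only, and is `c`-Lipschitz for the `ℓ¹` distance. -/
def SiteLipschitz (f : Fields d → ℝ) (s : Finset (Fin d → ℤ)) (c : ℝ) : Prop :=
  ∀ η η', |f η - f η'| ≤ c * ∑ x ∈ s, |η x - η' x|

namespace SiteLipschitz

variable {f : Fields d → ℝ} {s : Finset (Fin d → ℤ)} {c : ℝ}

lemma congr (hf : SiteLipschitz f s c) {η η' : Fields d} (h : ∀ x ∈ s, η x = η' x) :
    f η = f η' := by
  have h1 := hf η η'
  rw [Finset.sum_eq_zero fun x hx => by rw [h x hx, sub_self, abs_zero], mul_zero] at h1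
  exact sub_eq_zero.1 (abs_nonpos_iff.1 h1)

lemma mono (hf : SiteLipschitz f s c) {t : Finset (Fin d → ℤ)} (hst : s ⊆ t) (hc : 0 ≤ c) :
    SiteLipschitz f t c := fun η η' =>
  (hf η η').trans (mul_le_mul_of_nonneg_left
    (Finset.sum_le_sum_of_subset_of_nonneg hst fun _ _ _ => abs_nonneg _) hc)

lemma continuous (hf : SiteLipschitz f s c) : Continuous f := by
  refine continuous_iff_continuousAt.2 fun η => tendsto_iff_norm_sub_tendsto_zero.2 ?_
  have bound_tendsto : Tendsto (fun η' : Fields d => c * ∑ x ∈ s, |η' x - η x|) (𝓝 η) (𝓝 0) := by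
    have : Continuous fun η' : Fields d => c * ∑ x ∈ s, |η' x - η x| := by fun_prop
    simpa using this.tendsto η
  exact squeeze_zero (fun _ => norm_nonneg _) (fun η' => hf η' η) bound_tendsto

lemma measurable (hf : SiteLipschitz f s c) : Measurable f := hf.continuous.measurable

lemma abs_le (hf : SiteLipschitz f s c) (η : Fields d) :
    |f η| ≤ |f 0| + c * ∑ x ∈ s, |η x| := by
  have h := hf η 0
  simp only [Pi.zero_apply, sub_zero] at h
  linarith [abs_sub_abs_le_abs_sub (f η) (f 0)]

lemma comp_splice_left (hf : SiteLipschitz f s c) (hc : 0 ≤ c) (Λ : Finset (Fin d → ℤ))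
    (η : Fields d) : SiteLipschitz (fun ω => f (splice Λ η ω)) s c := fun ω ω' => by
  refine (hf _ _).trans (mul_le_mul_of_nonneg_left (Finset.sum_le_sum fun x _ => ?_) hc)
  unfold splice
  split_ifs <;> simp

lemma comp_splice_right (hf : SiteLipschitz f s c) (hc : 0 ≤ c) (Λ : Finset (Fin d → ℤ))
    (ω : Fields d) : SiteLipschitz (fun η => f (splice Λ η ω)) (s ∩ Λ) c := fun η η' => by
  refine (hf _ _).trans (mul_le_mul_of_nonneg_left (le_of_eq ?_) hc)
  rw [← Finset.filter_mem_eq_inter, Finset.sum_filter]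
  refine Finset.sum_congr rfl fun x _ => ?_
  by_cases hx : x ∈ Λ <;> simp [splice, hx]

variable {ν : Measure ℝ} [IsProbabilityMeasure ν]

lemma memLp (hf : SiteLipschitz f s c) (hν : MemLp id 2 ν) :
    MemLp f 2 (fieldLaw d ν) := by
  have hsum : MemLp (fun η : Fields d => ∑ x ∈ s, |η x|) 2 (fieldLaw d ν) :=
    memLp_finsetSum s fun x _ => (memLp_eval hν x).abs
  exact ((memLp_const |f 0|).add (hsum.const_mul c)).mono hf.measurable.aestronglyMeasurable
    (Eventually.of_forall fun η => (hf.abs_le η).trans (le_abs_self _))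

lemma integrable (hf : SiteLipschitz f s c) (hν : MemLp id 2 ν) :
    Integrable f (fieldLaw d ν) := (hf.memLp hν).integrable one_le_two

protected lemma condAv (hf : SiteLipschitz f s c) (hc : 0 ≤ c) (hν : MemLp id 2 ν)
    (Λ : Finset (Fin d → ℤ)) : SiteLipschitz (condAv ν Λ f) (s ∩ Λ) c := fun η η' => by
  have hη := (hf.comp_splice_left hc Λ η).integrable hν
  have hη' := (hf.comp_splice_left hc Λ η').integrable hν
  calc |condAv ν Λ f η - condAv ν Λ f η'|
      = |∫ ω, (f (splice Λ η ω) - f (splice Λ η' ω)) ∂(fieldLaw d ν)| := by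
        rw [integral_sub hη hη', condAv, condAv]
    _ ≤ ∫ ω, |f (splice Λ η ω) - f (splice Λ η' ω)| ∂(fieldLaw d ν) :=
        abs_integral_le_integral_abs
    _ ≤ ∫ _ω : Fields d, c * ∑ x ∈ s ∩ Λ, |η x - η' x| ∂(fieldLaw d ν) :=
        integral_mono (hη.sub hη').abs (integrable_const _)
          fun ω => hf.comp_splice_right hc Λ ω η η'
    _ = c * ∑ x ∈ s ∩ Λ, |η x - η' x| := by simp

lemma integral_mul_condAv (hf : SiteLipschitz f s c) (hc : 0 ≤ c) (hν : MemLp id 2 ν)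
    (Λ : Finset (Fin d → ℤ)) :
    ∫ η, f η * condAv ν Λ f η ∂(fieldLaw d ν)
      = ∫ η, condAv ν Λ f η ^ 2 ∂(fieldLaw d ν) := by
  have hg := hf.condAv hc hν Λ
  have condAv_splice (η ω : Fields d) : condAv ν Λ f (splice Λ η ω)
      = condAv ν Λ f η :=
    hg.congr fun x hx => by simp [splice, (Finset.mem_inter.1 hx).2]
  rw [← integral_condAv (f := fun η => f η * condAv ν Λ f η)
    ((hf.memLp hν).integrable_mul (hg.memLp hν)) Λ]
  refine integral_congr_ae (Eventually.of_forall fun η => ?_)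
  change ∫ ω, f (splice Λ η ω) * condAv ν Λ f (splice Λ η ω) ∂(fieldLaw d ν) = _
  simp only [condAv_splice]
  rw [integral_mul_const, sq, condAv]

end SiteLipschitz

variable {ν : Measure ℝ} [IsProbabilityMeasure ν]

lemma integral_sub_sq {Ω : Type*} [MeasurableSpace Ω] {P : Measure Ω} {X Y : Ω → ℝ}
    (hX : MemLp X 2 P) (hY : MemLp Y 2 P) :
    ∫ ω, (X ω - Y ω) ^ 2 ∂P = ∫ ω, X ω ^ 2 ∂P + ∫ ω, Y ω ^ 2 ∂P - 2 * ∫ ω, X ω * Y ω ∂P := by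
  have hXY : Integrable (fun ω => X ω * Y ω) P := hX.integrable_mul hY
  have hsum : Integrable (fun ω => X ω ^ 2 + Y ω ^ 2) P := hX.integrable_sq.add hY.integrable_sq
  rw [← integral_const_mul, ← integral_add hX.integrable_sq hY.integrable_sq,
    ← integral_sub hsum (hXY.const_mul 2)]
  congr with ω
  ring

lemma integral_prod_sub_sq {Ω : Type*} [MeasurableSpace Ω] {P : Measure Ω}
    [IsProbabilityMeasure P] {X : Ω → ℝ} (hX : MemLp X 2 P) :
    ∫ p, (X p.1 - X p.2) ^ 2 ∂(P.prod P) = 2 * Var[X; P] := by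
  have h1 : MemLp (fun p : Ω × Ω => X p.1) 2 (P.prod P) :=
    hX.comp_measurePreserving measurePreserving_fst
  have h2 : MemLp (fun p : Ω × Ω => X p.2) 2 (P.prod P) :=
    hX.comp_measurePreserving measurePreserving_snd
  rw [integral_sub_sq h1 h2, integral_prod_mul,
    integral_fun_fst (fun ω => X ω ^ 2), integral_fun_snd (fun ω => X ω ^ 2), variance_eq_sub hX]
  simp only [probReal_univ, one_smul, Pi.pow_apply]
  ring

/-- Resampling the fields off `Λ` measures the variance that conditioning on `η_Λ` removes. -/
lemma SiteLipschitz.integral_prod_sub_splice_sq {f : Fields d → ℝ} {s : Finset (Fin d → ℤ)} {c : ℝ}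
    (hf : SiteLipschitz f s c) (hc : 0 ≤ c) (hν : MemLp id 2 ν) (Λ : Finset (Fin d → ℤ)) :
    ∫ p, (f p.1 - f (splice Λ p.1 p.2)) ^ 2 ∂((fieldLaw d ν).prod (fieldLaw d ν))
      = 2 * (Var[f; fieldLaw d ν] - Var[condAv ν Λ f; fieldLaw d ν]) := by
  have hf2 := hf.memLp hν
  have hsplice := measurePreserving_splice (d := d) ν Λ
  have h1 : MemLp (fun p : Fields d × Fields d => f p.1) 2
      ((fieldLaw d ν).prod (fieldLaw d ν)) := hf2.comp_measurePreserving measurePreserving_fst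
  have h2 : MemLp (fun p : Fields d × Fields d => f (splice Λ p.1 p.2)) 2
      ((fieldLaw d ν).prod (fieldLaw d ν)) := hf2.comp_measurePreserving hsplice
  have resampled_sq : ∫ p, f (splice Λ p.1 p.2) ^ 2 ∂((fieldLaw d ν).prod (fieldLaw d ν))
      = ∫ η, f η ^ 2 ∂(fieldLaw d ν) :=
    hsplice.hasLaw.integral_comp (f := fun η => f η ^ 2) hf2.integrable_sq.aestronglyMeasurable
  have cross : ∫ p, f p.1 * f (splice Λ p.1 p.2) ∂((fieldLaw d ν).prod (fieldLaw d ν))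
      = ∫ η, condAv ν Λ f η ^ 2 ∂(fieldLaw d ν) := by
    rw [integral_prod (fun p => f p.1 * f (splice Λ p.1 p.2)) (h1.integrable_mul h2),
      ← hf.integral_mul_condAv hc hν]
    simp only [integral_const_mul, condAv]
  rw [integral_sub_sq h1 h2,
    integral_fun_fst (fun η => f η ^ 2), resampled_sq, cross, variance_eq_sub hf2,
    variance_eq_sub ((hf.condAv hc hν Λ).memLp hν), integral_condAv (hf.integrable hν)]
  simp only [probReal_univ, one_smul, Pi.pow_apply]
  ring

lemma variance_sub_variance_condAv_le (hν : MemLp id 2 ν) {c : ℝ} (hc : 0 ≤ c)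
    {s : Finset (Fin d → ℤ)} {a : Fin d → ℤ} {f : Fields d → ℝ}
    (hf : SiteLipschitz f (insert a s) c) (ha : a ∉ s) :
    Var[f; fieldLaw d ν] - Var[condAv ν s f; fieldLaw d ν] ≤ c ^ 2 * Var[id; ν] := by
  have hf2 := hf.memLp hν
  have hev := memLp_eval (d := d) hν a
  have pointwise (p : Fields d × Fields d) :
      (f p.1 - f (splice s p.1 p.2)) ^ 2 ≤ c ^ 2 * (p.1 a - p.2 a) ^ 2 := by
    rw [← mul_pow, sq_le_sq, abs_mul, abs_of_nonneg hc]
    refine (hf _ _).trans (le_of_eq ?_)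
    rw [Finset.sum_insert ha, Finset.sum_eq_zero fun x hx => by simp [splice, hx], add_zero]
    simp [splice, ha]
  have integrated : ∫ p, (f p.1 - f (splice s p.1 p.2)) ^ 2 ∂((fieldLaw d ν).prod (fieldLaw d ν))
      ≤ ∫ p, c ^ 2 * (p.1 a - p.2 a) ^ 2 ∂((fieldLaw d ν).prod (fieldLaw d ν)) :=
    integral_mono
      ((hf2.comp_measurePreserving measurePreserving_fst).sub
        (hf2.comp_measurePreserving (measurePreserving_splice ν s))).integrable_sq
      (((hev.comp_measurePreserving measurePreserving_fst).sub
        (hev.comp_measurePreserving measurePreserving_snd)).integrable_sq.const_mul _) pointwise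
  have eval_variance : Var[fun η : Fields d => η a; fieldLaw d ν] = Var[id; ν] :=
    (measurePreserving_eval_fieldLaw ν a).hasLaw.variance_eq
  rw [hf.integral_prod_sub_splice_sq hc hν, integral_const_mul, integral_prod_sub_sq hev,
    eval_variance] at integrated
  linarith

theorem variance_le_of_siteLipschitz (hν : MemLp id 2 ν) {c : ℝ} (hc : 0 ≤ c)
    {s : Finset (Fin d → ℤ)} {f : Fields d → ℝ} (hf : SiteLipschitz f s c) :
    Var[f; fieldLaw d ν] ≤ c ^ 2 * s.card * Var[id; ν] := by
  induction s using Finset.induction_on generalizing f with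
  | empty =>
    have hconst : f = fun _ => f 0 := funext fun η => hf.congr (by simp)
    rw [hconst, variance_eq_integral aemeasurable_const]
    simp
  | insert a s ha ih =>
    have hcond := ih ((hf.condAv hc hν s).mono
      (Finset.inter_subset_right : insert a s ∩ s ⊆ s) hc)
    have hstep := variance_sub_variance_condAv_le hν hc hf ha
    rw [Finset.card_insert_of_notMem ha]
    push_cast
    linarith

lemma ae_tendsto_zero_of_integral_sq_le {Ω : Type*} [MeasurableSpace Ω] {P : Measure Ω}
    {X : ℕ → Ω → ℝ} (hX : ∀ n, MemLp (X n) 2 P) {b : ℕ → ℝ} (hb : Summable b)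
    (h : ∀ n, ∫ ω, X n ω ^ 2 ∂P ≤ b n) :
    ∀ᵐ ω ∂P, Tendsto (fun n => X n ω) atTop (𝓝 0) := by
  have hm (n : ℕ) : AEMeasurable (fun ω => ENNReal.ofReal (X n ω ^ 2)) P :=
    ((hX n).aestronglyMeasurable.aemeasurable.pow_const 2).ennreal_ofReal
  have hterm (n : ℕ) : ∫⁻ ω, ENNReal.ofReal (X n ω ^ 2) ∂P ≤ ENNReal.ofReal (b n) := by
    rw [← ofReal_integral_eq_lintegral_ofReal (hX n).integrable_sq
      (Eventually.of_forall fun _ => sq_nonneg _)]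
    exact ENNReal.ofReal_le_ofReal (h n)
  have hsum : ∫⁻ ω, ∑' n, ENNReal.ofReal (X n ω ^ 2) ∂P ≠ ⊤ := by
    rw [lintegral_tsum hm]
    exact ne_top_of_le_ne_top hb.tsum_ofReal_ne_top (ENNReal.tsum_le_tsum hterm)
  filter_upwards [ae_lt_top' (AEMeasurable.tsum hm) hsum] with ω hω
  have hsq : Tendsto (fun n => X n ω ^ 2) atTop (𝓝 0) := by
    have := (ENNReal.tendsto_toReal ENNReal.zero_ne_top).comp
      (ENNReal.tendsto_atTop_zero_of_tsum_ne_top hω.ne)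
    refine this.congr fun n => ?_
    rw [Function.comp_apply, ENNReal.toReal_ofReal (sq_nonneg _)]
  have habs := hsq.sqrt
  simp only [Real.sqrt_zero, Real.sqrt_sq_eq_abs] at habs
  exact (tendsto_zero_iff_abs_tendsto_zero _).2 habs

lemma sq_le_card_box_sq (hd : 1 ≤ d) (k : ℕ) : (k : ℝ) ^ 2 ≤ (box d (k ^ 2)).card := by
  have h : k ^ 2 ≤ (2 * k ^ 2 + 1) ^ d :=
    le_trans (by omega) (Nat.le_self_pow (by omega) (2 * k ^ 2 + 1))
  rw [card_box]
  exact_mod_cast h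

lemma integral_centered_div_card_sq_le (hd : 1 ≤ d) (hν : MemLp id 2 ν) {c : ℝ} (hc : 0 ≤ c)
    {k : ℕ} (hk : k ≠ 0) {f : Fields d → ℝ} (hf : SiteLipschitz f (box d (k ^ 2)) c) :
    ∫ η, ((f η - ∫ ω, f ω ∂(fieldLaw d ν)) / (box d (k ^ 2)).card) ^ 2 ∂(fieldLaw d ν)
      ≤ c ^ 2 * Var[id; ν] * (1 / (k : ℝ) ^ 2) := by
  have hk0 : (0 : ℝ) < (k : ℝ) ^ 2 := by positivity
  have hB := sq_le_card_box_sq hd k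
  have hB0 : (0 : ℝ) < (box d (k ^ 2)).card := hk0.trans_le hB
  have hvar : 0 ≤ Var[id; ν] := variance_nonneg _ _
  calc ∫ η, ((f η - ∫ ω, f ω ∂(fieldLaw d ν)) / (box d (k ^ 2)).card) ^ 2 ∂(fieldLaw d ν)
      = Var[f; fieldLaw d ν] / ((box d (k ^ 2)).card : ℝ) ^ 2 := by
        simp only [div_pow]
        rw [integral_div, variance_eq_integral hf.measurable.aemeasurable]
    _ ≤ c ^ 2 * (box d (k ^ 2)).card * Var[id; ν] / ((box d (k ^ 2)).card : ℝ) ^ 2 := by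
        gcongr
        exact variance_le_of_siteLipschitz hν hc hf
    _ = c ^ 2 * Var[id; ν] * (1 / ((box d (k ^ 2)).card : ℝ)) := by field_simp
    _ ≤ c ^ 2 * Var[id; ν] * (1 / (k : ℝ) ^ 2) := by gcongr

/-- Along the squares the variances are summable, so no maximal inequality is needed. -/
theorem ae_tendsto_centered_div_card (hd : 1 ≤ d) (hν : MemLp id 2 ν) {c : ℝ} (hc : 0 ≤ c)
    {f : ℕ → Fields d → ℝ} {N : ℕ} (hf : ∀ K, N ≤ K → SiteLipschitz (f K) (box d K) c) :
    ∀ᵐ η ∂(fieldLaw d ν), Tendsto (fun n : ℕ =>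
      (f (n ^ 2) η - ∫ ω, f (n ^ 2) ω ∂(fieldLaw d ν)) / (box d (n ^ 2)).card) atTop (𝓝 0) := by
  have hL (n : ℕ) : SiteLipschitz (f ((n + (N + 1)) ^ 2)) (box d ((n + (N + 1)) ^ 2)) c :=
    hf _ ((by omega : N ≤ n + (N + 1)).trans (Nat.le_self_pow two_ne_zero _))
  have shifted := ae_tendsto_zero_of_integral_sq_le
    (fun n => (((hL n).memLp hν).sub (memLp_const
      (∫ ω, f ((n + (N + 1)) ^ 2) ω ∂(fieldLaw d ν)))).mul_const
        ((box d ((n + (N + 1)) ^ 2)).card : ℝ)⁻¹)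
    (((summable_nat_add_iff (N + 1)).2 (Real.summable_one_div_nat_pow.2 one_lt_two)).mul_left
      (c ^ 2 * Var[id; ν]))
    (fun n => integral_centered_div_card_sq_le hd hν hc (Nat.succ_ne_zero (n + N)) (hL n))
  filter_upwards [shifted] with η hη
  exact (tendsto_add_atTop_iff_nat (N + 1)).1 hη

end SiteLipschitz

lemma exists_tendsto_of_forall_eventually_near {x : ℕ → ℝ}
    (h : ∀ e > 0, ∃ c, ∀ᶠ K in atTop, |x K - c| ≤ e) : ∃ l, Tendsto x atTop (𝓝 l) := by
  refine cauchySeq_tendsto_of_complete (Metric.cauchySeq_iff'.2 fun e he => ?_)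
  obtain ⟨c, hc⟩ := h (e / 3) (by positivity)
  obtain ⟨N, hN⟩ := eventually_atTop.1 hc
  refine ⟨N, fun n hn => ?_⟩
  have hn' := abs_le.1 (hN n hn)
  have hN' := abs_le.1 (hN N le_rfl)
  rw [Real.dist_eq, abs_lt]
  constructor <;> linarith

lemma exists_tendsto_of_asymptotic_bounds {x b : ℕ → ℝ} {u : ℕ → ℕ → ℝ}
    (hb : Tendsto b atTop (𝓝 0)) (hu : ∀ M, Tendsto (u M) atTop (𝓝 (b M)))
    (hx : ∀ᶠ M in atTop, ∀ᶠ K in atTop, |x K - x M| ≤ u M K) :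
    ∃ l, Tendsto x atTop (𝓝 l) := by
  refine exists_tendsto_of_forall_eventually_near fun e he => ?_
  obtain ⟨M, hMe, hM⟩ := ((hb.eventually (gt_mem_nhds he)).and hx).exists
  refine ⟨x M, ?_⟩
  filter_upwards [(hu M).eventually (gt_mem_nhds hMe), hM] with K hKe hK
  exact hK.trans hKe.le

section Tiling

lemma tendsto_two_mul_add_one_atTop : Tendsto (fun K : ℕ => 2 * K + 1) atTop atTop :=
  tendsto_atTop_mono (fun K => (by omega : K ≤ 2 * K + 1)) tendsto_id

/-- The fraction of the periodic box of side `2K + 1` that is covered by a largest cubical array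
of disjoint boxes of side `2M + 1`. -/
noncomputable def tiledFraction (d M K : ℕ) : ℝ :=
  ((((2 * K + 1) / (2 * M + 1) * (2 * M + 1) : ℕ) : ℝ) / (2 * K + 1 : ℕ)) ^ d

/-- The fraction of the box `Γ_M` occupied by `Γ_{M - R}`. -/
noncomputable def coreFraction (d R M : ℕ) : ℝ :=
  (((2 * (M - R) + 1 : ℕ) : ℝ) / (2 * M + 1 : ℕ)) ^ d

lemma tendsto_natDiv_mul_div_self {p : ℕ} (hp : p ≠ 0) :
    Tendsto (fun n : ℕ => ((n / p * p : ℕ) : ℝ) / n) atTop (𝓝 1) := by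
  have h := ((tendsto_nat_floor_mul_div_atTop (R := ℝ) (a := (p : ℝ)⁻¹) (by positivity)).comp
    tendsto_natCast_atTop_atTop).mul_const (p : ℝ)
  rw [inv_mul_cancel₀ (by positivity)] at h
  refine h.congr fun n => ?_
  simp only [Function.comp_apply]
  rw [inv_mul_eq_div, Nat.floor_div_eq_div, Nat.cast_mul, div_mul_eq_mul_div]

lemma tendsto_tiledFraction (d M : ℕ) : Tendsto (tiledFraction d M) atTop (𝓝 1) := by
  have h := ((tendsto_natDiv_mul_div_self (Nat.succ_ne_zero (2 * M))).comp
    tendsto_two_mul_add_one_atTop).pow d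
  rwa [one_pow] at h

lemma tendsto_coreFraction (d R : ℕ) : Tendsto (coreFraction d R) atTop (𝓝 1) := by
  have h0 : Tendsto (fun M : ℕ => (1 : ℝ) - (2 * R) * ((2 * M + 1 : ℕ) : ℝ)⁻¹) atTop
      (𝓝 (1 - 2 * R * 0)) :=
    tendsto_const_nhds.sub (Tendsto.const_mul _ (tendsto_inv_atTop_zero.comp
      (tendsto_natCast_atTop_atTop.comp tendsto_two_mul_add_one_atTop)))
  have h := h0.pow d
  rw [mul_zero, sub_zero, one_pow] at h
  refine h.congr' ?_
  filter_upwards [eventually_ge_atTop R] with M hM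
  rw [coreFraction]
  congr 1
  rw [eq_div_iff (by positivity), sub_mul, mul_assoc, inv_mul_cancel₀ (by positivity)]
  push_cast [Nat.cast_sub hM]
  ring

lemma abs_density_sub_le_of_tiling {d R K M : ℕ} {E : ℕ → ℝ} {a : ℝ}
    (h : |E K - (((2 * K + 1) / (2 * M + 1) : ℕ) : ℝ) ^ d * E M|
      ≤ 2 * (((2 * K + 1 : ℕ) : ℝ) ^ d - (((2 * K + 1) / (2 * M + 1) : ℕ) : ℝ) ^ d
        * ((2 * (M - R) + 1 : ℕ) : ℝ) ^ d) * a) :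
    |E K / (box d K).card - E M / (box d M).card|
      ≤ 2 * (1 - tiledFraction d M K * coreFraction d R M) * a
        + |tiledFraction d M K - 1| * |E M / (box d M).card| := by
  rw [card_box, card_box, tiledFraction, coreFraction]
  push_cast at h ⊢
  set p : ℝ := (2 * K + 1) ^ d with hp
  set q : ℝ := (2 * M + 1) ^ d with hq
  set n : ℝ := (((2 * K + 1) / (2 * M + 1) : ℕ) : ℝ) ^ d with hn
  have hp0 : 0 < p := by positivity
  have hq0 : 0 < q := by positivity
  rw [div_pow, div_pow, mul_pow, ← hp, ← hq, ← hn]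
  have scaled : |E K / p - n * q / p * (E M / q)|
      ≤ 2 * (1 - n * q / p * ((2 * ((M - R : ℕ) : ℝ) + 1) ^ d / q)) * a := by
    rw [show E K / p - n * q / p * (E M / q) = (E K - n * E M) / p by field_simp,
      abs_div, abs_of_pos hp0, div_le_iff₀ hp0]
    refine h.trans (le_of_eq ?_)
    field_simp
  calc |E K / p - E M / q|
      = |(E K / p - n * q / p * (E M / q)) + (n * q / p - 1) * (E M / q)| := by ring_nf
    _ ≤ _ := (abs_add_le _ _).trans (add_le_add scaled (abs_mul _ _).le)

lemma exists_tendsto_density_of_tiling {d R : ℕ} {E : ℕ → ℝ} {a : ℝ}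
    (h : ∀ K M, R ≤ K → R ≤ M → |E K - (((2 * K + 1) / (2 * M + 1) : ℕ) : ℝ) ^ d * E M|
      ≤ 2 * (((2 * K + 1 : ℕ) : ℝ) ^ d - (((2 * K + 1) / (2 * M + 1) : ℕ) : ℝ) ^ d
        * ((2 * (M - R) + 1 : ℕ) : ℝ) ^ d) * a) :
    ∃ l, Tendsto (fun K => E K / (box d K).card) atTop (𝓝 l) := by
  refine exists_tendsto_of_asymptotic_bounds (b := fun M => 2 * (1 - coreFraction d R M) * a)
    (u := fun M K => 2 * (1 - tiledFraction d M K * coreFraction d R M) * a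
      + |tiledFraction d M K - 1| * |E M / (box d M).card|) ?_ (fun M => ?_) ?_
  · simpa using (((tendsto_coreFraction d R).const_sub 1).const_mul 2).mul_const a
  · have ht := tendsto_tiledFraction d M
    simpa using ((((ht.mul_const (coreFraction d R M)).const_sub 1).const_mul 2).mul_const a).add
      ((ht.sub_const 1).abs.mul_const |E M / (box d M).card|)
  · filter_upwards [eventually_ge_atTop R] with M hM
    filter_upwards [eventually_ge_atTop R] with K hK
    exact abs_density_sub_le_of_tiling (h K M hK hM)

end Tiling

section Squares

lemma tendsto_natSqrt_atTop : Tendsto Nat.sqrt atTop atTop :=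
  tendsto_atTop_atTop.2 fun b => ⟨b * b, fun _ ha => Nat.le_sqrt.2 ha⟩

lemma tendsto_card_box_succ_sq_div (d : ℕ) :
    Tendsto (fun k : ℕ => ((box d ((k + 1) ^ 2)).card : ℝ) / (box d (k ^ 2)).card)
      atTop (𝓝 1) := by
  have side : Tendsto (fun k : ℕ => ((2 * (k + 1) ^ 2 + 1 : ℕ) : ℝ) / (2 * k ^ 2 + 1 : ℕ))
      atTop (𝓝 1) := by
    have upper : Tendsto (fun k : ℕ => (1 : ℝ) + 6 * (k : ℝ)⁻¹) atTop (𝓝 (1 + 6 * 0)) :=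
      tendsto_const_nhds.add ((tendsto_inv_atTop_zero.comp tendsto_natCast_atTop_atTop).const_mul _)
    rw [mul_zero, add_zero] at upper
    refine tendsto_of_tendsto_of_tendsto_of_le_of_le' tendsto_const_nhds upper
      (Eventually.of_forall fun k => ?_) ?_
    · rw [le_div_iff₀ (by positivity), one_mul]
      exact_mod_cast (by gcongr; omega : 2 * k ^ 2 + 1 ≤ 2 * (k + 1) ^ 2 + 1)
    · filter_upwards [eventually_ge_atTop 1] with k hk
      have hk1 : (1 : ℝ) ≤ k := by exact_mod_cast hk
      have : (0 : ℝ) < k := by linarith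
      have expand : (1 + 6 * (k : ℝ)⁻¹) * (2 * k ^ 2 + 1)
          = 2 * k ^ 2 + 1 + 12 * k + 6 * (k : ℝ)⁻¹ := by
        field_simp
        ring
      have hinv : 0 < (k : ℝ)⁻¹ := by positivity
      rw [div_le_iff₀ (by positivity)]
      push_cast
      rw [expand]
      nlinarith
  have h := side.pow d
  rw [one_pow] at h
  refine h.congr fun k => ?_
  rw [card_box, card_box, div_pow]
  push_cast
  rfl

variable {B : ℕ → ℝ}

lemma tendsto_sqrt_sq_div_self (hB : ∀ K, 0 < B K) (hBm : Monotone B)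
    (hr : Tendsto (fun k : ℕ => B ((k + 1) ^ 2) / B (k ^ 2)) atTop (𝓝 1)) :
    Tendsto (fun K : ℕ => B (K.sqrt ^ 2) / B K) atTop (𝓝 1) := by
  have hinv := (hr.inv₀ one_ne_zero).comp tendsto_natSqrt_atTop
  rw [inv_one] at hinv
  refine tendsto_of_tendsto_of_tendsto_of_le_of_le hinv tendsto_const_nhds
    (fun K => ?_) fun K => div_le_one_of_le₀ (hBm (Nat.sqrt_le' K)) (hB _).le
  rw [Function.comp_apply, inv_div]
  exact div_le_div_of_nonneg_left (hB _).le (hB _) (hBm (Nat.lt_succ_sqrt' K).le)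

lemma tendsto_increment_div_of_tendsto_squares (hB : ∀ K, 0 < B K)
    (hr : Tendsto (fun k : ℕ => B ((k + 1) ^ 2) / B (k ^ 2)) atTop (𝓝 1)) {N : ℕ → ℝ} {a : ℝ}
    (hN : Tendsto (fun n : ℕ => N (n ^ 2) / B (n ^ 2)) atTop (𝓝 a)) :
    Tendsto (fun n : ℕ => (N ((n + 1) ^ 2) - N ((n - 1) ^ 2)) / B (n ^ 2)) atTop (𝓝 0) := by
  refine (tendsto_add_atTop_iff_nat 1).1 ?_
  have hinv := hr.inv₀ one_ne_zero
  rw [inv_one] at hinv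
  have h := (((tendsto_add_atTop_iff_nat 2).2 hN).mul ((tendsto_add_atTop_iff_nat 1).2 hr)).sub
    (hN.mul hinv)
  rw [sub_self] at h
  refine h.congr fun k => ?_
  have h0 := (hB (k ^ 2)).ne'
  have h1 := (hB ((k + 1) ^ 2)).ne'
  have h2 := (hB ((k + 2) ^ 2)).ne'
  rw [show k + 1 + 1 = k + 2 by ring, Nat.add_sub_cancel]
  field_simp

lemma abs_sub_sqrt_sq_le {x N : ℕ → ℝ} {R K : ℕ} (hN : Monotone N)
    (hx : ∀ K M, R ≤ M → M ≤ K → |x K - x M| ≤ 2 * (N K - N (M - R))) (hK : R + 1 ≤ K.sqrt) :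
    |x K - x (K.sqrt ^ 2)| ≤ 2 * (N ((K.sqrt + 1) ^ 2) - N ((K.sqrt - 1) ^ 2)) := by
  have hlt := hN (Nat.lt_succ_sqrt' K).le
  have hle := Nat.sqrt_le' K
  generalize K.sqrt = s at hK hlt hle
  obtain ⟨t, rfl⟩ : ∃ t, s = t + 1 := ⟨s - 1, by omega⟩
  have hgap : t ^ 2 + R ≤ (t + 1) ^ 2 := by nlinarith
  have hcore : N ((t + 1 - 1) ^ 2) ≤ N ((t + 1) ^ 2 - R) := hN (by rw [Nat.add_sub_cancel]; omega)
  have := hx K ((t + 1) ^ 2) (by omega) hle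
  linarith

theorem tendsto_div_of_tendsto_squares (hB : ∀ K, 0 < B K) (hBm : Monotone B)
    (hr : Tendsto (fun k : ℕ => B ((k + 1) ^ 2) / B (k ^ 2)) atTop (𝓝 1))
    {x N : ℕ → ℝ} {R : ℕ} {l a : ℝ} (hN : Monotone N)
    (hx : ∀ K M, R ≤ M → M ≤ K → |x K - x M| ≤ 2 * (N K - N (M - R)))
    (hxl : Tendsto (fun n : ℕ => x (n ^ 2) / B (n ^ 2)) atTop (𝓝 l))
    (hNa : Tendsto (fun n : ℕ => N (n ^ 2) / B (n ^ 2)) atTop (𝓝 a)) :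
    Tendsto (fun K : ℕ => x K / B K) atTop (𝓝 l) := by
  have increment : Tendsto (fun K : ℕ => (x K - x (K.sqrt ^ 2)) / B (K.sqrt ^ 2)) atTop (𝓝 0) := by
    have bound := ((tendsto_increment_div_of_tendsto_squares hB hr hNa).const_mul 2).comp
      tendsto_natSqrt_atTop
    rw [mul_zero] at bound
    refine squeeze_zero_norm' ?_ bound
    filter_upwards [tendsto_natSqrt_atTop.eventually_ge_atTop (R + 1)] with K hK
    rw [Function.comp_apply, Real.norm_eq_abs, abs_div, abs_of_pos (hB _), ← mul_div_assoc]
    exact div_le_div_of_nonneg_right (abs_sub_sqrt_sq_le hN hx hK) (hB _).le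
  have h := (increment.add (hxl.comp tendsto_natSqrt_atTop)).mul
    (tendsto_sqrt_sq_div_self hB hBm hr)
  rw [zero_add, mul_one] at h
  refine h.congr fun K => ?_
  have hsq := (hB (K.sqrt ^ 2)).ne'
  have hK := (hB K).ne'
  rw [Function.comp_apply]
  field_simp
  ring

end Squares

lemma tendsto_of_lipschitzWith_of_forall_rat {C : NNReal} {f : ℕ → ℝ → ℝ} {F : ℝ → ℝ}
    (hf : ∀ᶠ K in atTop, LipschitzWith C (f K)) (hF : Continuous F)
    (h : ∀ r : ℚ, Tendsto (fun K => f K r) atTop (𝓝 (F r))) (x : ℝ) :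
    Tendsto (fun K => f K x) atTop (𝓝 (F x)) := by
  obtain ⟨N, hN⟩ := eventually_atTop.1 hf
  have equicont : Equicontinuous fun K => f (K + N) :=
    (LipschitzWith.uniformEquicontinuous _ C fun K => hN _ (Nat.le_add_left N K)).equicontinuous
  have closed := equicont.isClosed_setOfPred_tendsto (l := atTop) hF
  have dense : ∀ x, Tendsto (fun K => f (K + N) x) atTop (𝓝 (F x)) := fun x =>
    Rat.denseRange_cast.induction_on (p := fun x => Tendsto (fun K => f (K + N) x) atTop (𝓝 (F x)))
      x closed fun r => (tendsto_add_atTop_iff_nat N).2 (h r)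
  exact (tendsto_add_atTop_iff_nat N).1 (dense x)

/-! ### The free energy density -/

lemma card_box_pos (d K : ℕ) : (0 : ℝ) < (box d K).card := by
  rw [card_box]
  positivity

lemma card_compl_blockCore_tiling {d K M L m : ℕ} (hLM : L ≤ M)
    (hm : m * (2 * M + 1) ≤ 2 * K + 1) :
    ((blockCore K M L fun i : Fin d → Fin m =>
        proj K fun k => ((2 * M + 1 : ℕ) : ℤ) * (i k : ℕ))ᶜ.card : ℝ)
      = ((2 * K + 1 : ℕ) : ℝ) ^ d - (m : ℝ) ^ d * ((2 * L + 1 : ℕ) : ℝ) ^ d := by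
  rw [Finset.card_compl, Nat.cast_sub (Finset.card_le_univ _), card_torus,
    card_blockCore hLM (blockSite_tiling_injective hm), Fintype.card_fun, Fintype.card_fin,
    Fintype.card_fin]
  push_cast
  rfl

namespace LatticeSystem

variable {σ : Type*} [Fintype σ] [DecidableEq σ] {d : ℕ}

section SiteNormBound

variable (S : LatticeSystem d σ)

/-- A bound for the norm of the part of the Hamiltonian attached to one site, when the external
field there is `h + ε * t`. -/
noncomputable def siteNormBound (ε h t : ℝ) : ℝ := S.siteBound + |h| + ε * |t|

/-- A bound for the norm of the part of the Hamiltonian attached to the sites of `Γ_L`. -/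
noncomputable def boxNormBound (ε h : ℝ) (L : ℕ) (η : Fields d) : ℝ :=
  ∑ x ∈ box d L, S.siteNormBound ε h (η x)

variable {S} {ε : ℝ}

lemma siteNormBound_nonneg (hε : 0 ≤ ε) (h t : ℝ) : 0 ≤ S.siteNormBound ε h t := by
  have := S.siteBound_nonneg
  unfold siteNormBound
  positivity

lemma siteBound_add_abs_le (hε : 0 ≤ ε) (h t : ℝ) :
    S.siteBound + |h + ε * t| ≤ S.siteNormBound ε h t := by
  rw [siteNormBound, add_assoc]
  gcongr
  exact (abs_add_le _ _).trans_eq (by rw [abs_mul, abs_of_nonneg hε])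

lemma boxNormBound_mono (hε : 0 ≤ ε) (h : ℝ) (η : Fields d) :
    Monotone fun L => S.boxNormBound ε h L η := fun _ _ hLM =>
  Finset.sum_le_sum_of_subset_of_nonneg (box_subset_box hLM) fun _ _ _ =>
    siteNormBound_nonneg hε h _

lemma siteLipschitz_boxNormBound (hε : 0 ≤ ε) (h : ℝ) (L : ℕ) :
    SiteLipschitz (S.boxNormBound ε h L) (box d L) ε := fun η η' => by
  rw [boxNormBound, boxNormBound, ← Finset.sum_sub_distrib, Finset.mul_sum]
  refine (Finset.abs_sum_le_sum_abs _ _).trans (Finset.sum_le_sum fun x _ => ?_)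
  rw [siteNormBound, siteNormBound, add_sub_add_left_eq_sub, ← mul_sub, abs_mul, abs_of_nonneg hε]
  exact mul_le_mul_of_nonneg_left (abs_abs_sub_abs_le _ _) hε

variable (S ε) {ν : Measure ℝ} [IsProbabilityMeasure ν] (hν : MemLp id 1 ν) (h : ℝ)
include hν

lemma integrable_siteNormBound (x : Fin d → ℤ) :
    Integrable (fun η : Fields d => S.siteNormBound ε h (η x)) (fieldLaw d ν) :=
  (integrable_const _).add (((memLp_one_iff_integrable.1 (memLp_eval hν x)).abs).const_mul ε)

lemma integral_siteNormBound (x : Fin d → ℤ) :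
    ∫ η : Fields d, S.siteNormBound ε h (η x) ∂(fieldLaw d ν)
      = S.siteNormBound ε h (∫ t, |t| ∂ν) := by
  have habs := (memLp_one_iff_integrable.1 (memLp_eval (d := d) hν x)).abs
  simp only [siteNormBound]
  rw [integral_add (integrable_const _) (habs.const_mul ε), integral_const_mul, integral_abs_eval,
    integral_const, probReal_univ, one_smul, abs_of_nonneg (integral_nonneg fun t => abs_nonneg t)]

lemma integral_sum_siteNormBound {ι : Type*} (s : Finset ι) (g : ι → Fin d → ℤ) :
    ∫ η : Fields d, ∑ i ∈ s, S.siteNormBound ε h (η (g i)) ∂(fieldLaw d ν)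
      = s.card * S.siteNormBound ε h (∫ t, |t| ∂ν) := by
  rw [integral_finsetSum _ fun i _ => S.integrable_siteNormBound ε hν h (g i)]
  simp only [integral_siteNormBound S ε hν, Finset.sum_const, nsmul_eq_mul]

end SiteNormBound

section TorusFreeEnergy

variable (S : LatticeSystem d σ) (β : ℝ≥0∞) (ε : ℝ)

/-- The finite volume free energy defined with the normalized trace `Tr 1 = 1`, for which the free
energy of a disjoint union of blocks is the sum of the free energies of the blocks, whether or not
the blocks fill the volume. -/
noncomputable def torusFreeEnergy (h : ℝ) (K : ℕ) (η : Fields d) : ℝ :=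
  normalizedFreeEnergy β (S.fieldHamiltonian K fun v => h + ε * η (rep v))

lemma torusFreeEnergy_eq (h : ℝ) (K : ℕ) (η : Fields d) :
    S.torusFreeEnergy β ε h K η = S.freeEnergy β ε h K η
      + (box d K).card * (β.toReal⁻¹ * Real.log (Fintype.card σ)) := by
  rw [torusFreeEnergy, normalizedFreeEnergy, freeEnergy_eq_eqFreeEnergy, Fintype.card_fun,
    card_torus, card_box, Nat.cast_pow, Real.log_pow]
  ring

lemma integral_torusFreeEnergy_div {ν : Measure ℝ} [IsProbabilityMeasure ν] {h : ℝ} {K : ℕ}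
    (hf : Integrable (S.freeEnergy β ε h K) (fieldLaw d ν)) :
    (∫ η, S.torusFreeEnergy β ε h K η ∂(fieldLaw d ν)) / (box d K).card
      = (∫ η, S.freeEnergy β ε h K η ∂(fieldLaw d ν)) / (box d K).card
        + β.toReal⁻¹ * Real.log (Fintype.card σ) := by
  simp only [torusFreeEnergy_eq]
  rw [integral_add hf (integrable_const _), integral_const, probReal_univ, one_smul, add_div,
    mul_div_cancel_left₀ _ (card_box_pos d K).ne']

end TorusFreeEnergy

section FreeEnergy

variable [Nonempty σ] {S : LatticeSystem d σ} {β : ℝ≥0∞} {ε : ℝ}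

lemma siteLipschitz_freeEnergy (hβ : β ≠ 0) (hε : 0 ≤ ε) (h : ℝ) {K : ℕ} (hK : S.radius ≤ K) :
    SiteLipschitz (S.freeEnergy β ε h K) (box d K) ε := fun η η' => by
  rw [freeEnergy_eq_eqFreeEnergy, freeEnergy_eq_eqFreeEnergy, ← sum_rep (fun x => |η x - η' x|),
    Finset.mul_sum]
  refine (abs_eqFreeEnergy_fieldHamiltonian_sub_le hβ hK _ _).trans_eq
    (Finset.sum_congr rfl fun v _ => ?_)
  rw [add_sub_add_left_eq_sub, ← mul_sub, abs_mul, abs_of_nonneg hε]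

lemma abs_freeEnergy_sub_le (hβ : β ≠ 0) (h h' : ℝ) {K : ℕ} (hK : S.radius ≤ K)
    (η : Fields d) :
    |S.freeEnergy β ε h K η - S.freeEnergy β ε h' K η| ≤ (box d K).card * |h - h'| := by
  rw [freeEnergy_eq_eqFreeEnergy, freeEnergy_eq_eqFreeEnergy]
  refine (abs_eqFreeEnergy_fieldHamiltonian_sub_le hβ hK _ _).trans_eq ?_
  simp only [add_sub_add_right_eq_sub, Finset.sum_const, Finset.card_univ, card_torus, card_box,
    nsmul_eq_mul]

lemma siteLipschitz_torusFreeEnergy (hβ : β ≠ 0) (hε : 0 ≤ ε) (h : ℝ) {K : ℕ}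
    (hK : S.radius ≤ K) : SiteLipschitz (S.torusFreeEnergy β ε h K) (box d K) ε := fun η η' => by
  rw [torusFreeEnergy_eq, torusFreeEnergy_eq, add_sub_add_right_eq_sub]
  exact siteLipschitz_freeEnergy hβ hε h hK η η'

lemma measurable_normalizedFreeEnergy_fieldHamiltonian (hβ : β ≠ 0) (K : ℕ) (ε h : ℝ) :
    Measurable fun ξ : Torus d K → ℝ =>
      normalizedFreeEnergy β (S.fieldHamiltonian K fun v => h + ε * ξ v) :=
  (((continuous_eqFreeEnergy_fieldHamiltonian hβ K).comp
    (by fun_prop : Continuous fun (ξ : Torus d K → ℝ) v => h + ε * ξ v)).add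
      continuous_const).measurable

lemma abs_torusFreeEnergy_sub_le (hβ : β ≠ 0) (hε : 0 ≤ ε) (h : ℝ) (η : Fields d) {K M : ℕ}
    (hM : S.radius ≤ M) (hMK : M ≤ K) :
    |S.torusFreeEnergy β ε h K η - S.torusFreeEnergy β ε h M η|
      ≤ 2 * (S.boxNormBound ε h K η - S.boxNormBound ε h (M - S.radius) η) := by
  have hsub : M - S.radius ≤ K := (Nat.sub_le _ _).trans hMK
  have block := abs_normalizedFreeEnergy_sub_sum_blocks_le (S := S) hβ (hM.trans hMK) hM
    (blockSite_zero_injective hMK) (fun v => h + ε * η (rep v))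
  simp only [rep_blockSite_zero hMK, Finset.univ_unique, Finset.sum_singleton] at block
  refine block.trans (mul_le_mul_of_nonneg_left ?_ zero_le_two)
  calc _ ≤ ∑ u ∈ (blockCore K M (M - S.radius) fun _ : Unit => 0)ᶜ,
        S.siteNormBound ε h (η (rep u)) :=
        Finset.sum_le_sum fun u _ => siteBound_add_abs_le hε h _
    _ = ∑ u : Torus d K, if rep u ∈ box d (M - S.radius) then 0
          else S.siteNormBound ε h (η (rep u)) := by
        rw [Finset.sum_ite, Finset.sum_const_zero, zero_add]
        congr 1
        ext u
        simp [mem_blockCore_zero (Nat.sub_le M S.radius) hMK]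
    _ = S.boxNormBound ε h K η - S.boxNormBound ε h (M - S.radius) η := by
        rw [sum_rep fun x => if x ∈ box d (M - S.radius) then 0 else S.siteNormBound ε h (η x),
          Finset.sum_ite, Finset.sum_const_zero, zero_add, boxNormBound, boxNormBound,
          ← Finset.sum_sdiff (box_subset_box hsub), add_sub_cancel_right, Finset.sdiff_eq_filter]

variable {ν : Measure ℝ} [IsProbabilityMeasure ν]

lemma abs_integral_torusFreeEnergy_sub_le (hν : MemLp id 2 ν) (hβ : β ≠ 0) (hε : 0 ≤ ε) (h : ℝ)
    {K M m : ℕ} (hK : S.radius ≤ K) (hM : S.radius ≤ M) (hm : m * (2 * M + 1) ≤ 2 * K + 1) :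
    |∫ η, S.torusFreeEnergy β ε h K η ∂(fieldLaw d ν)
        - (m : ℝ) ^ d * ∫ η, S.torusFreeEnergy β ε h M η ∂(fieldLaw d ν)|
      ≤ 2 * (((2 * K + 1 : ℕ) : ℝ) ^ d - (m : ℝ) ^ d * ((2 * (M - S.radius) + 1 : ℕ) : ℝ) ^ d)
        * S.siteNormBound ε h (∫ t, |t| ∂ν) := by
  have hν₁ : MemLp id 1 ν := hν.mono_exponent one_le_two
  set c : (Fin d → Fin m) → Torus d K := fun i => proj K fun k => ((2 * M + 1 : ℕ) : ℤ) * (i k : ℕ)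
  have hc : Function.Injective (blockSite K M c) := blockSite_tiling_injective hm
  let blockEnergy (i : Fin d → Fin m) (η : Fields d) : ℝ := normalizedFreeEnergy β
    (S.fieldHamiltonian M fun v => h + ε * η (rep (blockSite K M c (i, v))))
  have hmeas := measurable_normalizedFreeEnergy_fieldHamiltonian (S := S) hβ M ε h
  have hrep (i : Fin d → Fin m) : Function.Injective fun v => rep (blockSite K M c (i, v)) :=
    rep_injective.comp (hc.comp (Prod.mk_right_injective i))
  have integrable_torus : Integrable (S.torusFreeEnergy β ε h K) (fieldLaw d ν) :=
    (siteLipschitz_torusFreeEnergy hβ hε h hK).integrable hν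
  have integrable_block : ∀ i ∈ Finset.univ, Integrable (blockEnergy i) (fieldLaw d ν) :=
    fun i _ => integrable_comp_sites hmeas rep_injective (hrep i)
      ((siteLipschitz_torusFreeEnergy (S := S) hβ hε h hM).integrable hν)
  have integral_block (i : Fin d → Fin m) : ∫ η, blockEnergy i η ∂(fieldLaw d ν)
      = ∫ η, S.torusFreeEnergy β ε h M η ∂(fieldLaw d ν) :=
    integral_comp_sites hmeas (hrep i) rep_injective
  have bound (η : Fields d) : |S.torusFreeEnergy β ε h K η - ∑ i, blockEnergy i η|
      ≤ 2 * ∑ u ∈ (blockCore K M (M - S.radius) c)ᶜ, S.siteNormBound ε h (η (rep u)) :=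
    (abs_normalizedFreeEnergy_sub_sum_blocks_le hβ hK hM hc fun v => h + ε * η (rep v)).trans
      (mul_le_mul_of_nonneg_left (Finset.sum_le_sum fun u _ => siteBound_add_abs_le hε h _)
        zero_le_two)
  calc _ = |∫ η, (S.torusFreeEnergy β ε h K η - ∑ i, blockEnergy i η) ∂(fieldLaw d ν)| := by
        rw [integral_sub integrable_torus (integrable_finsetSum _ integrable_block),
          integral_finsetSum _ integrable_block]
        simp [integral_block]
    _ ≤ ∫ η, 2 * ∑ u ∈ (blockCore K M (M - S.radius) c)ᶜ, S.siteNormBound ε h (η (rep u))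
          ∂(fieldLaw d ν) :=
        abs_integral_le_integral_abs.trans <| integral_mono
          (integrable_torus.sub (integrable_finsetSum _ integrable_block)).abs
          ((integrable_finsetSum _ fun u _ =>
            S.integrable_siteNormBound ε hν₁ h (rep u)).const_mul 2) bound
    _ = _ := by
        rw [integral_const_mul, S.integral_sum_siteNormBound ε hν₁,
          card_compl_blockCore_tiling (Nat.sub_le _ _) hm, mul_assoc]

variable (S) in
lemma exists_tendsto_integral_torusFreeEnergy (hν : MemLp id 2 ν) (hβ : β ≠ 0) (hε : 0 ≤ ε)
    (h : ℝ) : ∃ l, Tendsto (fun K : ℕ =>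
      (∫ η, S.torusFreeEnergy β ε h K η ∂(fieldLaw d ν)) / (box d K).card) atTop (𝓝 l) :=
  exists_tendsto_density_of_tiling fun _ _ hK hM =>
    abs_integral_torusFreeEnergy_sub_le hν hβ hε h hK hM (Nat.div_mul_le_self _ _)

lemma ae_tendsto_torusFreeEnergy (hd : 1 ≤ d) (hν : MemLp id 2 ν) (hβ : β ≠ 0) (hε : 0 ≤ ε)
    {h l : ℝ} (hl : Tendsto (fun K : ℕ => (∫ η, S.torusFreeEnergy β ε h K η ∂(fieldLaw d ν))
      / (box d K).card) atTop (𝓝 l)) :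
    ∀ᵐ η ∂(fieldLaw d ν), Tendsto (fun K : ℕ => S.torusFreeEnergy β ε h K η / (box d K).card)
      atTop (𝓝 l) := by
  filter_upwards [ae_tendsto_centered_div_card hd hν hε
      (fun K (hK : S.radius ≤ K) => siteLipschitz_torusFreeEnergy (S := S) hβ hε h hK),
    ae_tendsto_centered_div_card (N := 0) hd hν hε
      (fun K _ => siteLipschitz_boxNormBound (S := S) hε h K)] with η energy_lim bound_lim
  have hcard (n : ℕ) : ((box d (n ^ 2)).card : ℝ) ≠ 0 := (card_box_pos d _).ne'
  have energy_sq := energy_lim.add (hl.comp (tendsto_pow_atTop two_ne_zero))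
  have bound_sq := bound_lim.add_const (S.siteNormBound ε h (∫ t, |t| ∂ν))
  rw [zero_add] at energy_sq bound_sq
  refine tendsto_div_of_tendsto_squares (R := S.radius) (card_box_pos d)
    (fun K M hKM => Nat.cast_le.2 (Finset.card_le_card (box_subset_box hKM)))
    (tendsto_card_box_succ_sq_div d) (boxNormBound_mono (S := S) hε h η)
    (fun K M hM hMK => abs_torusFreeEnergy_sub_le hβ hε h η hM hMK)
    (energy_sq.congr fun n => ?_) (bound_sq.congr fun n => ?_)
  · rw [Function.comp_apply, ← add_div, sub_add_cancel]
  · simp only [boxNormBound]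
    rw [S.integral_sum_siteNormBound ε (hν.mono_exponent one_le_two), div_add' _ _ _ (hcard n),
      mul_comm (S.siteNormBound ε h _), sub_add_cancel]

variable (S) in
lemma exists_tendsto_integral_freeEnergy (hν : MemLp id 2 ν) (hβ : β ≠ 0) (hε : 0 ≤ ε)
    (h : ℝ) : ∃ l, Tendsto (fun K : ℕ =>
      (∫ η, S.freeEnergy β ε h K η ∂(fieldLaw d ν)) / (box d K).card) atTop (𝓝 l) := by
  obtain ⟨l, hl⟩ := S.exists_tendsto_integral_torusFreeEnergy hν hβ hε h
  refine ⟨l - β.toReal⁻¹ * Real.log (Fintype.card σ), (hl.sub_const _).congr' ?_⟩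
  filter_upwards [eventually_ge_atTop S.radius] with K hK
  rw [S.integral_torusFreeEnergy_div β ε ((siteLipschitz_freeEnergy hβ hε h hK).integrable hν),
    add_sub_cancel_right]

lemma ae_tendsto_freeEnergy (hd : 1 ≤ d) (hν : MemLp id 2 ν) (hβ : β ≠ 0) (hε : 0 ≤ ε)
    {h l : ℝ} (hl : Tendsto (fun K : ℕ => (∫ η, S.freeEnergy β ε h K η ∂(fieldLaw d ν))
      / (box d K).card) atTop (𝓝 l)) :
    ∀ᵐ η ∂(fieldLaw d ν), Tendsto (fun K : ℕ => S.freeEnergy β ε h K η / (box d K).card)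
      atTop (𝓝 l) := by
  have mean : Tendsto (fun K : ℕ => (∫ η, S.torusFreeEnergy β ε h K η ∂(fieldLaw d ν))
      / (box d K).card) atTop (𝓝 (l + β.toReal⁻¹ * Real.log (Fintype.card σ))) := by
    refine (hl.add_const _).congr' ?_
    filter_upwards [eventually_ge_atTop S.radius] with K hK
    rw [S.integral_torusFreeEnergy_div β ε ((siteLipschitz_freeEnergy hβ hε h hK).integrable hν)]
  filter_upwards [ae_tendsto_torusFreeEnergy hd hν hβ hε mean] with η hη
  refine (add_sub_cancel_right l _ ▸ hη.sub_const _).congr fun K => ?_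
  rw [torusFreeEnergy_eq, add_div, mul_div_cancel_left₀ _ (card_box_pos d K).ne',
    add_sub_cancel_right]

lemma lipschitzWith_freeEnergy_div (hβ : β ≠ 0) {K : ℕ} (hK : S.radius ≤ K) (η : Fields d) :
    LipschitzWith 1 fun h => S.freeEnergy β ε h K η / (box d K).card :=
  LipschitzWith.of_dist_le_mul fun h h' => by
    rw [NNReal.coe_one, one_mul, Real.dist_eq, Real.dist_eq, ← sub_div, abs_div,
      abs_of_pos (card_box_pos d K), div_le_iff₀' (card_box_pos d K)]
    exact abs_freeEnergy_sub_le hβ h h' hK η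

lemma lipschitzWith_integral_freeEnergy_div (hν : MemLp id 2 ν) (hβ : β ≠ 0) (hε : 0 ≤ ε) {K : ℕ}
    (hK : S.radius ≤ K) : LipschitzWith 1 fun h =>
      (∫ η, S.freeEnergy β ε h K η ∂(fieldLaw d ν)) / (box d K).card := by
  have integrable (h : ℝ) : Integrable (S.freeEnergy β ε h K) (fieldLaw d ν) :=
    (siteLipschitz_freeEnergy hβ hε h hK).integrable hν
  refine LipschitzWith.of_dist_le_mul fun h h' => ?_
  rw [NNReal.coe_one, one_mul, Real.dist_eq, Real.dist_eq, ← sub_div, abs_div,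
    abs_of_pos (card_box_pos d K), div_le_iff₀' (card_box_pos d K),
    ← integral_sub (integrable h) (integrable h')]
  calc _ ≤ ∫ η, |S.freeEnergy β ε h K η - S.freeEnergy β ε h' K η| ∂(fieldLaw d ν) :=
        abs_integral_le_integral_abs
    _ ≤ ∫ _η, ((box d K).card : ℝ) * |h - h'| ∂(fieldLaw d ν) :=
        integral_mono ((integrable h).sub (integrable h')).abs (integrable_const _)
          fun η => abs_freeEnergy_sub_le hβ h h' hK η
    _ = _ := by rw [integral_const, probReal_univ, one_smul]

variable (S) in
theorem exists_isFreeEnergyDensity (hd : 1 ≤ d) (hν : MemLp id 2 ν) (hβ : β ≠ 0) (hε : 0 ≤ ε) :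
    ∃ F : ℝ → ℝ, IsFreeEnergyDensity S ν β ε F ∧ ∀ h, Tendsto (fun K : ℕ =>
      (∫ η, S.freeEnergy β ε h K η ∂(fieldLaw d ν)) / (box d K).card) atTop (𝓝 (F h)) := by
  choose F hF using S.exists_tendsto_integral_freeEnergy hν hβ hε
  refine ⟨F, ?_, hF⟩
  have continuous_F : Continuous F :=
    ((isClosed_setOfPred_lipschitzWith 1).mem_of_tendsto (tendsto_pi_nhds.2 hF)
      ((eventually_ge_atTop S.radius).mono fun K hK =>
        lipschitzWith_integral_freeEnergy_div hν hβ hε hK)).continuous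
  filter_upwards [ae_all_iff.2 fun r : ℚ => ae_tendsto_freeEnergy hd hν hβ hε (hF r)] with η hη h
  exact tendsto_of_lipschitzWith_of_forall_rat ((eventually_ge_atTop S.radius).mono
    fun K hK => lipschitzWith_freeEnergy_div hβ hK η) continuous_F hη h

end FreeEnergy

end LatticeSystem

/-! ### Supergradients and limits of Lipschitz families -/

/-- The line of slope `a` through the graph of `φ` at `t` lies above the graph. -/
def IsSupergradAt (φ : ℝ → ℝ) (t a : ℝ) : Prop := ∀ u, φ u ≤ φ t + a * (u - t)

/-- `p t` is a supergradient of `φ` at every `t`; in particular `φ` is concave. -/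
def IsSupergrad (φ p : ℝ → ℝ) : Prop := ∀ t, IsSupergradAt φ t (p t)

section SupergradAt

variable {φ : ℝ → ℝ} {t a : ℝ}

lemma IsSupergradAt.const_mul {c : ℝ} (hc : 0 ≤ c) (h : IsSupergradAt φ t a) :
    IsSupergradAt (fun u => c * φ u) t (c * a) := fun u =>
  (mul_le_mul_of_nonneg_left (h u) hc).trans_eq (by ring)

lemma IsSupergradAt.of_tendsto {ι : Type*} {l : Filter ι} [l.NeBot] {φ' : ι → ℝ → ℝ} {a' : ι → ℝ}
    (h : ∀ i, IsSupergradAt (φ' i) t (a' i)) (hφ : ∀ u, Tendsto (fun i => φ' i u) l (𝓝 (φ u)))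
    (ha : Tendsto a' l (𝓝 a)) : IsSupergradAt φ t a := fun u =>
  le_of_tendsto_of_tendsto' (hφ u) ((hφ t).add (ha.mul_const _)) fun i => h i u

/-- With `u = 2 x - t`, the supergradient at the midpoint `x` of `t` and `u` lies between the slopes
of the chords over `[t, x]` and `[x, u]`, and the second one is `2 slope φ t u - slope φ t x`. -/
lemma IsSupergradAt.abs_sub_slope_le {x : ℝ} (hx : x ≠ t) (h : IsSupergradAt φ x a) :
    |a - slope φ t x| ≤ 2 * |slope φ t (2 * x - t) - slope φ t x| := by
  have hxt : 0 < |x - t| := abs_pos.2 (sub_ne_zero.2 hx)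
  have hne : x - t ≠ 0 := sub_ne_zero.2 hx
  refine le_of_mul_le_mul_right ?_ hxt
  rw [mul_assoc, ← abs_mul, ← abs_mul, sub_mul, sub_mul, slope_def_field, slope_def_field,
    div_mul_cancel₀ _ hne, show 2 * x - t - t = 2 * (x - t) by ring, div_mul_eq_mul_div,
    mul_div_mul_right _ _ hne]
  have at_t := h t
  have at_u := h (2 * x - t)
  have lower : (φ (2 * x - t) - φ t) / 2 - (φ x - φ t)
      ≥ -|(φ (2 * x - t) - φ t) / 2 - (φ x - φ t)| := neg_abs_le _
  rw [abs_le]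
  constructor <;> linarith

lemma tendsto_of_isSupergradAt {D : ℝ} {s : Set ℝ} (hφ : HasDerivWithinAt φ D s t) {ι : Type*}
    {l : Filter ι} {x b : ι → ℝ} (hx : Tendsto x l (𝓝 t)) (hxt : ∀ i, x i ≠ t)
    (hxs : ∀ i, x i ∈ s) (hxs' : ∀ i, 2 * x i - t ∈ s)
    (h : ∀ i, IsSupergradAt φ (x i) (b i)) : Tendsto b l (𝓝 D) := by
  rw [hasDerivWithinAt_iff_tendsto_slope] at hφ
  have near : Tendsto (fun i => slope φ t (x i)) l (𝓝 D) :=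
    hφ.comp (tendsto_nhdsWithin_iff.2 ⟨hx, .of_forall fun i => ⟨hxs i, hxt i⟩⟩)
  have reflected : Tendsto (fun i => slope φ t (2 * x i - t)) l (𝓝 D) := by
    refine hφ.comp (tendsto_nhdsWithin_iff.2 ⟨?_, .of_forall fun i => ⟨hxs' i, fun e => hxt i ?_⟩⟩)
    · simpa [two_mul] using (hx.const_mul 2).sub_const t
    · linarith [Set.mem_singleton_iff.1 e]
  have gap := ((reflected.sub near).abs.const_mul 2)
  rw [sub_self, abs_zero, mul_zero] at gap
  simpa using (squeeze_zero_norm (fun i => (h i).abs_sub_slope_le (hxt i)) gap).add near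

end SupergradAt

namespace IsSupergrad

variable {φ p : ℝ → ℝ}

lemma antitone (h : IsSupergrad φ p) : Antitone p := fun t u htu => by
  rcases htu.eq_or_lt with rfl | htu
  · exact le_rfl
  · have from_t := h t u
    have from_u := h u t
    refine le_of_mul_le_mul_right ?_ (sub_pos.2 htu)
    linarith

lemma concaveOn (h : IsSupergrad φ p) : ConcaveOn ℝ Set.univ φ :=
  ⟨convex_univ, fun t _ u _ a b ha hb hab => by
    have at_t := mul_le_mul_of_nonneg_left (h (a * t + b * u) t) ha
    have at_u := mul_le_mul_of_nonneg_left (h (a * t + b * u) u) hb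
    simp only [smul_eq_mul]
    obtain rfl : b = 1 - a := by linarith
    linarith⟩

lemma continuous (h : IsSupergrad φ p) : Continuous φ :=
  continuousOn_univ.1 (h.concaveOn.continuousOn isOpen_univ)

lemma abs_sub_sub_le (h : IsSupergrad φ p) (t u : ℝ) :
    |φ u - φ t - p t * (u - t)| ≤ |p u - p t| * |u - t| := by
  have from_t := h t u
  have from_u := h u t
  rw [← abs_mul, abs_of_nonpos (by linarith)]
  refine le_trans ?_ (neg_le_abs _)
  linarith

lemma hasDerivAt (h : IsSupergrad φ p) {t : ℝ} (ht : ContinuousAt p t) :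
    HasDerivAt φ (p t) t := by
  rw [hasDerivAt_iff_isLittleO, Asymptotics.isLittleO_iff]
  intro e he
  filter_upwards [Metric.tendsto_nhds.1 ht e he] with u hu
  rw [smul_eq_mul, mul_comm (u - t)]
  exact (h.abs_sub_sub_le t u).trans (mul_le_mul_of_nonneg_right hu.le (abs_nonneg _))

lemma integral_eq_sub (h : IsSupergrad φ p) (a b : ℝ) : ∫ t in a..b, p t = φ b - φ a :=
  integral_eq_of_hasDerivAt_off_countable φ p h.antitone.countable_not_continuousAt
    h.continuous.continuousOn (fun _ hx => h.hasDerivAt (not_not.1 hx.2))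
    h.antitone.intervalIntegrable

lemma sub_le_sub_of_le {ψ q : ℝ → ℝ} (hφ : IsSupergrad φ p) (hψ : IsSupergrad ψ q)
    (hpq : ∀ t, q t ≤ p t) {a b : ℝ} (hab : a ≤ b) : ψ b - ψ a ≤ φ b - φ a := by
  rw [← hφ.integral_eq_sub, ← hψ.integral_eq_sub]
  exact intervalIntegral.integral_mono hab hψ.antitone.intervalIntegrable
    hφ.antitone.intervalIntegrable hpq

lemma isDistribDeriv_half_sub {ψ q : ℝ → ℝ} (hφ : IsSupergrad φ p) (hψ : IsSupergrad ψ q) :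
    IsDistribDeriv (fun t => (1 / 2) * (φ t - ψ t)) fun t => (1 / 2) * (p t - q t) := by
  refine ⟨(hφ.antitone.locallyIntegrable.sub hψ.antitone.locallyIntegrable).smul (1 / 2 : ℝ),
    fun a b => ?_⟩
  rw [intervalIntegral.integral_const_mul, intervalIntegral.integral_sub
    hφ.antitone.intervalIntegrable hψ.antitone.intervalIntegrable, hφ.integral_eq_sub,
    hψ.integral_eq_sub]
  ring

section Limits

variable {φ' p' : ℕ → ℝ → ℝ}

lemma tendsto_of_continuousAt (h : IsSupergrad φ p) (h' : ∀ j, IsSupergrad (φ' j) (p' j))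
    (hlim : ∀ t, Tendsto (fun j => φ' j t) atTop (𝓝 (φ t))) {t : ℝ} (ht : ContinuousAt p t) :
    Tendsto (fun j => p' j t) atTop (𝓝 (p t)) := by
  refine tendsto_order.2 ⟨fun a ha => ?_, fun a ha => ?_⟩
  · obtain ⟨s, hs, hts⟩ : ∃ s, a < p s ∧ t < s :=
      ((ht.eventually (lt_mem_nhds ha)).filter_mono (nhdsWithin_le_nhds (s := Set.Ioi t)) |>.and
        self_mem_nhdsWithin).exists
    have slope_gt : a * (s - t) < φ s - φ t := by nlinarith [h s t]
    filter_upwards [((hlim s).sub (hlim t)).eventually (lt_mem_nhds slope_gt)] with j hj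
    exact lt_of_mul_lt_mul_right (by linarith [h' j t s]) (sub_nonneg.2 hts.le)
  · obtain ⟨s, hs, hts⟩ : ∃ s, p s < a ∧ s < t :=
      ((ht.eventually (gt_mem_nhds ha)).filter_mono (nhdsWithin_le_nhds (s := Set.Iio t)) |>.and
        self_mem_nhdsWithin).exists
    have slope_lt : φ t - φ s < a * (t - s) := by nlinarith [h s t]
    filter_upwards [((hlim t).sub (hlim s)).eventually (gt_mem_nhds slope_lt)] with j hj
    exact lt_of_mul_lt_mul_right (by linarith [h' j t s]) (sub_nonneg.2 hts.le)

lemma of_mapClusterPt (h' : ∀ j, IsSupergrad (φ' j) (p' j))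
    (hlim : ∀ t, Tendsto (fun j => φ' j t) atTop (𝓝 (φ t))) (hp : MapClusterPt p atTop p') :
    IsSupergrad φ p := fun t => by
  obtain ⟨U, hU, hpU⟩ := mapClusterPt_iff_ultrafilter.1 hp
  exact IsSupergradAt.of_tendsto (fun j => h' j t) (fun u => (hlim u).mono_left hU)
    (tendsto_pi_nhds.1 hpU t)

lemma tendsto_integral (h : IsSupergrad φ p) (h' : ∀ j, IsSupergrad (φ' j) (p' j))
    (hlim : ∀ t, Tendsto (fun j => φ' j t) atTop (𝓝 (φ t))) {c : ℝ} (hc : ∀ j t, |p' j t| ≤ c)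
    {ν : Measure ℝ} [IsFiniteMeasure ν] (hν : ∀ᵐ t ∂ν, ContinuousAt p t) :
    Tendsto (fun j => ∫ t, p' j t ∂ν) atTop (𝓝 (∫ t, p t ∂ν)) :=
  tendsto_integral_of_dominated_convergence (fun _ => c)
    (fun j => (h' j).antitone.measurable.aestronglyMeasurable) (integrable_const _)
    (fun j => .of_forall (hc j)) (hν.mono fun _ ht => h.tendsto_of_continuousAt h' hlim ht)

end Limits

end IsSupergrad

lemma hasDerivWithinAt_Ioi_of_concaveOn {φ : ℝ → ℝ} (h : ConcaveOn ℝ Set.univ φ) (t : ℝ) :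
    ∃ D, HasDerivWithinAt φ D (Set.Ioi t) t := by
  have := (h.neg.hasDerivWithinAt_rightDeriv_of_mem_interior (x := t) (by simp)).neg
  exact ⟨_, by simpa only [neg_neg] using this⟩

lemma hasDerivWithinAt_Iio_of_concaveOn {φ : ℝ → ℝ} (h : ConcaveOn ℝ Set.univ φ) (t : ℝ) :
    ∃ D, HasDerivWithinAt φ D (Set.Iio t) t := by
  have := (h.neg.hasDerivWithinAt_leftDeriv_of_mem_interior (x := t) (by simp)).neg
  exact ⟨_, by simpa only [neg_neg] using this⟩

/-- Both slopes decrease, so the variations of their difference do not add up: this saves the factor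
`2` in the Lipschitz constant. -/
lemma lipschitzWith_half_sub_of_antitone {p q : ℝ → ℝ} {C : NNReal} (hp : Antitone p)
    (hq : Antitone q) (hpC : LipschitzWith (2 * C) p) (hqC : LipschitzWith (2 * C) q) :
    LipschitzWith C fun t => (1 / 2) * (p t - q t) := by
  refine LipschitzWith.of_dist_le_mul fun t u => ?_
  wlog htu : t ≤ u generalizing t u
  · rw [dist_comm, dist_comm t u]
    exact this u t (le_of_not_ge htu)
  have p_drop := (le_abs_self _).trans (hpC.dist_le_mul t u)
  have q_drop := (le_abs_self _).trans (hqC.dist_le_mul t u)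
  have p_anti := hp htu
  have q_anti := hq htu
  rw [NNReal.coe_mul, NNReal.coe_ofNat] at p_drop q_drop
  rw [Real.dist_eq, abs_le]
  constructor <;> linarith

section SiteLipschitzLimits

variable {d : ℕ} {s : Finset (Fin d → ℤ)} {c : ℝ}

/-- A diagonal subsequence settles the countably many values on a dense set of configurations, and
the common Lipschitz bound carries the convergence to all configurations. -/
theorem exists_subseq_tendsto_of_siteLipschitz {ι : Type*} [Countable ι]
    {u : ℕ → ι → Fields d → ℝ} {s : ι → Finset (Fin d → ℤ)}
    (hu : ∀ n i, SiteLipschitz (u n i) (s i) c) {b : ι → ℝ} (hb : ∀ n i, |u n i 0| ≤ b i) :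
    ∃ φ : ℕ → ℕ, StrictMono φ ∧ ∃ U : ι → Fields d → ℝ, ∀ i η,
      Tendsto (fun n => u (φ n) i η) atTop (𝓝 (U i η)) := by
  obtain ⟨D, hD_countable, hD_dense⟩ := TopologicalSpace.exists_countable_dense (Fields d)
  have := hD_countable.to_subtype
  let B (p : ι × D) : ℝ := b p.1 + c * ∑ x ∈ s p.1, |(p.2 : Fields d) x|
  have compact_box : IsCompact (Set.pi Set.univ fun p : ι × D => Set.Icc (-B p) (B p)) :=
    isCompact_univ_pi fun p => isCompact_Icc
  obtain ⟨a, -, φ, hφ, ha⟩ :=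
    compact_box.tendsto_subseq (x := fun n p => u n p.1 p.2) fun n p _ => by
      rw [Set.mem_Icc, ← abs_le]
      exact ((hu n p.1).abs_le _).trans (add_le_add_left (hb n p.1) _)
  rw [tendsto_pi_nhds] at ha
  suffices h : ∀ i η, ∃ l, Tendsto (fun n => u (φ n) i η) atTop (𝓝 l) by
    choose U hU using h
    exact ⟨φ, hφ, U, hU⟩
  refine fun i η => exists_tendsto_of_forall_eventually_near fun e he => ?_
  have hcont : Continuous fun q : Fields d => c * ∑ x ∈ s i, |η x - q x| := by fun_prop
  have hη : c * ∑ x ∈ s i, |η x - η x| < e / 2 := by simpa using by positivity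
  obtain ⟨q, hqD, hq⟩ := hD_dense.exists_mem_open (isOpen_lt hcont continuous_const) ⟨η, hη⟩
  refine ⟨a (i, ⟨q, hqD⟩), ?_⟩
  filter_upwards [Metric.tendsto_nhds.1 (ha (i, ⟨q, hqD⟩)) (e / 2) (by positivity)] with n hn
  calc |u (φ n) i η - a (i, ⟨q, hqD⟩)|
      ≤ |u (φ n) i η - u (φ n) i q| + |u (φ n) i q - a (i, ⟨q, hqD⟩)| := abs_sub_le _ _ _
    _ ≤ e / 2 + e / 2 := add_le_add ((hu (φ n) i η q).trans (le_of_lt hq)) (le_of_lt hn)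
    _ = e := add_halves e

lemma SiteLipschitz.of_tendsto {u : ℕ → Fields d → ℝ} {U : Fields d → ℝ}
    (hu : ∀ n, SiteLipschitz (u n) s c) (h : ∀ η, Tendsto (fun n => u n η) atTop (𝓝 (U η))) :
    SiteLipschitz U s c := fun η η' =>
  le_of_tendsto' ((h η).sub (h η')).abs fun n => hu n η η'

lemma SiteLipschitz.half_sub {f f' : Fields d → ℝ} (hf : SiteLipschitz f s c)
    (hf' : SiteLipschitz f' s c) : SiteLipschitz (fun η => (1 / 2) * (f η - f' η)) s c :=
  fun η η' => by
    have h := _root_.abs_le.1 (hf η η')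
    have h' := _root_.abs_le.1 (hf' η η')
    rw [_root_.abs_le]
    constructor <;> linarith

lemma lipSeminorm_le_of_siteLipschitz {f : Fields d → ℝ} (hc : 0 ≤ c) (hf : SiteLipschitz f s c) :
    lipSeminorm f ≤ ENNReal.ofReal c := by
  refine iSup₂_le fun η η' => iSup₂_le fun _ _ => ENNReal.div_le_of_le_mul ?_
  refine (ENNReal.ofReal_le_ofReal (hf η η')).trans ?_
  rw [ENNReal.ofReal_mul hc, ENNReal.ofReal_sum_of_nonneg fun _ _ => abs_nonneg _]
  exact mul_le_mul_right (ENNReal.sum_le_tsum (f := fun x => ENNReal.ofReal |(η - η') x|) s) _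

variable {ν : Measure ℝ} [IsProbabilityMeasure ν]

lemma SiteLipschitz.abs_zero_sub_integral_le {f : Fields d → ℝ} (hf : SiteLipschitz f s c)
    (hν : MemLp id 2 ν) :
    |f 0 - ∫ η, f η ∂(fieldLaw d ν)| ≤ c * (s.card * ∫ t, |t| ∂ν) := by
  have integrable_abs_eval (x : Fin d → ℤ) : Integrable (fun η : Fields d => |η x|)
      (fieldLaw d ν) := ((memLp_eval hν x).integrable one_le_two).abs
  calc |f 0 - ∫ η, f η ∂(fieldLaw d ν)|
      = |∫ η, (f 0 - f η) ∂(fieldLaw d ν)| := by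
        rw [integral_sub (integrable_const _) (hf.integrable hν)]
        simp
    _ ≤ ∫ η, |f 0 - f η| ∂(fieldLaw d ν) := abs_integral_le_integral_abs
    _ ≤ ∫ η : Fields d, c * ∑ x ∈ s, |η x| ∂(fieldLaw d ν) :=
        integral_mono ((integrable_const _).sub (hf.integrable hν)).abs
          ((integrable_finsetSum _ fun x _ => integrable_abs_eval x).const_mul c)
          fun η => by simpa using hf 0 η
    _ = c * (s.card * ∫ t, |t| ∂ν) := by
        rw [integral_const_mul, integral_finsetSum _ fun x _ => integrable_abs_eval x]
        simp only [integral_abs_eval, Finset.sum_const, nsmul_eq_mul]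

lemma tendsto_integral_of_siteLipschitz (hν : MemLp id 2 ν) {u : ℕ → Fields d → ℝ}
    {U : Fields d → ℝ} {b : ℝ} (hu : ∀ n, SiteLipschitz (u n) s c) (hb : ∀ n, |u n 0| ≤ b)
    (h : ∀ η, Tendsto (fun n => u n η) atTop (𝓝 (U η))) :
    Tendsto (fun n => ∫ η, u n η ∂(fieldLaw d ν)) atTop (𝓝 (∫ η, U η ∂(fieldLaw d ν))) := by
  refine tendsto_integral_of_dominated_convergence (fun η => b + c * ∑ x ∈ s, |η x|)
    (fun n => (hu n).measurable.aestronglyMeasurable) ?_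
    (fun n => Eventually.of_forall fun η => ?_) (Eventually.of_forall h)
  · exact (integrable_const b).add ((integrable_finsetSum s fun x _ =>
      ((memLp_eval hν x).integrable one_le_two).abs).const_mul c)
  · exact ((hu n).abs_le η).trans (add_le_add_left (hb n) _)

lemma tendsto_condAv_of_siteLipschitz (hν : MemLp id 2 ν) (hc : 0 ≤ c) {u : ℕ → Fields d → ℝ}
    {U : Fields d → ℝ} {b : ℝ} (hu : ∀ n, SiteLipschitz (u n) s c) (hb : ∀ n, |u n 0| ≤ b)
    (h : ∀ η, Tendsto (fun n => u n η) atTop (𝓝 (U η))) (Λ : Finset (Fin d → ℤ))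
    (η : Fields d) : Tendsto (fun n => condAv ν Λ (u n) η) atTop (𝓝 (condAv ν Λ U η)) :=
  tendsto_integral_of_siteLipschitz hν (u := fun n ω => u n (splice Λ η ω))
    (b := b + c * ∑ x ∈ s, |splice Λ η 0 x|) (fun n => (hu n).comp_splice_left hc Λ η)
    (fun n => ((hu n).abs_le _).trans (add_le_add_left (hb n) _)) fun _ => h _

lemma splice_splice_of_subset {Λ Λ' : Finset (Fin d → ℤ)} (h : Λ ⊆ Λ') (η ω ω' : Fields d) :
    splice Λ' (splice Λ η ω) ω' = splice Λ η (splice Λ' ω ω') := by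
  funext x
  by_cases hx : x ∈ Λ
  · simp [splice, hx, h hx]
  · simp [splice, hx]

lemma SiteLipschitz.condAv_condAv {f : Fields d → ℝ} (hf : SiteLipschitz f s c) (hc : 0 ≤ c)
    (hν : MemLp id 2 ν) {Λ Λ' : Finset (Fin d → ℤ)} (h : Λ ⊆ Λ') (η : Fields d) :
    DisorderedLattice.condAv ν Λ (DisorderedLattice.condAv ν Λ' f) η
      = DisorderedLattice.condAv ν Λ f η := by
  have tower := integral_condAv ((hf.comp_splice_left hc Λ η).integrable hν) Λ'
  simpa only [DisorderedLattice.condAv, splice_splice_of_subset h] using tower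

end SiteLipschitzLimits

section Families

variable {d : ℕ} {ν : Measure ℝ} {ε : ℝ}

variable (ν ε) in
/-- The properties of the family `L ↦ G_L` that do not compare different boxes: `g L` is an
`ε`-Lipschitz function of the fields in `Γ_L` with mean zero. -/
structure IsCenteredFamily (g : ℕ → Fields d → ℝ) : Prop where
  lip : ∀ L, SiteLipschitz (g L) (box d L) ε
  mean : ∀ L, ∫ η, g L η ∂(fieldLaw d ν) = 0

variable (ν) in
/-- Averaging `g L` over the fields outside the translate `Γ_{L'} - x` gives the translate of
`g L'`. -/
def IsCovariant (g : ℕ → Fields d → ℝ) (L L' : ℕ) (x : Fin d → ℤ) : Prop :=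
  ∀ η, condAv ν (translateSet (-x) (box d L')) (g L) η = g L' (shiftField x η)

/-- Half the difference of two families: it combines the limits of the free energies at the fields
`h + δ` and `h - δ` into the limit `G` of `g^δ`. -/
noncomputable def halfDiff (g g' : ℕ → Fields d → ℝ) (L : ℕ) (η : Fields d) : ℝ :=
  (1 / 2) * (g L η - g' L η)

variable {g g' : ℕ → Fields d → ℝ} {u : ℕ → ℕ → Fields d → ℝ} {U : ℕ → Fields d → ℝ}
  [IsProbabilityMeasure ν]

lemma IsCenteredFamily.integrable (hν : MemLp id 2 ν) (hg : IsCenteredFamily ν ε g) (L : ℕ) :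
    Integrable (g L) (fieldLaw d ν) := (hg.lip L).integrable hν

lemma IsCenteredFamily.abs_zero_le (hν : MemLp id 2 ν) (hg : IsCenteredFamily ν ε g) (L : ℕ) :
    |g L 0| ≤ ε * ((box d L).card * ∫ t, |t| ∂ν) := by
  simpa only [hg.mean, sub_zero] using (hg.lip L).abs_zero_sub_integral_le hν

lemma IsCenteredFamily.of_tendsto (hν : MemLp id 2 ν) (hu : ∀ n, IsCenteredFamily ν ε (u n))
    (h : ∀ L η, Tendsto (fun n => u n L η) atTop (𝓝 (U L η))) : IsCenteredFamily ν ε U where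
  lip L := SiteLipschitz.of_tendsto (fun n => (hu n).lip L) (h L)
  mean L := by
    have := tendsto_integral_of_siteLipschitz hν (fun n => (hu n).lip L)
      (fun n => (hu n).abs_zero_le hν L) (h L)
    simp only [(hu _).mean L] at this
    exact tendsto_nhds_unique this tendsto_const_nhds

lemma IsCenteredFamily.halfDiff (hν : MemLp id 2 ν) (hg : IsCenteredFamily ν ε g)
    (hg' : IsCenteredFamily ν ε g') : IsCenteredFamily ν ε (halfDiff g g') where
  lip L := (hg.lip L).half_sub (hg'.lip L)
  mean L := by
    simp only [DisorderedLattice.halfDiff]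
    rw [integral_const_mul, integral_sub (hg.integrable hν L) (hg'.integrable hν L), hg.mean,
      hg'.mean, sub_zero, mul_zero]

lemma IsCovariant.of_tendsto (hν : MemLp id 2 ν) (hε : 0 ≤ ε)
    (hu : ∀ n, IsCenteredFamily ν ε (u n))
    (h : ∀ L η, Tendsto (fun n => u n L η) atTop (𝓝 (U L η))) {L L' : ℕ} {x : Fin d → ℤ}
    (hc : ∀ᶠ n in atTop, IsCovariant ν (u n) L L' x) : IsCovariant ν U L L' x := fun η =>
  tendsto_nhds_unique
    ((tendsto_condAv_of_siteLipschitz hν hε (fun n => (hu n).lip L)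
      (fun n => (hu n).abs_zero_le hν L) (h L) _ η).congr' (hc.mono fun _ hn => hn η)) (h L' _)

lemma IsCovariant.halfDiff (hν : MemLp id 2 ν) (hε : 0 ≤ ε) (hg : IsCenteredFamily ν ε g)
    (hg' : IsCenteredFamily ν ε g') {L L' : ℕ} {x : Fin d → ℤ} (h : IsCovariant ν g L L' x)
    (h' : IsCovariant ν g' L L' x) : IsCovariant ν (halfDiff g g') L L' x := fun η => by
  simp only [DisorderedLattice.halfDiff, ← h η, ← h' η, condAv]
  rw [integral_const_mul, integral_sub (((hg.lip L).comp_splice_left hε _ η).integrable hν)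
    (((hg'.lip L).comp_splice_left hε _ η).integrable hν)]

end Families

/-! ### Conditional free energies and their limits -/

section Translation

variable {d K : ℕ} {A : Finset (Fin d → ℤ)} {x : Fin d → ℤ}

lemma mem_translateSet_neg {y : Fin d → ℤ} : y ∈ translateSet (-x) A ↔ y + x ∈ A := by
  simp only [translateSet, Finset.mem_map, addRightEmbedding_apply, ← sub_eq_add_neg,
    sub_eq_iff_eq_add, exists_eq_right]

lemma rep_add_proj_mem_iff (hA : A ⊆ box d K) (hA' : translateSet (-x) A ⊆ box d K)
    (v : Torus d K) : rep (v + proj K x) ∈ A ↔ rep v ∈ translateSet (-x) A := by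
  rw [mem_translateSet_neg]
  refine ⟨fun hv => ?_, fun hv => by rwa [rep_add_proj (hA hv)]⟩
  have hw : rep (v + proj K x) - x ∈ translateSet (-x) A := by
    rwa [mem_translateSet_neg, sub_add_cancel]
  have proj_sub : proj K (rep (v + proj K x) - x) = v :=
    add_right_cancel (b := proj K x) (by rw [← proj_add, sub_add_cancel, proj_rep])
  have rep_eq := rep_proj (hA' hw)
  rw [proj_sub] at rep_eq
  rwa [rep_eq, sub_add_cancel]

lemma splice_box_zero (η ω : Fields d) :
    splice (box d 0) η ω = Function.update ω 0 (η 0) := by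
  funext x
  by_cases hx : x = 0
  · simp [splice, box_zero, hx]
  · simp [splice, box_zero, hx]

lemma resetField_splice (L : ℕ) (η ω : Fields d) :
    resetField L (splice (box d L) η ω) = splice (box d L) 0 ω := by
  funext y
  simp only [resetField, splice]
  split_ifs <;> rfl

lemma update_zero_rep (ω : Fields d) (t : ℝ) :
    (fun v : Torus d K => Function.update ω 0 t (rep v))
      = Function.update (fun v => ω (rep v)) 0 t := by
  have := Function.update_comp_eq_of_injective ω (rep_injective (d := d) (K := K)) 0 t
  rwa [rep_zero] at this

end Translation

lemma integral_sub_sub_add {α : Type*} [MeasurableSpace α] {μ : Measure α} {f g f' g' : α → ℝ}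
    (hf : Integrable f μ) (hg : Integrable g μ) (hf' : Integrable f' μ) (hg' : Integrable g' μ) :
    ∫ a, f a - g a - f' a + g' a ∂μ
      = ∫ a, f a ∂μ - ∫ a, g a ∂μ - ∫ a, f' a ∂μ + ∫ a, g' a ∂μ := by
  rw [← integral_sub' hf hg, ← integral_sub' (hf.sub hg) hf',
    ← integral_add' ((hf.sub hg).sub hf') hg']
  simp only [Pi.add_apply, Pi.sub_apply]

namespace LatticeSystem

variable {σ : Type*} [Fintype σ] [DecidableEq σ] [Nonempty σ] {d : ℕ} {S : LatticeSystem d σ}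
  {β : ℝ≥0∞} {ε : ℝ} {K : ℕ}

section StateKappa

lemma freeEnergy_le (hβ : β ≠ 0) (h h' : ℝ) (K : ℕ) (η η' : Fields d) :
    S.freeEnergy β ε h' K η' ≤ S.freeEnergy β ε h K η
      + ∑ v, ((h' - h) + ε * (η' (rep v) - η (rep v))) * S.stateKappa β ε h K η v := by
  simp only [freeEnergy_eq_eqFreeEnergy, stateKappa_eq_eqState]
  refine (S.eqFreeEnergy_fieldHamiltonian_le hβ (fun v => h + ε * η (rep v)) _).trans_eq ?_
  congr 1
  exact Finset.sum_congr rfl fun v _ => by ring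

lemma abs_stateKappa_le (hK : S.radius ≤ K) (h : ℝ) (η : Fields d) (v : Torus d K) :
    |S.stateKappa β ε h K η v| ≤ 1 := by
  rw [stateKappa_eq_eqState]
  exact abs_eqState_torusKappa_le hK β _ v

lemma measurable_eqState_fieldHamiltonian (h : ℝ) (v : Torus d K) :
    Measurable fun ξ : Torus d K → ℝ =>
      eqState β (S.fieldHamiltonian K fun w => h + ε * ξ w) (S.torusKappa K v) :=
  measurable_eqState ((S.continuous_fieldHamiltonian K).comp
    (by fun_prop : Continuous fun (ξ : Torus d K → ℝ) w => h + ε * ξ w))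
    (fun _ => S.isHermitian_fieldHamiltonian K _) β _

lemma measurable_stateKappa (h : ℝ) (v : Torus d K) :
    Measurable fun η : Fields d => S.stateKappa β ε h K η v := by
  simp only [stateKappa_eq_eqState]
  exact (measurable_eqState_fieldHamiltonian h v).comp
    (measurable_pi_lambda _ fun w => measurable_pi_apply (rep w))

variable {ν : Measure ℝ} [IsProbabilityMeasure ν]

lemma integrable_stateKappa (hK : S.radius ≤ K) (h : ℝ) (v : Torus d K) :
    Integrable (fun η : Fields d => S.stateKappa β ε h K η v) (fieldLaw d ν) :=
  Integrable.of_bound (measurable_stateKappa h v).aestronglyMeasurable 1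
    (Eventually.of_forall fun η => abs_stateKappa_le hK h η v)

lemma integral_stateKappa (h : ℝ) (v : Torus d K) :
    ∫ η, S.stateKappa β ε h K η v ∂(fieldLaw d ν)
      = ∫ η, S.stateKappa β ε h K η 0 ∂(fieldLaw d ν) := by
  have translate (η : Fields d) : S.stateKappa β ε h K η v
      = eqState β (S.fieldHamiltonian K fun w => h + ε * η (rep (w + v))) (S.torusKappa K 0) := by
    rw [S.eqState_fieldHamiltonian_translate β 0 v fun w => h + ε * η (rep w), zero_add,
      stateKappa_eq_eqState]
  simp only [translate]
  simp only [stateKappa_eq_eqState]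
  exact integral_comp_sites (measurable_eqState_fieldHamiltonian h 0)
    (rep_injective.comp (add_left_injective v)) rep_injective

theorem isSupergrad_integral_freeEnergy_div (hν : MemLp id 2 ν) (hβ : β ≠ 0) (hε : 0 ≤ ε)
    (hK : S.radius ≤ K) :
    IsSupergrad (fun h => (∫ η, S.freeEnergy β ε h K η ∂(fieldLaw d ν)) / (box d K).card)
      (fun h => ∫ η, S.stateKappa β ε h K η 0 ∂(fieldLaw d ν)) := fun h h' => by
  have hB := card_box_pos d K
  have integrable_freeEnergy (h : ℝ) :=
    (siteLipschitz_freeEnergy (S := S) hβ hε h hK).integrable hν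
  have integrable_term (v : Torus d K) : Integrable (fun η : Fields d =>
      (h' - h) * S.stateKappa β ε h K η v) (fieldLaw d ν) :=
    (integrable_stateKappa hK h v).const_mul _
  have integrable_sum := integrable_finsetSum Finset.univ fun v _ => integrable_term v
  have mean_le := integral_mono (integrable_freeEnergy h')
    ((integrable_freeEnergy h).add integrable_sum) fun η => by
      simpa only [sub_self, mul_zero, add_zero, Pi.add_apply, Finset.sum_apply] using
        freeEnergy_le (S := S) hβ h h' K η η
  rw [integral_add' (integrable_freeEnergy h) integrable_sum,
    integral_finsetSum _ fun v _ => integrable_term v] at mean_le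
  simp only [integral_const_mul, integral_stateKappa, Finset.sum_const, Finset.card_univ,
    card_torus, nsmul_eq_mul] at mean_le
  rw [div_le_iff₀ hB, add_mul, div_mul_cancel₀ _ hB.ne', card_box]
  linarith

end StateKappa

section CenteredFree

variable {ν : Measure ℝ} [IsProbabilityMeasure ν]

lemma condAv_freeEnergy_translate (hβ : β ≠ 0) (h : ℝ) {Λ : Finset (Fin d → ℤ)} {x : Fin d → ℤ}
    (hΛ : Λ ⊆ box d K) (hΛ' : translateSet (-x) Λ ⊆ box d K) (η : Fields d) :
    condAv ν (translateSet (-x) Λ) (S.freeEnergy β ε h K) η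
      = condAv ν Λ (S.freeEnergy β ε h K) (shiftField x η) := by
  let Ψ (ξ : Torus d K → ℝ) : ℝ := eqFreeEnergy β (S.fieldHamiltonian K fun v =>
    h + ε * (if rep v ∈ translateSet (-x) Λ then η (rep v) else ξ v))
  have measurable_Ψ : Measurable Ψ := by
    refine ((continuous_eqFreeEnergy_fieldHamiltonian hβ K).comp
      (continuous_pi fun v => ?_)).measurable
    split_ifs <;> fun_prop
  have eq_Ψ (ω : Fields d) : S.freeEnergy β ε h K (splice (translateSet (-x) Λ) η ω)
      = Ψ fun v => ω (rep v) := freeEnergy_eq_eqFreeEnergy S β ε h K _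
  have shifted_eq_Ψ (ω : Fields d) : S.freeEnergy β ε h K (splice Λ (shiftField x η) ω)
      = Ψ fun v => ω (rep (v + proj K x)) := by
    rw [freeEnergy_eq_eqFreeEnergy, ← S.eqFreeEnergy_fieldHamiltonian_translate β (proj K x)]
    congr 2 with v
    simp only [splice, rep_add_proj_mem_iff hΛ hΛ']
    split_ifs with hv
    · rw [shiftField, rep_add_proj (hΛ (mem_translateSet_neg.1 hv)), add_sub_cancel_right]
    · rfl
  simp only [condAv, eq_Ψ, shifted_eq_Ψ]
  exact integral_comp_sites measurable_Ψ rep_injective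
    (rep_injective.comp (add_left_injective (proj K x)))

variable (S β ε ν) in
omit [Nonempty σ] [IsProbabilityMeasure ν] in
/-- The average of the free energy given the fields in `Λ`, minus its mean. The centered second
difference `centeredDiff` is half the difference of these at the fields `h + δ` and `h - δ`. -/
noncomputable def centeredFree (h : ℝ) (K : ℕ) (Λ : Finset (Fin d → ℤ)) (η : Fields d) : ℝ :=
  condAv ν Λ (S.freeEnergy β ε h K) η - ∫ ω, S.freeEnergy β ε h K ω ∂(fieldLaw d ν)

lemma isCenteredFamily_centeredFree (hν : MemLp id 2 ν) (hβ : β ≠ 0) (hε : 0 ≤ ε) (h : ℝ)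
    (hK : S.radius ≤ K) : IsCenteredFamily ν ε fun L => S.centeredFree β ε ν h K (box d L) where
  lip L η η' := by
    rw [centeredFree, centeredFree, sub_sub_sub_cancel_right]
    exact (((siteLipschitz_freeEnergy hβ hε h hK).condAv hε hν _).mono
      Finset.inter_subset_right hε) η η'
  mean L := by
    have hL := siteLipschitz_freeEnergy (S := S) hβ hε h hK
    simp only [centeredFree]
    rw [integral_sub ((hL.condAv hε hν _).integrable hν) (integrable_const _),
      integral_condAv (hL.integrable hν)]
    simp

lemma isCovariant_centeredFree (hν : MemLp id 2 ν) (hβ : β ≠ 0) (hε : 0 ≤ ε) (h : ℝ)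
    (hK : S.radius ≤ K) {L L' : ℕ} {x : Fin d → ℤ} (hLK : L ≤ K) (hLK' : L' ≤ K)
    (hx : translateSet (-x) (box d L') ⊆ box d L) :
    IsCovariant ν (fun L => S.centeredFree β ε ν h K (box d L)) L L' x := fun η => by
  have hL := siteLipschitz_freeEnergy (S := S) hβ hε h hK
  have integrable_condAv :=
    ((hL.condAv hε hν (box d L)).comp_splice_left hε (translateSet (-x) (box d L')) η).integrable hν
  change condAv ν _ (S.centeredFree β ε ν h K (box d L)) η
    = condAv ν (box d L') (S.freeEnergy β ε h K) (shiftField x η) - _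
  rw [← condAv_freeEnergy_translate hβ h (box_subset_box hLK') (hx.trans (box_subset_box hLK)) η,
    ← hL.condAv_condAv hε hν hx η]
  conv_lhs => unfold condAv centeredFree
  rw [integral_sub integrable_condAv (integrable_const _)]
  simp [condAv]

lemma secondDiff_eq (hν : MemLp id 2 ν) (hβ : β ≠ 0) (hε : 0 ≤ ε) (h δ : ℝ) (hK : S.radius ≤ K)
    (L : ℕ) (η : Fields d) :
    secondDiff S ν β ε h L K δ η = (1 / 2) *
      (condAv ν (box d L) (S.freeEnergy β ε (h + δ) K) η
        - condAv ν (box d L) (S.freeEnergy β ε (h + δ) K) 0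
        - condAv ν (box d L) (S.freeEnergy β ε (h - δ) K) η
        + condAv ν (box d L) (S.freeEnergy β ε (h - δ) K) 0) := by
  have integrable_splice (h : ℝ) (η : Fields d) :=
    ((siteLipschitz_freeEnergy (S := S) hβ hε h hK).comp_splice_left hε (box d L) η).integrable hν
  simp only [secondDiff, condAv, resetField_splice]
  rw [integral_sub_sub_add (integrable_splice _ η) (integrable_splice _ 0) (integrable_splice _ η)
    (integrable_splice _ 0)]

lemma centeredDiff_eq_halfDiff (hν : MemLp id 2 ν) (hβ : β ≠ 0) (hε : 0 ≤ ε) (h δ : ℝ)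
    (hK : S.radius ≤ K) (L : ℕ) (η : Fields d) :
    centeredDiff S ν β ε h L K δ η
      = halfDiff (fun L => S.centeredFree β ε ν (h + δ) K (box d L))
          (fun L => S.centeredFree β ε ν (h - δ) K (box d L)) L η := by
  have lip (h : ℝ) := siteLipschitz_freeEnergy (S := S) hβ hε h hK
  have integrable_condAv (h : ℝ) := ((lip h).condAv hε hν (box d L)).integrable hν
  rw [centeredDiff]
  simp only [secondDiff_eq hν hβ hε h δ hK]
  rw [integral_const_mul, integral_sub_sub_add (integrable_condAv _) (integrable_const _)
      (integrable_condAv _) (integrable_const _), integral_condAv ((lip _).integrable hν),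
    integral_condAv ((lip _).integrable hν)]
  simp only [integral_const, probReal_univ, one_smul, halfDiff, centeredFree]
  ring

end CenteredFree

section OriginSlope

variable (S β ε) in
omit [Nonempty σ] in
/-- The derivative in `t` of the free energy averaged with the field at the origin equal to `t`;
at zero temperature only a supergradient. -/
noncomputable def originSlope (ν : Measure ℝ) (h : ℝ) (K : ℕ) (t : ℝ) : ℝ :=
  ε * ∫ ω, S.stateKappa β ε h K (Function.update ω 0 t) 0 ∂(fieldLaw d ν)

variable {ν : Measure ℝ} [IsProbabilityMeasure ν]

lemma integrable_stateKappa_update (hK : S.radius ≤ K) (h t : ℝ) :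
    Integrable (fun ω : Fields d => S.stateKappa β ε h K (Function.update ω 0 t) 0)
      (fieldLaw d ν) :=
  Integrable.of_bound
    ((measurable_stateKappa h 0).comp measurable_update_left).aestronglyMeasurable 1
    (Eventually.of_forall fun _ => abs_stateKappa_le hK h _ 0)

lemma abs_originSlope_le (hε : 0 ≤ ε) (hK : S.radius ≤ K) (h t : ℝ) :
    |S.originSlope β ε ν h K t| ≤ ε := by
  have abs_mean_le : ‖∫ ω, S.stateKappa β ε h K (Function.update ω 0 t) 0 ∂(fieldLaw d ν)‖
      ≤ 1 * (fieldLaw d ν).real Set.univ :=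
    norm_integral_le_of_norm_le_const (Eventually.of_forall fun _ => abs_stateKappa_le hK h _ 0)
  rw [probReal_univ, mul_one, Real.norm_eq_abs] at abs_mean_le
  rw [originSlope, abs_mul, abs_of_nonneg hε]
  exact mul_le_of_le_one_right hε abs_mean_le

lemma freeEnergy_update_le (hβ : β ≠ 0) (h t u : ℝ) (K : ℕ) (ω : Fields d) :
    S.freeEnergy β ε h K (Function.update ω 0 u)
      ≤ S.freeEnergy β ε h K (Function.update ω 0 t)
        + ε * (u - t) * S.stateKappa β ε h K (Function.update ω 0 t) 0 := by
  refine (freeEnergy_le hβ h h K (Function.update ω 0 t) (Function.update ω 0 u)).trans_eq ?_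
  congr 1
  rw [Finset.sum_eq_single 0]
  · simp [rep_zero]
  · intro v _ hv
    have hr : rep v ≠ 0 := fun e => hv (rep_injective (e.trans rep_zero.symm))
    simp [Function.update_of_ne hr]
  · exact fun h0 => absurd (Finset.mem_univ _) h0

theorem isSupergrad_originSlope (hν : MemLp id 2 ν) (hβ : β ≠ 0) (hε : 0 ≤ ε)
    (hK : S.radius ≤ K) (h : ℝ) :
    IsSupergrad (fun t => S.centeredFree β ε ν h K (box d 0) fun _ => t)
      (S.originSlope β ε ν h K) := fun t u => by
  have integrable_update (t : ℝ) :
      Integrable (fun ω => S.freeEnergy β ε h K (Function.update ω 0 t)) (fieldLaw d ν) := by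
    simpa only [splice_box_zero] using ((siteLipschitz_freeEnergy (S := S) hβ hε h
      hK).comp_splice_left hε (box d 0) fun _ => t).integrable hν
  have integrable_slope := (integrable_stateKappa_update (S := S) (β := β) (ε := ε) (ν := ν)
    hK h t).const_mul (ε * (u - t))
  have mean_le := integral_mono (integrable_update u)
    ((integrable_update t).add integrable_slope) (freeEnergy_update_le hβ h t u K)
  rw [integral_add' (integrable_update t) integrable_slope, integral_const_mul] at mean_le
  simp only [centeredFree, condAv, splice_box_zero, originSlope]
  linarith

lemma stateKappa_update_sub_update_le (hβ : β ≠ 0) (hβ' : β ≠ ⊤) (hε : 0 ≤ ε)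
    (hK : S.radius ≤ K) (h : ℝ) {t u : ℝ} (htu : t ≤ u) (ω : Fields d) :
    S.stateKappa β ε h K (Function.update ω 0 t) 0
      - S.stateKappa β ε h K (Function.update ω 0 u) 0 ≤ 2 * β.toReal * (ε * (u - t)) := by
  have field_update : (fun v : Torus d K => h + ε * Function.update ω 0 u (rep v))
      = (fun v => h + ε * Function.update ω 0 t (rep v)) + Pi.single 0 (ε * (u - t)) := by
    funext v
    rw [Pi.add_apply, congrFun (update_zero_rep ω u) v, congrFun (update_zero_rep ω t) v]
    rcases eq_or_ne v 0 with rfl | hv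
    · simp only [Function.update_self, Pi.single_eq_same]
      ring
    · simp [hv]
  rw [stateKappa_eq_eqState, stateKappa_eq_eqState, field_update]
  exact eqState_torusKappa_sub_add_single_le hβ hβ' hK _ 0
    (mul_nonneg hε (sub_nonneg.2 htu))

theorem lipschitzWith_originSlope (hν : MemLp id 2 ν) (hβ : β ≠ 0) (hβ' : β ≠ ⊤) (hε : 0 ≤ ε)
    (hK : S.radius ≤ K) (h : ℝ) :
    LipschitzWith (2 * (β.toReal * ε ^ 2).toNNReal) (S.originSlope β ε ν h K) := by
  refine LipschitzWith.of_dist_le_mul fun t u => ?_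
  wlog htu : t ≤ u generalizing t u
  · rw [dist_comm, dist_comm t u]
    exact this u t (le_of_not_ge htu)
  have mean_le := integral_mono ((integrable_stateKappa_update (ν := ν) hK h t).sub
    (integrable_stateKappa_update hK h u)) (integrable_const _)
    (stateKappa_update_sub_update_le (S := S) hβ hβ' hε hK h htu)
  rw [integral_sub' (integrable_stateKappa_update hK h t) (integrable_stateKappa_update hK h u),
    integral_const, probReal_univ, one_smul] at mean_le
  rw [Real.dist_eq, abs_of_nonneg (sub_nonneg.2
    ((isSupergrad_originSlope (S := S) hν hβ hε hK h).antitone htu)), dist_comm, Real.dist_eq,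
    abs_of_nonneg (sub_nonneg.2 htu), originSlope, originSlope, ← mul_sub, NNReal.coe_mul,
    NNReal.coe_ofNat, Real.coe_toNNReal _ (by positivity)]
  calc _ ≤ ε * (2 * β.toReal * (ε * (u - t))) := mul_le_mul_of_nonneg_left mean_le hε
    _ = _ := by ring

lemma integral_originSlope (hν : MemLp id 2 ν) (hβ : β ≠ 0) (hε : 0 ≤ ε) (hK : S.radius ≤ K)
    (h : ℝ) :
    ∫ t, S.originSlope β ε ν h K t ∂ν
      = ε * ∫ η, S.stateKappa β ε h K η 0 ∂(fieldLaw d ν) := by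
  have eq_condAv (η : Fields d) : S.originSlope β ε ν h K (η 0)
      = ε * condAv ν (box d 0) (fun η => S.stateKappa β ε h K η 0) η := by
    simp only [originSlope, condAv, splice_box_zero]
  rw [← (measurePreserving_eval_fieldLaw ν (0 : Fin d → ℤ)).hasLaw.integral_comp
    (isSupergrad_originSlope hν hβ hε hK h).antitone.measurable.aestronglyMeasurable]
  simp only [Function.comp_apply, eq_condAv]
  rw [integral_const_mul, integral_condAv (integrable_stateKappa hK h 0)]

lemma originSlope_le_originSlope (hε : 0 ≤ ε) (hK : S.radius ≤ K) {h h' : ℝ}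
    (hs : ∀ η : Fields d, S.stateKappa β ε h' K η 0 ≤ S.stateKappa β ε h K η 0) (t : ℝ) :
    S.originSlope β ε ν h' K t ≤ S.originSlope β ε ν h K t :=
  mul_le_mul_of_nonneg_left (integral_mono (integrable_stateKappa_update hK h' t)
    (integrable_stateKappa_update hK h t) fun _ => hs _) hε

end OriginSlope

end LatticeSystem

section FieldSlope

/-- A supergradient `p` of `φ` with the bounds that hold for the derivative of a one-site free
energy in the field: `|p| ≤ ε`, and a Lipschitz bound at positive temperature. -/
structure IsFieldSlope (β : ℝ≥0∞) (ε : ℝ) (φ p : ℝ → ℝ) : Prop where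
  isSupergrad : IsSupergrad φ p
  bound : ∀ t, |p t| ≤ ε
  lipschitzWith : β ≠ ⊤ → LipschitzWith (2 * (β.toReal * ε ^ 2).toNNReal) p

namespace IsFieldSlope

variable {β : ℝ≥0∞} {ε : ℝ} {φ p : ℝ → ℝ} {φ' p' : ℕ → ℝ → ℝ}

lemma exists_of_tendsto (h : ∀ j, IsFieldSlope β ε (φ' j) (p' j))
    (hlim : ∀ t, Tendsto (fun j => φ' j t) atTop (𝓝 (φ t))) : ∃ p, IsFieldSlope β ε φ p := by
  have compact_box : IsCompact (Set.pi Set.univ fun _ : ℝ => Set.Icc (-ε) ε) :=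
    isCompact_univ_pi fun _ => isCompact_Icc
  obtain ⟨p, hp_mem, hp⟩ := compact_box.exists_mapClusterPt (f := atTop) (u := p')
    (tendsto_principal.2 (.of_forall fun j t _ => abs_le.1 ((h j).bound t)))
  exact ⟨p, .of_mapClusterPt (fun j => (h j).isSupergrad) hlim hp,
    fun t => abs_le.2 (hp_mem t trivial),
    fun hβ => (isClosed_setOfPred_lipschitzWith _).mem_of_mapClusterPt hp
      (.of_forall fun j => (h j).lipschitzWith hβ)⟩

variable {ν : Measure ℝ}

lemma integrable [IsFiniteMeasure ν] (h : IsFieldSlope β ε φ p) : Integrable p ν :=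
  .of_bound h.isSupergrad.antitone.measurable.aestronglyMeasurable ε (.of_forall h.bound)

lemma ae_continuousAt (h : IsFieldSlope β ε φ p) (hac : β = ⊤ → ν ≪ volume) :
    ∀ᵐ t ∂ν, ContinuousAt p t := by
  by_cases hβ : β = ⊤
  · exact (hac hβ).ae_le
      (h.isSupergrad.antitone.countable_not_continuousAt.ae_notMem volume |>.mono
        fun _ ht => not_not.1 ht)
  · exact .of_forall fun t => (h.lipschitzWith hβ).continuous.continuousAt

lemma tendsto_integral [IsFiniteMeasure ν] (h : IsFieldSlope β ε φ p)
    (h' : ∀ j, IsFieldSlope β ε (φ' j) (p' j))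
    (hlim : ∀ t, Tendsto (fun j => φ' j t) atTop (𝓝 (φ t))) (hac : β = ⊤ → ν ≪ volume) :
    Tendsto (fun j => ∫ t, p' j t ∂ν) atTop (𝓝 (∫ t, p t ∂ν)) :=
  h.isSupergrad.tendsto_integral (fun j => (h' j).isSupergrad) hlim (fun j => (h' j).bound)
    (h.ae_continuousAt hac)

end IsFieldSlope

lemma integrable_half_sub_eval {d : ℕ} {ν : Measure ℝ} [IsProbabilityMeasure ν] {p q : ℝ → ℝ}
    (hp : Integrable p ν) (hq : Integrable q ν) (x : Fin d → ℤ) :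
    Integrable (fun η : Fields d => (1 / 2) * (p (η x) - q (η x))) (fieldLaw d ν) :=
  (measurePreserving_eval_fieldLaw ν x).integrable_comp_of_integrable
    ((hp.sub hq).const_mul (1 / 2))

lemma integral_half_sub_eval {d : ℕ} {ν : Measure ℝ} [IsProbabilityMeasure ν] {p q : ℝ → ℝ}
    (hp : Integrable p ν) (hq : Integrable q ν) (x : Fin d → ℤ) :
    ∫ η : Fields d, (1 / 2) * (p (η x) - q (η x)) ∂(fieldLaw d ν)
      = (1 / 2) * (∫ t, p t ∂ν - ∫ t, q t ∂ν) := by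
  rw [← integral_sub hp hq, ← integral_const_mul]
  exact (measurePreserving_eval_fieldLaw ν x).hasLaw.integral_comp
    (f := fun t => (1 / 2) * (p t - q t)) ((hp.sub hq).const_mul (1 / 2)).aestronglyMeasurable

end FieldSlope

namespace LatticeSystem

variable {σ : Type*} [Fintype σ] [DecidableEq σ] {d : ℕ}

/-- `W` is an iterated limit, first along the box sizes `K j` and then along the fields `θ i`, of
the centered conditional free energies; `V i` is the intermediate limit at the field `θ i`. -/
structure IsIteratedLimit (S : LatticeSystem d σ) (ν : Measure ℝ) (β : ℝ≥0∞) (ε : ℝ) (θ : ℕ → ℝ)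
    (K : ℕ → ℕ) (V : ℕ → ℕ → Fields d → ℝ) (W : ℕ → Fields d → ℝ) : Prop where
  radius_le : ∀ j, S.radius ≤ K j
  tendsto_atTop : Tendsto K atTop atTop
  inner : ∀ i L η, Tendsto (fun j => S.centeredFree β ε ν (θ i) (K j) (box d L) η) atTop
    (𝓝 (V i L η))
  outer : ∀ L η, Tendsto (fun i => V i L η) atTop (𝓝 (W L η))

variable [Nonempty σ] {S : LatticeSystem d σ} {ν : Measure ℝ} [IsProbabilityMeasure ν] {β : ℝ≥0∞}
  {ε : ℝ}

theorem exists_isIteratedLimit (S : LatticeSystem d σ) (hν : MemLp id 2 ν) (hβ : β ≠ 0)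
    (hε : 0 ≤ ε) {ι : Type*} [Countable ι] (θ : ι → ℕ → ℝ) :
    ∃ (K ψ : ℕ → ℕ) (V : ι → ℕ → ℕ → Fields d → ℝ) (W : ι → ℕ → Fields d → ℝ),
      StrictMono ψ ∧ ∀ b, IsIteratedLimit S ν β ε (fun i => θ b (ψ i)) K (V b) (W b) := by
  have radius_le (j : ℕ) : S.radius ≤ S.radius + j := Nat.le_add_right _ _
  have centered (j : ℕ) (t : ℝ) := isCenteredFamily_centeredFree hν hβ hε t (radius_le j)
  obtain ⟨φ, hφ, V, hV⟩ := exists_subseq_tendsto_of_siteLipschitz (ι := ι × ℕ × ℕ)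
    (u := fun j p => S.centeredFree β ε ν (θ p.1 p.2.1) (S.radius + j) (box d p.2.2))
    (fun j p => (centered j _).lip p.2.2) (fun j p => (centered j _).abs_zero_le hν p.2.2)
  have centered_V (b : ι) (i : ℕ) : IsCenteredFamily ν ε fun L => V (b, i, L) :=
    .of_tendsto hν (fun j => centered (φ j) (θ b i)) fun L => hV (b, i, L)
  obtain ⟨ψ, hψ, W, hW⟩ := exists_subseq_tendsto_of_siteLipschitz (ι := ι × ℕ)
    (u := fun i p => V (p.1, i, p.2)) (fun i p => (centered_V p.1 i).lip p.2)
    (fun i p => (centered_V p.1 i).abs_zero_le hν p.2)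
  exact ⟨fun j => S.radius + φ j, ψ, fun b i L => V (b, ψ i, L), fun b L => W (b, L), hψ,
    fun b => ⟨fun j => radius_le _,
      tendsto_atTop_mono (fun j => Nat.le_add_left _ _) hφ.tendsto_atTop,
      fun i L => hV (b, ψ i, L), fun L => hW (b, L)⟩⟩

theorem exists_isIteratedLimit_add_sub (S : LatticeSystem d σ) (hν : MemLp id 2 ν) (hβ : β ≠ 0)
    (hε : 0 ≤ ε) (h : ℝ) :
    ∃ (K : ℕ → ℕ) (δ : ℕ → ℝ) (V V' : ℕ → ℕ → Fields d → ℝ) (W W' : ℕ → Fields d → ℝ),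
      (∀ i, 0 < δ i) ∧ Tendsto δ atTop (𝓝 0) ∧
      IsIteratedLimit S ν β ε (fun i => h + δ i) K V W ∧
      IsIteratedLimit S ν β ε (fun i => h - δ i) K V' W' := by
  obtain ⟨δ, -, δ_pos, hδ⟩ := exists_seq_strictAnti_tendsto (0 : ℝ)
  obtain ⟨K, ψ, V, W, hψ, hW⟩ := S.exists_isIteratedLimit (ν := ν) hν hβ hε
    fun b : Bool => cond b (fun i => h + δ i) fun i => h - δ i
  exact ⟨K, fun i => δ (ψ i), V true, V false, W true, W false, fun i => δ_pos _,
    hδ.comp hψ.tendsto_atTop, hW true, hW false⟩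

lemma isFieldSlope_originSlope (hν : MemLp id 2 ν) (hβ : β ≠ 0) (hε : 0 ≤ ε) {K : ℕ}
    (hK : S.radius ≤ K) (h : ℝ) :
    IsFieldSlope β ε (oneSite fun L => S.centeredFree β ε ν h K (box d L))
      (S.originSlope β ε ν h K) where
  isSupergrad := isSupergrad_originSlope hν hβ hε hK h
  bound := abs_originSlope_le hε hK h
  lipschitzWith hβ' := lipschitzWith_originSlope hν hβ hβ' hε hK h

section FreeEnergyDensity

variable {F : ℝ → ℝ} (hF : ∀ h, Tendsto (fun K : ℕ =>
  (∫ η, S.freeEnergy β ε h K η ∂(fieldLaw d ν)) / (box d K).card) atTop (𝓝 (F h)))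

include hF

lemma concaveOn_of_tendsto_integral_freeEnergy (hν : MemLp id 2 ν) (hβ : β ≠ 0) (hε : 0 ≤ ε) :
    ConcaveOn ℝ Set.univ F :=
  isClosed_setOfPred_concaveOn.mem_of_tendsto (tendsto_pi_nhds.2 hF)
    ((eventually_ge_atTop S.radius).mono fun _ hK =>
      (isSupergrad_integral_freeEnergy_div hν hβ hε hK).concaveOn)

/-- In finite volume the mean slope is `ε` times the mean of `⟨κ_0⟩`, which is a supergradient of
the mean free energy density. -/
lemma isSupergradAt_integral_of_isFieldSlope (hν : MemLp id 2 ν) (hβ : β ≠ 0)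
    (hac : β = ⊤ → ν ≪ volume) (hε : 0 ≤ ε) {K : ℕ → ℕ} (hK : ∀ j, S.radius ≤ K j)
    (hK' : Tendsto K atTop atTop) {t : ℝ} {φ q : ℝ → ℝ} (hφ : ∀ u, Tendsto
      (fun j => oneSite (fun L => S.centeredFree β ε ν t (K j) (box d L)) u) atTop (𝓝 (φ u)))
    (hq : IsFieldSlope β ε φ q) :
    IsSupergradAt (fun h => ε * F h) t (∫ u, q u ∂ν) := by
  refine IsSupergradAt.of_tendsto
    (fun j => (isSupergrad_integral_freeEnergy_div hν hβ hε (hK j) t).const_mul hε)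
    (fun u => ((hF u).comp hK').const_mul ε) ?_
  exact (hq.tendsto_integral (fun j => isFieldSlope_originSlope hν hβ hε (hK j) t) hφ hac).congr
    fun j => integral_originSlope hν hβ hε (hK j) t

end FreeEnergyDensity

namespace IsIteratedLimit

variable {θ θ' : ℕ → ℝ} {K : ℕ → ℕ} {V V' : ℕ → ℕ → Fields d → ℝ} {W W' : ℕ → Fields d → ℝ}

lemma isCenteredFamily_inner (hW : IsIteratedLimit S ν β ε θ K V W) (hν : MemLp id 2 ν)
    (hβ : β ≠ 0) (hε : 0 ≤ ε) (i : ℕ) : IsCenteredFamily ν ε (V i) :=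
  .of_tendsto hν (fun j => isCenteredFamily_centeredFree hν hβ hε (θ i) (hW.radius_le j))
    (hW.inner i)

lemma isCenteredFamily (hW : IsIteratedLimit S ν β ε θ K V W) (hν : MemLp id 2 ν) (hβ : β ≠ 0)
    (hε : 0 ≤ ε) : IsCenteredFamily ν ε W :=
  .of_tendsto hν (hW.isCenteredFamily_inner hν hβ hε) hW.outer

lemma isCovariant (hW : IsIteratedLimit S ν β ε θ K V W) (hν : MemLp id 2 ν) (hβ : β ≠ 0)
    (hε : 0 ≤ ε) {L L' : ℕ} {x : Fin d → ℤ} (hx : translateSet (-x) (box d L') ⊆ box d L) :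
    IsCovariant ν W L L' x := by
  refine .of_tendsto hν hε (hW.isCenteredFamily_inner hν hβ hε) hW.outer (.of_forall fun i => ?_)
  refine .of_tendsto hν hε (fun j => isCenteredFamily_centeredFree hν hβ hε (θ i)
    (hW.radius_le j)) (hW.inner i) ?_
  filter_upwards [hW.tendsto_atTop.eventually_ge_atTop L, hW.tendsto_atTop.eventually_ge_atTop L']
    with j hL hL'
  exact isCovariant_centeredFree hν hβ hε (θ i) (hW.radius_le j) hL hL' hx

lemma exists_isFieldSlope_inner (hW : IsIteratedLimit S ν β ε θ K V W) (hν : MemLp id 2 ν)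
    (hβ : β ≠ 0) (hε : 0 ≤ ε) (i : ℕ) : ∃ q, IsFieldSlope β ε (oneSite (V i)) q :=
  IsFieldSlope.exists_of_tendsto (fun j => isFieldSlope_originSlope hν hβ hε (hW.radius_le j) (θ i))
    fun _ => hW.inner i 0 _

lemma exists_isFieldSlope (hW : IsIteratedLimit S ν β ε θ K V W) (hν : MemLp id 2 ν) (hβ : β ≠ 0)
    (hε : 0 ≤ ε) : ∃ p, IsFieldSlope β ε (oneSite W) p := by
  choose q hq using hW.exists_isFieldSlope_inner hν hβ hε
  exact IsFieldSlope.exists_of_tendsto hq fun _ => hW.outer 0 _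

theorem integral_slope_eq (hW : IsIteratedLimit S ν β ε θ K V W) (hν : MemLp id 2 ν)
    (hβ : β ≠ 0) (hac : β = ⊤ → ν ≪ volume) (hε : 0 ≤ ε) {F p : ℝ → ℝ}
    (hF : ∀ h, Tendsto (fun K : ℕ =>
      (∫ η, S.freeEnergy β ε h K η ∂(fieldLaw d ν)) / (box d K).card) atTop (𝓝 (F h)))
    (hp : IsFieldSlope β ε (oneSite W) p) {h D : ℝ} {s : Set ℝ} (hD : HasDerivWithinAt F D s h)
    (hθ : Tendsto θ atTop (𝓝 h)) (hθh : ∀ i, θ i ≠ h) (hθs : ∀ i, θ i ∈ s)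
    (hθs' : ∀ i, 2 * θ i - h ∈ s) : ∫ t, p t ∂ν = ε * D := by
  choose q hq using hW.exists_isFieldSlope_inner hν hβ hε
  refine tendsto_nhds_unique (hp.tendsto_integral hq (fun _ => hW.outer 0 _) hac) ?_
  exact tendsto_of_isSupergradAt (hD.const_mul ε) hθ hθh hθs hθs' fun i =>
    isSupergradAt_integral_of_isFieldSlope hF hν hβ hac hε hW.radius_le hW.tendsto_atTop
      (fun _ => hW.inner i 0 _) (hq i)

theorem monotone_oneSite_halfDiff (hW : IsIteratedLimit S ν β ε θ K V W)
    (hW' : IsIteratedLimit S ν β ε θ' K V' W') (hν : MemLp id 2 ν) (hβ : β ≠ 0) (hε : 0 ≤ ε)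
    (hκ : ∀ i, ∀ᶠ j in atTop, ∀ η : Fields d,
      S.stateKappa β ε (θ' i) (K j) η 0 ≤ S.stateKappa β ε (θ i) (K j) η 0) :
    Monotone (oneSite (halfDiff W W')) := fun a b hab => by
  have increments_le : oneSite W' b - oneSite W' a ≤ oneSite W b - oneSite W a := by
    refine le_of_tendsto_of_tendsto' ((hW'.outer 0 _).sub (hW'.outer 0 _))
      ((hW.outer 0 _).sub (hW.outer 0 _)) fun i => ?_
    refine le_of_tendsto_of_tendsto ((hW'.inner i 0 _).sub (hW'.inner i 0 _))
      ((hW.inner i 0 _).sub (hW.inner i 0 _)) ((hκ i).mono fun j hj => ?_)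
    exact (isSupergrad_originSlope hν hβ hε (hW.radius_le j) (θ i)).sub_le_sub_of_le
      (isSupergrad_originSlope hν hβ hε (hW.radius_le j) (θ' i))
      (originSlope_le_originSlope hε (hW.radius_le j) hj) hab
  simp only [oneSite, halfDiff] at increments_le ⊢
  linarith

theorem antitone_oneSite_halfDiff (hW : IsIteratedLimit S ν β ε θ K V W)
    (hW' : IsIteratedLimit S ν β ε θ' K V' W') (hν : MemLp id 2 ν) (hβ : β ≠ 0) (hε : 0 ≤ ε)
    (hκ : ∀ i, ∀ᶠ j in atTop, ∀ η : Fields d,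
      S.stateKappa β ε (θ i) (K j) η 0 ≤ S.stateKappa β ε (θ' i) (K j) η 0) :
    Antitone (oneSite (halfDiff W W')) := fun a b hab => by
  have swapped := hW'.monotone_oneSite_halfDiff hW hν hβ hε hκ hab
  simp only [oneSite, halfDiff] at swapped ⊢
  linarith

section AddSub

variable {h : ℝ} {δ : ℕ → ℝ}

lemma integral_slope_eq_of_add (hW : IsIteratedLimit S ν β ε (fun i => h + δ i) K V W)
    (hν : MemLp id 2 ν) (hβ : β ≠ 0) (hac : β = ⊤ → ν ≪ volume) (hε : 0 ≤ ε)
    (hδ : ∀ i, 0 < δ i) (hδ0 : Tendsto δ atTop (𝓝 0)) {F p : ℝ → ℝ}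
    (hF : ∀ h, Tendsto (fun K : ℕ =>
      (∫ η, S.freeEnergy β ε h K η ∂(fieldLaw d ν)) / (box d K).card) atTop (𝓝 (F h)))
    (hp : IsFieldSlope β ε (oneSite W) p) {D : ℝ} (hD : HasDerivWithinAt F D (Set.Ioi h) h) :
    ∫ t, p t ∂ν = ε * D :=
  hW.integral_slope_eq hν hβ hac hε hF hp hD (by simpa using hδ0.const_add h)
    (fun i => (lt_add_of_pos_right h (hδ i)).ne') (fun i => lt_add_of_pos_right h (hδ i))
    fun i => Set.mem_Ioi.2 (by linarith [hδ i])

lemma integral_slope_eq_of_sub (hW : IsIteratedLimit S ν β ε (fun i => h - δ i) K V W)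
    (hν : MemLp id 2 ν) (hβ : β ≠ 0) (hac : β = ⊤ → ν ≪ volume) (hε : 0 ≤ ε)
    (hδ : ∀ i, 0 < δ i) (hδ0 : Tendsto δ atTop (𝓝 0)) {F p : ℝ → ℝ}
    (hF : ∀ h, Tendsto (fun K : ℕ =>
      (∫ η, S.freeEnergy β ε h K η ∂(fieldLaw d ν)) / (box d K).card) atTop (𝓝 (F h)))
    (hp : IsFieldSlope β ε (oneSite W) p) {D : ℝ} (hD : HasDerivWithinAt F D (Set.Iio h) h) :
    ∫ t, p t ∂ν = ε * D :=
  hW.integral_slope_eq hν hβ hac hε hF hp hD (by simpa using hδ0.const_sub h)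
    (fun i => (sub_lt_self h (hδ i)).ne) (fun i => sub_lt_self h (hδ i))
    fun i => Set.mem_Iio.2 (by linarith [hδ i])

lemma tendsto_centeredDiff (hW : IsIteratedLimit S ν β ε (fun i => h + δ i) K V W)
    (hW' : IsIteratedLimit S ν β ε (fun i => h - δ i) K V' W') (hν : MemLp id 2 ν) (hβ : β ≠ 0)
    (hε : 0 ≤ ε) (i L : ℕ) (η : Fields d) :
    Tendsto (fun j => centeredDiff S ν β ε h L (K j) (δ i) η) atTop
      (𝓝 (halfDiff (V i) (V' i) L η)) := by
  simp only [centeredDiff_eq_halfDiff hν hβ hε h (δ i) (hW.radius_le _)]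
  exact ((hW.inner i L η).sub (hW'.inner i L η)).const_mul _

theorem exists_isDistribDeriv_oneSite_halfDiff
    (hW : IsIteratedLimit S ν β ε (fun i => h + δ i) K V W)
    (hW' : IsIteratedLimit S ν β ε (fun i => h - δ i) K V' W') (hν : MemLp id 2 ν) (hβ : β ≠ 0)
    (hac : β = ⊤ → ν ≪ volume) (hε : 0 ≤ ε) (hδ : ∀ i, 0 < δ i) (hδ0 : Tendsto δ atTop (𝓝 0))
    {F : ℝ → ℝ} (hF : ∀ h, Tendsto (fun K : ℕ =>
      (∫ η, S.freeEnergy β ε h K η ∂(fieldLaw d ν)) / (box d K).card) atTop (𝓝 (F h))) :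
    ∃ G' : ℝ → ℝ, IsDistribDeriv (oneSite (halfDiff W W')) G' ∧
      (β ≠ ⊤ → LipschitzWith (β.toReal * ε ^ 2).toNNReal G') ∧
      Integrable (fun η => G' (η 0)) (fieldLaw d ν) ∧
      ∃ D D' : ℝ, HasDerivWithinAt F D (Set.Ioi h) h ∧ HasDerivWithinAt F D' (Set.Iio h) h ∧
        ∫ η, G' (η 0) ∂(fieldLaw d ν) = ε / 2 * (D - D') := by
  have concave := concaveOn_of_tendsto_integral_freeEnergy hF hν hβ hε
  obtain ⟨p, hp⟩ := hW.exists_isFieldSlope hν hβ hε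
  obtain ⟨q, hq⟩ := hW'.exists_isFieldSlope hν hβ hε
  obtain ⟨D, hD⟩ := hasDerivWithinAt_Ioi_of_concaveOn concave h
  obtain ⟨D', hD'⟩ := hasDerivWithinAt_Iio_of_concaveOn concave h
  refine ⟨fun t => (1 / 2) * (p t - q t),
    hp.isSupergrad.isDistribDeriv_half_sub hq.isSupergrad,
    fun hβ' => lipschitzWith_half_sub_of_antitone hp.isSupergrad.antitone hq.isSupergrad.antitone
      (hp.lipschitzWith hβ') (hq.lipschitzWith hβ'),
    integrable_half_sub_eval hp.integrable hq.integrable 0, D, D', hD, hD', ?_⟩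
  rw [integral_half_sub_eval hp.integrable hq.integrable,
    hW.integral_slope_eq_of_add hν hβ hac hε hδ hδ0 hF hp hD,
    hW'.integral_slope_eq_of_sub hν hβ hac hε hδ hδ0 hF hq hD']
  ring

lemma monotone_oneSite_halfDiff_of_weakFKG
    (hW : IsIteratedLimit S ν β ε (fun i => h + δ i) K V W)
    (hW' : IsIteratedLimit S ν β ε (fun i => h - δ i) K V' W') (hν : MemLp id 2 ν) (hβ : β ≠ 0)
    (hε : 0 ≤ ε) (hδ : ∀ i, 0 < δ i) (hκ : S.WeakFKG β ε) :
    Monotone (oneSite (halfDiff W W')) :=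
  hW.monotone_oneSite_halfDiff hW' hν hβ hε fun i =>
    (hW.tendsto_atTop.eventually hκ).mono fun _ hj η =>
      hj 0 _ _ η η (by linarith [hδ i]) fun _ _ => le_rfl

lemma antitone_oneSite_halfDiff_of_weakFKGNeg
    (hW : IsIteratedLimit S ν β ε (fun i => h + δ i) K V W)
    (hW' : IsIteratedLimit S ν β ε (fun i => h - δ i) K V' W') (hν : MemLp id 2 ν) (hβ : β ≠ 0)
    (hε : 0 ≤ ε) (hδ : ∀ i, 0 < δ i) (hκ : S.WeakFKGNeg β ε) :
    Antitone (oneSite (halfDiff W W')) :=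
  hW.antitone_oneSite_halfDiff hW' hν hβ hε fun i =>
    (hW.tendsto_atTop.eventually hκ).mono fun _ hj η =>
      hj 0 _ _ η η (by linarith [hδ i]) fun _ _ => le_rfl

end AddSub

end IsIteratedLimit

end LatticeSystem

end DisorderedLattice

open DisorderedLattice DisorderedLattice.LatticeSystem

theorem mainTheorem4 {d : ℕ} (hd : 1 ≤ d) {σ : Type*} [Fintype σ] [DecidableEq σ] [Nonempty σ]
    (S : DisorderedLattice.LatticeSystem d σ)
    (ν : MeasureTheory.Measure ℝ) [MeasureTheory.IsProbabilityMeasure ν]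
    (hν : MeasureTheory.MemLp id 2 ν)
    (β : ENNReal) (hβ : β ≠ 0) (hac : β = ⊤ → ν ≪ MeasureTheory.volume)
    (ε : ℝ) (hε : 0 ≤ ε) :
    ∃ F : ℝ → ℝ, DisorderedLattice.IsFreeEnergyDensity S ν β ε F ∧
      ∀ h : ℝ, ∃ (K : ℕ → ℕ) (δ : ℕ → ℝ) (G : ℕ → DisorderedLattice.Fields d → ℝ),
        Tendsto K atTop atTop ∧ (∀ i, 0 < δ i) ∧ Tendsto δ atTop (𝓝 0) ∧
        -- the iterated limits exist
        (∃ Gδ : ℕ → ℕ → DisorderedLattice.Fields d → ℝ, ∀ L η,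
          (∀ i, Tendsto (fun j => DisorderedLattice.centeredDiff S ν β ε h L (K j) (δ i) η)
            atTop (𝓝 (Gδ L i η))) ∧
          Tendsto (fun i => Gδ L i η) atTop (𝓝 (G L η))) ∧
        -- mean zero
        (∀ L, MeasureTheory.Integrable (G L) (DisorderedLattice.fieldLaw d ν) ∧
          ∫ η, G L η ∂(DisorderedLattice.fieldLaw d ν) = 0) ∧
        -- locality
        (∀ L η η', (∀ x ∈ DisorderedLattice.box d L, η x = η' x) → G L η = G L η') ∧
        -- Lipschitz bound
        (∀ L, DisorderedLattice.lipSeminorm (G L) ≤ ENNReal.ofReal ε) ∧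
        -- martingale property and translation covariance
        (∀ (L L' : ℕ) (x : Fin d → ℤ) (Λ : Finset (Fin d → ℤ)),
          DisorderedLattice.translateSet (-x) (DisorderedLattice.box d L') = Λ →
          Λ ⊆ DisorderedLattice.box d L →
          ∀ η, DisorderedLattice.condAv ν Λ (G L) η
            = G L' (DisorderedLattice.shiftField x η)) ∧
        -- the derivative of the one-site function
        (∃ G' : ℝ → ℝ,
          DisorderedLattice.IsDistribDeriv (DisorderedLattice.oneSite G) G' ∧
          (β ≠ ⊤ → LipschitzWith (Real.toNNReal (β.toReal * ε ^ 2)) G') ∧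
          MeasureTheory.Integrable (fun η => G' (η 0)) (DisorderedLattice.fieldLaw d ν) ∧
          ∃ Dplus Dminus : ℝ,
            HasDerivWithinAt F Dplus (Set.Ioi h) h ∧
            HasDerivWithinAt F Dminus (Set.Iio h) h ∧
            ∫ η, G' (η 0) ∂(DisorderedLattice.fieldLaw d ν) = ε / 2 * (Dplus - Dminus)) ∧
        -- monotonicity
        (S.WeakFKG β ε → Monotone (DisorderedLattice.oneSite G)) ∧
        (S.WeakFKGNeg β ε → Antitone (DisorderedLattice.oneSite G)) := by
  obtain ⟨F, hF, hmean⟩ := S.exists_isFreeEnergyDensity hd hν hβ hε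
  refine ⟨F, hF, fun h => ?_⟩
  obtain ⟨K, δ, V, V', W, W', hδ, hδ0, hW, hW'⟩ := S.exists_isIteratedLimit_add_sub hν hβ hε h
  have centered := hW.isCenteredFamily hν hβ hε
  have centered' := hW'.isCenteredFamily hν hβ hε
  have hG := centered.halfDiff hν centered'
  refine ⟨K, δ, halfDiff W W', hW.tendsto_atTop, hδ, hδ0,
    ⟨fun L i => halfDiff (V i) (V' i) L, fun L η => ⟨fun i =>
      hW.tendsto_centeredDiff hW' hν hβ hε i L η,
      ((hW.outer L η).sub (hW'.outer L η)).const_mul _⟩⟩,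
    fun L => ⟨hG.integrable hν L, hG.mean L⟩, fun L _ _ => (hG.lip L).congr,
    fun L => lipSeminorm_le_of_siteLipschitz hε (hG.lip L), ?_,
    hW.exists_isDistribDeriv_oneSite_halfDiff hW' hν hβ hac hε hδ hδ0 hmean,
    hW.monotone_oneSite_halfDiff_of_weakFKG hW' hν hβ hε hδ,
    hW.antitone_oneSite_halfDiff_of_weakFKGNeg hW' hν hβ hε hδ⟩
  rintro L L' x _ rfl hx
  exact IsCovariant.halfDiff hν hε centered centered' (hW.isCovariant hν hβ hε hx)
    (hW'.isCovariant hν hβ hε hx)
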